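/- **Setting.** Let $(t,x_1,x_2,x_3)$ be the coordinates of $\mathbb{R}^4=\mathbb{R}\times\mathbb{R}^3$, let $M\subset\mathbb{R}^4\setminus\{0\}$ be open, and let $\mathcal{A}\subset TM\setminus 0$ be a conic subbundle, i.e. an open set that projects onto $M$ and is stable under $(x,\dot x)\mapsto(x,\lambda\dot x)$, $\lambda>0$. Write $\partial_a=\partial/\partial x^a$, $\dot\partial_a=\partial/\partial\dot x^a$. A pseudo-Finsler function is a smooth $L:\mathcal{A}\to\mathbb{R}$ with $L(x,\lambda\dot x)=\lambda^2L(x,\dot x)$ for $\lambda>0$ and with $g_{ab}=\frac12\dot\partial_a\dot\partial_bL$ nonsingular on $\mathcal{A}$ (of any signature). Its canonical spray and nonlinear connection have the coefficients $G^a=\frac14g^{ab}(\dot x^c\partial_c\dot\partial_bL-\partial_bL)$ and $G^a{}_b=\dot\partial_bG^a$, and $\delta_a=\partial_a-G^b{}_a\dot\partial_b$. The function $L$ is *Berwald* if $2G^c=\Gamma^c_{ab}(x)\dot x^a\dot x^b$ on $\mathcal{A}$ for a torsion-free affine connection $\nabla$ on $M$ with coefficients $\Gamma^c_{ab}$; this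 $\nabla$ is then unique and is called the canonical affine connection of $L$. The *holonomy distribution* $\mathcal{D}_{\mathcal{H}}$ on $\mathcal{A}$ is spanned at each point by all the vector fields $\delta_a$, $[\delta_a,\delta_b]$, $[\delta_a,[\delta_b,\delta_c]]$, $\dots$, and $\mathcal{V}(\mathcal{D}_{\mathcal{H}})$ is its intersection with the vertical distribution $\mathrm{Span}\{\dot\partial_a\}$. The function $L$ is *spatially spherically symmetric* if $X^C(L)=0$ on $\mathcal{A}$ for the generators $X=x_i\partial_{x_j}-x_j\partial_{x_i}$ ($1\le i,j\le3$) of the rotations of $\mathbb{R}^3$, where $X^C=X^a\partial_a+\dot x^b(\partial_bX^a)\dot\partial_a$. It is *non-Riemannian* if there is no nonempty open set $U\subset M$ over which $L$ is quadratic in $\dot x$, in the sense that every $(x,\dot x)\in\mathcal{A}$ with $x\in U$ has a neighbourhood in the fibre $\mathcal{A}\cap T_xM$ on which $L(x,\cdot)$ coincides with a quadratic form. Finally, $L$ *admits an affinely equivalent pseudo-Riemannian metric* if every point of $M$ has an open neighbourhood $U\subset M$ carrying a smooth pseudo-Riemannian metric, of some signature, whose Levi-Civita connection is $\nabla|_U$.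 **Theorem.** Let $L:\mathcal{A}\to\mathbb{R}$ be a spatially spherically symmetric, non-Riemannian Berwald pseudo-Finsler function of arbitrary signature, over an open set $M\subset\mathbb{R}^4\setminus\{0\}$. Then $L$ admits an affinely equivalent pseudo-Riemannian metric if and only if both of the following hold: 1. $\dim\mathcal{V}(\mathcal{D}_{\mathcal{H}})\le2$ at every point of $\mathcal{A}$; 2. the Ricci tensor of the canonical affine connection $\nabla$ of $L$ is symmetric on $M$. -/

import Mathlib

open Set Filter Topology
open scoped ContDiff

noncomputable section

namespace BerwaldFinsler

/-- The coordinate space `ℝ⁴`, with coordinates `(t, x₁, x₂, x₃)`; index `0` is the time `t`. -/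
abbrev R4 : Type := Fin 4 → ℝ

/-- The tangent bundle `Tℝ⁴ = ℝ⁴ × ℝ⁴`; a point is a pair `(x, v)` of a base point and a velocity. -/
abbrev TR4 : Type := R4 × R4

/-- The coordinate vector `e_a`. -/
def e (a : Fin 4) : R4 := Pi.single a 1

/-- The derivative `∂f/∂x^a` of a function on the base. -/
def pd (a : Fin 4) (f : R4 → ℝ) (x : R4) : ℝ := fderiv ℝ f x (e a)

/-- The derivative `∂F/∂x^a` of a function on the tangent bundle. -/
def dx (a : Fin 4) (F : TR4 → ℝ) (p : TR4) : ℝ := fderiv ℝ F p (e a, 0)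

/-- The derivative `∂F/∂v^a` of a function on the tangent bundle. -/
def dv (a : Fin 4) (F : TR4 → ℝ) (p : TR4) : ℝ := fderiv ℝ F p (0, e a)

/-! ### Pseudo-Finsler structures -/

/-- `A` is a conic subbundle of `TM` without its zero section, for an open set `M`: it is open,
projects onto `M`, avoids zero vectors and is stable under positive rescaling of vectors. -/
structure IsConicSubbundle (M : Set R4) (A : Set TR4) : Prop where
  isOpen : IsOpen A
  proj : Prod.fst '' A = M
  ne_zero : ∀ x v, (x, v) ∈ A → v ≠ 0
  smul_mem : ∀ x v, (x, v) ∈ A → ∀ c : ℝ, 0 < c → (x, c • v) ∈ A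

/-- The Finslerian metric tensor `g_ab = (1/2) ∂²L/∂v^a∂v^b`. -/
def fundTensor (L : TR4 → ℝ) (p : TR4) : Matrix (Fin 4) (Fin 4) ℝ :=
  Matrix.of fun a b => (1 / 2) * dv a (dv b L) p

/-- `L` is a pseudo-Finsler function (of any signature) on the conic subbundle `A` of `TM`.
Only the values of `L` on `A` matter. -/
structure IsPseudoFinsler (M : Set R4) (A : Set TR4) (L : TR4 → ℝ) : Prop where
  conic : IsConicSubbundle M A
  smooth : ContDiffOn ℝ ∞ L A
  homogeneous : ∀ x v, (x, v) ∈ A → ∀ c : ℝ, 0 < c → L (x, c • v) = c ^ 2 * L (x, v)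
  nondegenerate : ∀ p ∈ A, (fundTensor L p).det ≠ 0

/-- The coefficients `G^a = (1/4) g^{ab} (v^c ∂_c ∂̇_b L - ∂_b L)` of the canonical spray. -/
def sprayCoeff (L : TR4 → ℝ) (a : Fin 4) (p : TR4) : ℝ :=
  (1 / 4) * ∑ b, (fundTensor L p)⁻¹ a b * ((∑ c, p.2 c * dx c (dv b L) p) - dx b L p)

/-- The coefficients `G^a_b = ∂G^a/∂v^b` of the canonical nonlinear connection. -/
def nonlinConn (L : TR4 → ℝ) (a b : Fin 4) (p : TR4) : ℝ := dv b (sprayCoeff L a) p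

/-- Coefficients of affine connections: `Γ x c a b` stands for `Γ^c_{ab}(x)`. -/
abbrev ConnCoeff : Type := R4 → Fin 4 → Fin 4 → Fin 4 → ℝ

/-- `Γ` is a torsion-free affine connection on `M` with `2 G^c = Γ^c_{ab}(x) v^a v^b` on `A`.
If such a `Γ` exists then `L` is a Berwald function, and `Γ`, which is determined on `M` because
every fibre of `A` is open and nonempty, is its canonical affine connection. -/
def IsCanonicalConnection (M : Set R4) (A : Set TR4) (L : TR4 → ℝ) (Γ : ConnCoeff) : Prop :=
  (∀ x ∈ M, ∀ c a b, Γ x c a b = Γ x c b a) ∧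
  ∀ p ∈ A, ∀ c, 2 * sprayCoeff L c p = ∑ a, ∑ b, Γ p.1 c a b * p.2 a * p.2 b

/-! ### The holonomy distribution -/

/-- The horizontal vector field `δ_a = ∂_a - G^b_a ∂̇_b`. -/
def horiz (L : TR4 → ℝ) (a : Fin 4) : TR4 → TR4 :=
  fun p => (e a, fun b => -nonlinConn L b a p)

/-- The vector fields `δ_a`, `[δ_a, δ_b]`, `[δ_a, [δ_b, δ_c]]`, and so on. -/
inductive IsIteratedBracket (L : TR4 → ℝ) : (TR4 → TR4) → Prop
  | base (a : Fin 4) : IsIteratedBracket L (horiz L a)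
  | bracket (a : Fin 4) (X : TR4 → TR4) (hX : IsIteratedBracket L X) :
      IsIteratedBracket L (VectorField.lieBracket ℝ (horiz L a) X)

/-- The holonomy distribution at `p`: the span of the values at `p` of the horizontal fields and
all their successive brackets. -/
def holonomyDistribution (L : TR4 → ℝ) (p : TR4) : Submodule ℝ TR4 :=
  Submodule.span ℝ {w | ∃ X, IsIteratedBracket L X ∧ X p = w}

/-- The vertical part of the holonomy distribution at `p`: its intersection with the kernel of
the differential of the projection `(x, v) ↦ x`. -/
def verticalHolonomy (L : TR4 → ℝ) (p : TR4) : Submodule ℝ TR4 :=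
  holonomyDistribution L p ⊓ LinearMap.ker (LinearMap.fst ℝ R4 R4)

/-! ### Curvature of the affine connection -/

/-- The curvature `R_e^a_{bc}` of the affine connection `Γ`, i.e. the `v^e`-derivative of
`R^a_{bc} = δ_c N^a_b - δ_b N^a_c` with `N^a_b = Γ^a_{be} v^e`. -/
def affineCurv (Γ : ConnCoeff) (x : R4) (i a b c : Fin 4) : ℝ :=
  pd c (fun y => Γ y a b i) x - pd b (fun y => Γ y a c i) x
    + ∑ d, (Γ x a c d * Γ x d b i - Γ x a b d * Γ x d c i)

/-- The Ricci tensor `R_bc = R_b^a_{ca}`. -/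
def ricci (Γ : ConnCoeff) (x : R4) (b c : Fin 4) : ℝ := ∑ a, affineCurv Γ x b a c a

/-! ### Pseudo-Riemannian metrics -/

/-- `g` is a (smooth) pseudo-Riemannian metric, of any signature, on the open set `U`. -/
structure IsPseudoRiemannian (U : Set R4) (g : R4 → Matrix (Fin 4) (Fin 4) ℝ) : Prop where
  smooth : ∀ i j, ContDiffOn ℝ ∞ (fun x => g x i j) U
  symm : ∀ x ∈ U, ∀ i j, g x i j = g x j i
  nondegenerate : ∀ x ∈ U, (g x).det ≠ 0

/-- The Christoffel symbols of the Levi-Civita connection of `g`. -/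
def christoffel (g : R4 → Matrix (Fin 4) (Fin 4) ℝ) : ConnCoeff := fun x c a b =>
  (1 / 2) * ∑ d, (g x)⁻¹ c d *
    (pd a (fun y => g y b d) x + pd b (fun y => g y a d) x - pd d (fun y => g y a b) x)

/-- Around every point of `M` there is a pseudo-Riemannian metric whose Levi-Civita connection
is `Γ`. -/
def IsLocallyRiemannMetrizable (M : Set R4) (Γ : ConnCoeff) : Prop :=
  ∀ x ∈ M, ∃ U : Set R4, IsOpen U ∧ x ∈ U ∧ U ⊆ M ∧
    ∃ g : R4 → Matrix (Fin 4) (Fin 4) ℝ, IsPseudoRiemannian U g ∧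
      ∀ y ∈ U, ∀ c a b, christoffel g y c a b = Γ y c a b

/-- Near `p`, the function `L` restricted to the tangent space at the base point of `p` is a
quadratic form in the velocity. -/
def IsQuadraticNear (L : TR4 → ℝ) (p : TR4) : Prop :=
  ∃ a : Matrix (Fin 4) (Fin 4) ℝ,
    ∀ᶠ w in 𝓝 p.2, L (p.1, w) = ∑ i, ∑ j, a i j * w i * w j

/-- `L` is nowhere Riemannian: on no nonempty open subset `U` of `M` is `L` a (locally)
quadratic function of the velocities. -/
def IsNonRiemannian (M : Set R4) (A : Set TR4) (L : TR4 → ℝ) : Prop :=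
  ∀ U : Set R4, IsOpen U → U ⊆ M → U.Nonempty →
    ¬ ∀ p ∈ A, p.1 ∈ U → IsQuadraticNear L p

/-! ### Spherical symmetry -/

/-- The infinitesimal rotation `x^i ∂_j - x^j ∂_i`; for spatial indices `i, j` these generate the
action of `SO(3)` on `ℝ⁴ = ℝ × ℝ³`. -/
def rotField (i j : Fin 4) : R4 → R4 := fun x => x i • e j - x j • e i

/-- The complete lift `X^C = X^a ∂_a + v^b (∂_b X^a) ∂̇_a` of a vector field. -/
def completeLift (X : R4 → R4) : TR4 → TR4 := fun p => (X p.1, fderiv ℝ X p.1 p.2)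

/-- `L` is spatially spherically symmetric: the generators of `SO(3)` are Killing fields of `L`,
`X^C(L) = 0` on `A`. -/
def IsSphericallySymmetric (A : Set TR4) (L : TR4 → ℝ) : Prop :=
  ∀ i j : Fin 4, i ≠ 0 → j ≠ 0 → ∀ p ∈ A, fderiv ℝ L p (completeLift (rotField i j) p) = 0

end BerwaldFinsler

end

open BerwaldFinsler

/-!
# Metrizability of spherically symmetric Berwald functions

Write `B` for the connection form of the canonical connection, `R` for its curvature and `ℓ` for
the restriction of `L` to a tangent space. Since `L` is Berwald, it is constant along the horizontal
fields `(a, -B a v)` (`fderiv_horizField_eq_zero`), hence along all their brackets. In particular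
parallel transport identifies the functions `ℓ` of different tangent spaces, and the endomorphisms
`R(a, b)` are symmetries of `ℓ` (`isSym_curv`), meaning that `dℓ(N v) = 0` for all `v`. The Ricci
tensor is symmetric exactly when all `R(a, b)` have trace zero (`ricci_sub_ricci`).

*Necessity.* If `g` is a metric with the given connection, then `R(a, b)` is `g`-antisymmetric, so
its trace vanishes. The iterated brackets that define the holonomy distribution are horizontal
fields or vertical fields `(0, N v)`, with endomorphisms `N` that preserve both `L` and `g(v, v)`
(`IsIteratedBracket.horizontal_or_vertical`). If their values were three-dimensional at some point,
they would be so over a neighbourhood and on a dense set of vectors in each fibre. There `dℓ` is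
proportional to the differential of `g(v, v)`, so `ℓ` is locally a multiple of it; hence the third
derivative of `ℓ` vanishes on a dense set, thus everywhere, and `L` is Riemannian over an open set
(`IsLocallyRiemannMetrizable.finrank_le_two`).

*Sufficiency.* A metric is obtained from a form on one tangent space by parallel transport along
rays, and it is parallel as soon as the form is preserved by the transported curvature
endomorphisms (`IsRadiallyParallel.hasFDerivAt`, a Grönwall estimate). So the point is to find a
nondegenerate symmetric form on one tangent space for which all these symmetries of `ℓ` are
antisymmetric (`exists_form`). If `ℓ` is quadratic somewhere this is clear. Otherwise the rotation
about the axis through the base point gives a symmetry of `ℓ` conjugate to the standard rotation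
generator `J` of a plane, and `R` is equivariant under it. The commutator with `J` splits symmetries
into weights `0`, `1` and `2`. Weight `2` is impossible, and weight `1` amounts to pairs `(p, s)` of a
vector and a covector of the plane fixed by `J` with `dℓ(p) + h s = 0`, where
`dℓ = h (v₂ dv₂ + v₃ dv₃)` on the rotated plane. Two independent pairs would make `ℓ` quadratic.
These facts, the bound on the holonomy, the Bianchi identity and the vanishing of the trace show that
the diagonal blocks of `R(a, b)` are trace-free (`curvature_lower_trace`). Finally, all symmetries of
`ℓ` that are block trace-free in some basis adapted to a rotation are antisymmetric for a common form
(`hasInvariantForm`): if there is a pair, `ℓ` determines such a form on the kernel of a common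
eigencovector, in which these symmetries take their values; if there is none, all symmetries commute
with all rotation generators, and the trace-free blocks on the fixed plane are multiples of a single
one.
-/


set_option maxSynthPendingDepth 5

noncomputable section

namespace BerwaldFinsler

/-! ### Radial parallel transport for linear connections -/

section Radial

variable {V E : Type*} [NormedAddCommGroup V] [NormedSpace ℝ V]
  [NormedAddCommGroup E] [NormedSpace ℝ E]

/-- `c` is parallel along the rays of `ball x₀ δ` that start at `x₀`, for the linear connection
`∇c = dc - θ c`. -/
def IsRadiallyParallel (θ : V → V →L[ℝ] E →L[ℝ] E) (x₀ : V) (δ : ℝ) (c : V → E) : Prop :=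
  ∀ h : V, ‖h‖ < δ → ∀ s ∈ Icc (0 : ℝ) 1,
    HasDerivWithinAt (fun s : ℝ => c (x₀ + s • h)) (θ (x₀ + s • h) h (c (x₀ + s • h)))
      (Icc 0 1) s

theorem IsRadiallyParallel.mono {θ : V → V →L[ℝ] E →L[ℝ] E} {x₀ : V} {δ δ' : ℝ} {c : V → E}
    (h : IsRadiallyParallel θ x₀ δ c) (hδ : δ' ≤ δ) : IsRadiallyParallel θ x₀ δ' c :=
  fun v hv => h v (hv.trans_le hδ)

theorem add_smul_mem_ball {x₀ h : V} {δ s : ℝ} (hh : ‖h‖ < δ) (hs : s ∈ Icc (0 : ℝ) 1) :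
    x₀ + s • h ∈ Metric.ball x₀ δ := by
  rw [Metric.mem_ball, dist_eq_norm, add_sub_cancel_left, norm_smul, Real.norm_eq_abs,
    abs_of_nonneg hs.1]
  exact lt_of_le_of_lt (mul_le_of_le_one_left (norm_nonneg _) hs.2) hh

theorem hasDerivWithinAt_Ici_of_Icc {f : ℝ → E} {f' : E} {a b s : ℝ} (hs : s ∈ Ico a b)
    (h : HasDerivWithinAt f f' (Icc a b) s) : HasDerivWithinAt f f' (Ici s) s :=
  (h.mono (Icc_subset_Icc_left hs.1)).mono_of_mem_nhdsWithin (Icc_mem_nhdsGE hs.2)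

/-- A linear equation `α' = A α` with small coefficient is solvable on `[0, 1]`, with a solution
that stays close to its initial value. -/
theorem exists_linear_ode_solution [CompleteSpace E] {A : ℝ → E →L[ℝ] E}
    (hA : ContinuousOn A (Icc 0 1)) (c₀ : E) {ε k : NNReal} (hk : ∀ s ∈ Icc (0 : ℝ) 1, ‖A s‖ ≤ k)
    (hε : k * (‖c₀‖ + ε) ≤ ε) :
    ∃ α : ℝ → E, α 0 = c₀ ∧ (∀ s, ‖α s - c₀‖ ≤ ε) ∧
      ∀ s ∈ Icc (0 : ℝ) 1, HasDerivWithinAt α (A s (α s)) (Icc 0 1) s := by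
  let t₀ : Icc (0 : ℝ) 1 := ⟨0, by simp⟩
  have hPL : IsPicardLindelof (fun (s : ℝ) (c : E) => A s c) t₀ c₀ ε 0 ε k := by
    constructor
    · intro s hs
      refine (LipschitzWith.of_dist_le_mul fun c c' => ?_).lipschitzOnWith
      rw [dist_eq_norm, dist_eq_norm, ← map_sub]
      exact ((A s).le_opNorm _).trans (mul_le_mul_of_nonneg_right (hk s hs) (norm_nonneg _))
    · intro c _
      exact hA.clm_apply continuousOn_const
    · intro s hs c hc
      have hc' : ‖c‖ ≤ ‖c₀‖ + ε := by
        have h1 : ‖c - c₀‖ ≤ ε := by simpa [dist_eq_norm] using hc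
        calc ‖c‖ ≤ ‖c₀‖ + ‖c - c₀‖ := norm_le_norm_add_norm_sub' _ _
          _ ≤ _ := by linarith
      calc ‖A s c‖ ≤ ‖A s‖ * ‖c‖ := (A s).le_opNorm c
        _ ≤ k * (‖c₀‖ + ε) := mul_le_mul (hk s hs) hc' (norm_nonneg _) k.2
        _ ≤ ε := hε
    · simp [t₀]
  have hc₀ : c₀ ∈ Metric.closedBall c₀ ((0 : NNReal) : ℝ) := by simp
  obtain ⟨α, hα⟩ := ODE.FunSpace.exists_isFixedPt_next hPL hc₀
  set β := ODE.FunSpace.next hPL hc₀ α with hβ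
  have h0 : β.compProj (t₀ : ℝ) = c₀ := by rw [ODE.FunSpace.compProj_val, hβ]; simp
  refine ⟨β.compProj, h0, fun s => ?_, fun s hs => ?_⟩
  · have := β.compProj_mem_closedBall hPL.mul_max_le (t := s)
    simpa [dist_eq_norm] using this
  · have hpic : ∀ t ∈ Icc (0 : ℝ) 1, β.compProj t =
        ODE.picard (fun (s : ℝ) (c : E) => A s c) (t₀ : ℝ) c₀ β.compProj t := fun t ht => by
      rw [ODE.FunSpace.compProj_apply, hβ, ODE.FunSpace.next_apply, hα, projIcc_of_mem _ ht]
    have hu : ContinuousOn (Function.uncurry fun (s : ℝ) (c : E) => A s c)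
        (Icc 0 1 ×ˢ univ) := by
      have h1 : ContinuousOn (fun q : ℝ × E => A q.1) (Icc 0 1 ×ˢ univ) :=
        hA.comp continuousOn_fst fun q hq => hq.1
      exact h1.clm_apply continuousOn_snd
    have := ODE.hasDerivWithinAt_picard_Icc (t₀ := (t₀ : ℝ)) (tmin := 0) (tmax := 1) t₀.2 hu
      (ODE.FunSpace.continuous_compProj β).continuousOn (fun _ _ => mem_univ _) c₀ hs
    exact this.congr hpic (hpic s hs)

/-- Linear ordinary differential equations are solvable along all short rays from a point. -/
theorem exists_isRadiallyParallel [CompleteSpace E] {U : Set V} (hU : IsOpen U) {x₀ : V}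
    (hx₀ : x₀ ∈ U) {θ : V → V →L[ℝ] E →L[ℝ] E} (hθ : ContinuousOn θ U) (c₀ : E) {ε : ℝ}
    (hε : 0 < ε) :
    ∃ δ > 0, Metric.ball x₀ δ ⊆ U ∧ ∃ c : V → E, c x₀ = c₀ ∧
      (∀ y ∈ Metric.ball x₀ δ, ‖c y - c₀‖ ≤ ε) ∧ IsRadiallyParallel θ x₀ δ c := by
  have hθx : ContinuousAt θ x₀ := hθ.continuousAt (hU.mem_nhds hx₀)
  set m : ℝ := ‖θ x₀‖ + 1 with hm
  have hm0 : 0 < m := by positivity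
  have hev : ∀ᶠ y in 𝓝 x₀, ‖θ y‖ < m := by
    have h1 : ContinuousAt (fun y => ‖θ y‖) x₀ :=
      (continuous_norm (E := V →L[ℝ] E →L[ℝ] E)).continuousAt.comp hθx
    exact h1.eventually (gt_mem_nhds (lt_add_one _))
  obtain ⟨δ₀, hδ₀, hball⟩ := Metric.eventually_nhds_iff_ball.1 (hev.and (hU.eventually_mem hx₀))
  set δ : ℝ := min δ₀ (ε / (m * (‖c₀‖ + ε))) with hδ
  have hδ0 : 0 < δ := lt_min hδ₀ (by positivity)
  have hδε : m * δ * (‖c₀‖ + ε) ≤ ε := by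
    have : δ ≤ ε / (m * (‖c₀‖ + ε)) := min_le_right _ _
    rw [le_div_iff₀ (by positivity)] at this
    linarith
  have hsub : ∀ y ∈ Metric.ball x₀ δ, ‖θ y‖ < m ∧ y ∈ U := fun y hy =>
    hball y (Metric.ball_subset_ball (min_le_left _ _) hy)
  have hcontray : ∀ h : V, ‖h‖ < δ → ContinuousOn (fun s : ℝ => θ (x₀ + s • h)) (Icc 0 1) := by
    intro h hh
    refine hθ.comp (by fun_prop) fun s hs => (hsub _ (add_smul_mem_ball hh hs)).2
  have hsol : ∀ h : V, ‖h‖ < δ → ∃ α : ℝ → E, α 0 = c₀ ∧ (∀ s, ‖α s - c₀‖ ≤ ε) ∧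
      ∀ s ∈ Icc (0 : ℝ) 1, HasDerivWithinAt α (θ (x₀ + s • h) h (α s)) (Icc 0 1) s := by
    intro h hh
    have hbd : ∀ s ∈ Icc (0 : ℝ) 1, ‖θ (x₀ + s • h) h‖ ≤ m * δ := fun s hs =>
      ((θ _).le_opNorm h).trans (mul_le_mul (hsub _ (add_smul_mem_ball hh hs)).1.le hh.le
        (norm_nonneg _) hm0.le)
    lift ε to NNReal using hε.le
    exact exists_linear_ode_solution (k := ⟨m * δ, by positivity⟩)
      ((hcontray h hh).clm_apply continuousOn_const) c₀ hbd hδε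
  choose! α hα0 hαε hα using hsol
  -- solutions along proportional vectors agree up to the time scale, by uniqueness
  have hadd : ∀ h : V, ‖h‖ < δ → ∀ s ∈ Icc (0 : ℝ) 1, α (s • h) 1 = α h s := by
    intro h hh s hs
    have hsh : ‖s • h‖ < δ := by
      simpa only [zero_add, mem_ball_zero_iff] using add_smul_mem_ball (x₀ := (0 : V)) hh hs
    have hst : ∀ t ∈ Icc (0 : ℝ) 1, s * t ∈ Icc (0 : ℝ) 1 := fun t ht =>
      ⟨mul_nonneg hs.1 ht.1, mul_le_one₀ hs.2 ht.1 ht.2⟩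
    have hd1 : ∀ t ∈ Icc (0 : ℝ) 1, HasDerivWithinAt (fun t => α (s • h) t - α h (s * t))
        (θ (x₀ + t • s • h) (s • h) (α (s • h) t - α h (s * t))) (Icc 0 1) t := by
      intro t ht
      have e1 := hα (s • h) hsh t ht
      have e2 := (hα h hh (s * t) (hst t ht)).scomp t
        (((hasDerivAt_id t).const_mul s).hasDerivWithinAt (s := Icc (0 : ℝ) 1)) hst
      refine (e1.sub e2).congr_deriv ?_
      simp [smul_smul, mul_comm t s, smul_sub]
    have hz := eq_zero_of_abs_deriv_le_mul_abs_self_of_eq_zero_right (K := m * δ) (a := 0) (b := 1)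
      (f := fun t => α (s • h) t - α h (s * t))
      (fun t ht => (hd1 t ht).continuousWithinAt)
      (fun t ht => hasDerivWithinAt_Ici_of_Icc ht (hd1 t ⟨ht.1, ht.2.le⟩))
      (by simp [hα0 h hh, hα0 _ hsh]) (fun t ht => by
        refine ((θ (x₀ + t • s • h) (s • h)).le_opNorm _).trans ?_
        refine mul_le_mul_of_nonneg_right ?_ (norm_nonneg _)
        exact ((θ _).le_opNorm _).trans (mul_le_mul
          (hsub _ (add_smul_mem_ball hsh ⟨ht.1, ht.2.le⟩)).1.le hsh.le (norm_nonneg _) hm0.le))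
      1 (by simp)
    have := sub_eq_zero.1 hz
    simpa using this
  have hα00 : ∀ s ∈ Icc (0 : ℝ) 1, α 0 s = c₀ := by
    intro s hs
    have h1 := hadd 0 (by simpa using hδ0) s hs
    have h0 := hadd 0 (by simpa using hδ0) 0 (by simp)
    rw [smul_zero] at h1 h0
    rw [← h1, h0, hα0 0 (by simpa using hδ0)]
  refine ⟨δ, hδ0, fun y hy => (hsub y hy).2, fun y => α (y - x₀) 1, ?_, ?_, ?_⟩
  · simp [hα00 1 (by simp)]
  · intro y hy
    exact hαε _ (by simpa [dist_eq_norm] using hy) 1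
  · intro h hh s hs
    have hc : ∀ t ∈ Icc (0 : ℝ) 1, α (x₀ + t • h - x₀) 1 = α h t := fun t ht => by
      rw [add_sub_cancel_left, hadd h hh t ht]
    simp only [hc s hs]
    exact (hα h hh s hs).congr hc (hc s hs)

/-- A radially parallel section that is annihilated by the curvature of the connection is parallel
in all directions: along the segments from `x₀` to `y` and to `y + a`, the values of `c` differ by
`θ a c` up to an error that obeys a Grönwall estimate of order `‖a‖ ^ 2`. -/
theorem IsRadiallyParallel.hasFDerivAt [FiniteDimensional ℝ V] {x₀ : V} {δ C : ℝ}
    {θ : V → V →L[ℝ] E →L[ℝ] E} {c : V → E}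
    (hθ : ContDiffOn ℝ 2 θ (Metric.ball x₀ δ))
    (hrad : IsRadiallyParallel θ x₀ δ c)
    (hC : ∀ y ∈ Metric.ball x₀ δ, ‖c y‖ ≤ C)
    (hflat : ∀ y ∈ Metric.ball x₀ δ, ∀ a b : V,
      fderiv ℝ θ y a b (c y) + θ y b (θ y a (c y)) =
        fderiv ℝ θ y b a (c y) + θ y a (θ y b (c y)))
    {y : V} (hy : y ∈ Metric.ball x₀ δ) : HasFDerivAt c ((θ y).flip (c y)) y := by
  have hopen : IsOpen (Metric.ball x₀ δ) := Metric.isOpen_ball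
  obtain ⟨ρ, hyρ, hρδ⟩ := exists_between (Metric.mem_ball.1 hy)
  have hρ0 : 0 < ρ := dist_nonneg.trans_lt hyρ
  set S := Metric.closedBall x₀ ρ with hS
  have hSsub : S ⊆ Metric.ball x₀ δ := Metric.closedBall_subset_ball hρδ
  have hScomp : IsCompact S := isCompact_closedBall x₀ ρ
  have hSconv : Convex ℝ S := convex_closedBall x₀ ρ
  have hθ1 : ContDiffOn ℝ 1 (fderiv ℝ θ) (Metric.ball x₀ δ) :=
    hθ.fderiv_of_isOpen hopen (by norm_num)
  have hθ2 : ContDiffOn ℝ 0 (fderiv ℝ (fderiv ℝ θ)) (Metric.ball x₀ δ) :=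
    hθ1.fderiv_of_isOpen hopen (by norm_num)
  obtain ⟨M₀, hM₀⟩ := hScomp.exists_bound_of_continuousOn (hθ.continuousOn.mono hSsub)
  obtain ⟨M₁, hM₁⟩ := hScomp.exists_bound_of_continuousOn (hθ1.continuousOn.mono hSsub)
  obtain ⟨M₂, hM₂⟩ := hScomp.exists_bound_of_continuousOn (hθ2.continuousOn.mono hSsub)
  obtain ⟨M, hM1, hM0', hM1', hM2'⟩ : ∃ M : ℝ, 1 ≤ M ∧ M₀ ≤ M ∧ M₁ ≤ M ∧ M₂ ≤ M :=
    ⟨max 1 (max M₀ (max M₁ M₂)), by simp, by simp, by simp, by simp⟩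
  have hMpos : 0 < M := by linarith
  have hd : ∀ x ∈ S, DifferentiableAt ℝ θ x := fun x hx =>
    (hθ.contDiffAt (hopen.mem_nhds (hSsub hx))).differentiableAt (by norm_num)
  have hd1 : ∀ x ∈ S, DifferentiableAt ℝ (fderiv ℝ θ) x := fun x hx =>
    (hθ1.contDiffAt (hopen.mem_nhds (hSsub hx))).differentiableAt (by norm_num)
  have hlip : ∀ x ∈ S, ∀ x' ∈ S, ‖θ x' - θ x‖ ≤ M * ‖x' - x‖ := fun x hx x' hx' =>
    hSconv.norm_image_sub_le_of_norm_fderiv_le hd (fun z hz => (hM₁ z hz).trans hM1') hx hx'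
  have hlip1 : ∀ x ∈ S, ∀ x' ∈ S, ‖fderiv ℝ θ x' - fderiv ℝ θ x‖ ≤ M * ‖x' - x‖ :=
    fun x hx x' hx' =>
    hSconv.norm_image_sub_le_of_norm_fderiv_le hd1 (fun z hz => (hM₂ z hz).trans hM2') hx hx'
  have htaylor : ∀ x ∈ S, ∀ x' ∈ S,
      ‖θ x' - θ x - fderiv ℝ θ x (x' - x)‖ ≤ M * ‖x' - x‖ ^ 2 := by
    intro x hx x' hx'
    have hseg : segment ℝ x x' ⊆ S := hSconv.segment_subset hx hx'
    have := (convex_segment x x').norm_image_sub_le_of_norm_hasFDerivWithin_le'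
      (f := θ) (f' := fderiv ℝ θ) (φ := fderiv ℝ θ x) (C := M * ‖x' - x‖)
      (fun z hz => (hd z (hseg hz)).hasFDerivAt.hasFDerivWithinAt)
      (fun z hz => (hlip1 x hx z (hseg hz)).trans (by
        gcongr
        have := norm_sub_le_of_mem_segment hz
        simpa using this))
      (left_mem_segment ℝ x x') (right_mem_segment ℝ x x')
    rw [pow_two, ← mul_assoc]
    exact this
  set h : V := y - x₀ with hh
  have hhρ : ‖h‖ ≤ ρ := by rw [hh, ← dist_eq_norm]; exact hyρ.le
  have hC0 : 0 ≤ C := (norm_nonneg _).trans (hC y hy)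
  set K : ℝ := M * ρ with hK
  have hKpos : 0 < K := mul_pos hMpos hρ0
  set B : ℝ := M * ρ * C + M * C + (M * ρ + M) * (M * C) with hB
  have key : ∀ a : V, y + a ∈ S →
      ‖c (y + a) - c y - θ y a (c y)‖ ≤ B / K * (Real.exp K - 1) * ‖a‖ ^ 2 := by
    intro a ha
    have hha : ‖h + a‖ ≤ ρ := by
      have : h + a = y + a - x₀ := by rw [hh]; abel
      rw [this, ← dist_eq_norm]; exact ha
    have hmem : ∀ k : V, ‖k‖ ≤ ρ → ∀ s ∈ Icc (0 : ℝ) 1, x₀ + s • k ∈ S := by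
      intro k hk s hs
      rw [hS, Metric.mem_closedBall, dist_eq_norm, add_sub_cancel_left, norm_smul,
        Real.norm_eq_abs, abs_of_nonneg hs.1]
      exact (mul_le_of_le_one_left (norm_nonneg _) hs.2).trans hk
    set x : ℝ → V := fun s => x₀ + s • h with hx
    set x' : ℝ → V := fun s => x₀ + s • (h + a) with hx'
    have hxx' : ∀ s, x' s - x s = s • a := fun s => by simp [hx, hx']
    -- the failure of `c` to be parallel in the direction `a`, along the ray to `y`
    set D : ℝ → E := fun s => c (x' s) - c (x s) - s • θ (x s) a (c (x s)) with hD
    set D' : ℝ → E := fun s => θ (x' s) (h + a) (c (x' s)) - θ (x s) h (c (x s)) -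
      (θ (x s) a (c (x s)) + s • (fderiv ℝ θ (x s) h a (c (x s)) +
        θ (x s) a (θ (x s) h (c (x s))))) with hD'
    have hder : ∀ s ∈ Icc (0 : ℝ) 1, HasDerivWithinAt D (D' s) (Icc 0 1) s := by
      intro s hs
      have e1 := hrad (h + a) (hha.trans_lt hρδ) s hs
      have e2 := hrad h (hhρ.trans_lt hρδ) s hs
      have ex : HasDerivWithinAt x h (Icc 0 1) s := by
        have := ((hasDerivAt_id s).smul_const h).const_add x₀
        simpa [hx] using this.hasDerivWithinAt
      have e3 : HasDerivWithinAt (fun s => θ (x s)) (fderiv ℝ θ (x s) h) (Icc 0 1) s :=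
        (hd _ (hmem h hhρ s hs)).hasFDerivAt.comp_hasDerivWithinAt s ex
      have e4 : HasDerivWithinAt (fun s => θ (x s) a) (fderiv ℝ θ (x s) h a) (Icc 0 1) s := by
        simpa using e3.clm_apply (hasDerivWithinAt_const s (Icc (0 : ℝ) 1) a)
      have e5 := e4.clm_apply e2
      have e6 := (hasDerivWithinAt_id s (Icc (0 : ℝ) 1)).smul e5
      refine ((e1.sub e2).sub e6).congr_deriv ?_
      simp only [hD', hx, hx', id, one_smul]
      abel
    have hbound : ∀ s ∈ Icc (0 : ℝ) 1, ‖D' s‖ ≤ K * ‖D s‖ + B * ‖a‖ ^ 2 := by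
      intro s hs
      have hxs := hmem h hhρ s hs
      have hxs' := hmem (h + a) hha s hs
      have hs1 : |s| ≤ 1 := abs_le.2 ⟨by linarith [hs.1], hs.2⟩
      have hsa : ‖x' s - x s‖ ≤ ‖a‖ := by
        rw [hxx', norm_smul, Real.norm_eq_abs]
        exact mul_le_of_le_one_left (norm_nonneg _) hs1
      have hcs : ‖c (x s)‖ ≤ C := hC _ (hSsub hxs)
      have hfl := hflat (x s) (hSsub hxs) a h
      have hfd : fderiv ℝ θ (x s) (x' s - x s) = s • fderiv ℝ θ (x s) a := by
        rw [hxx', map_smul]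
      -- the flatness hypothesis `hfl` cancels the terms of first order in `a`
      have hdec : D' s = θ (x' s) (h + a) (D s) +
          ((θ (x' s) - θ (x s) - fderiv ℝ θ (x s) (x' s - x s)) h (c (x s)) +
          ((θ (x' s) - θ (x s)) a (c (x s)) +
          s • ((θ (x' s) - θ (x s)) (h + a) (θ (x s) a (c (x s))) +
            θ (x s) a (θ (x s) a (c (x s)))))) := by
        rw [hfd]
        have hfl' : s • (fderiv ℝ θ (x s) h a (c (x s)) + θ (x s) a (θ (x s) h (c (x s)))) =
          s • (fderiv ℝ θ (x s) a h (c (x s)) + θ (x s) h (θ (x s) a (c (x s)))) := by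
          rw [hfl]
        simp only [hD', hfl']
        simp only [hD, sub_apply, smul_apply, map_add,
          map_sub, map_smul, add_apply, smul_add, smul_sub]
        abel
      have n1 : ‖θ (x' s) (h + a) (D s)‖ ≤ K * ‖D s‖ :=
        ((θ (x' s)).le_opNorm₂ _ _).trans (by
          gcongr
          exact mul_le_mul ((hM₀ _ hxs').trans hM0') hha (norm_nonneg _) hMpos.le)
      have n2 : ‖(θ (x' s) - θ (x s) - fderiv ℝ θ (x s) (x' s - x s)) h (c (x s))‖ ≤
          M * ‖a‖ ^ 2 * ρ * C :=
        (ContinuousLinearMap.le_opNorm₂ _ _ _).trans (by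
          gcongr
          exact (htaylor _ hxs _ hxs').trans (by gcongr))
      have n3 : ‖(θ (x' s) - θ (x s)) a (c (x s))‖ ≤ M * ‖a‖ * ‖a‖ * C :=
        (ContinuousLinearMap.le_opNorm₂ _ _ _).trans (by
          gcongr
          exact (hlip _ hxs _ hxs').trans (by gcongr))
      have n4 : ‖θ (x s) a (c (x s))‖ ≤ M * ‖a‖ * C :=
        (ContinuousLinearMap.le_opNorm₂ _ _ _).trans (by
          gcongr
          exact (hM₀ _ hxs).trans hM0')
      have n5 : ‖(θ (x' s) - θ (x s)) (h + a) (θ (x s) a (c (x s)))‖ ≤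
          M * ‖a‖ * ρ * (M * ‖a‖ * C) :=
        (ContinuousLinearMap.le_opNorm₂ _ _ _).trans (by
          gcongr
          exact (hlip _ hxs _ hxs').trans (by gcongr))
      have n6 : ‖θ (x s) a (θ (x s) a (c (x s)))‖ ≤ M * ‖a‖ * (M * ‖a‖ * C) :=
        (ContinuousLinearMap.le_opNorm₂ _ _ _).trans (by
          gcongr
          exact (hM₀ _ hxs).trans hM0')
      have n7 : ‖s • ((θ (x' s) - θ (x s)) (h + a) (θ (x s) a (c (x s))) +
            θ (x s) a (θ (x s) a (c (x s))))‖ ≤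
          M * ‖a‖ * ρ * (M * ‖a‖ * C) + M * ‖a‖ * (M * ‖a‖ * C) := by
        rw [norm_smul, Real.norm_eq_abs]
        exact (mul_le_of_le_one_left (norm_nonneg _) hs1).trans
          ((norm_add_le _ _).trans (add_le_add n5 n6))
      rw [hdec]
      refine (norm_add_le _ _).trans (add_le_add n1 ?_)
      refine ((norm_add_le _ _).trans (add_le_add n2
        ((norm_add_le _ _).trans (add_le_add n3 n7)))).trans (le_of_eq ?_)
      rw [hB]; ring
    have hgr := norm_le_gronwallBound_of_norm_deriv_right_le (f := D) (f' := D') (a := 0) (b := 1)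
      (δ := 0) (K := K) (ε := B * ‖a‖ ^ 2)
      (fun s hs => (hder s hs).continuousWithinAt)
      (fun s hs => hasDerivWithinAt_Ici_of_Icc hs (hder s ⟨hs.1, hs.2.le⟩))
      (by simp [hD, hx, hx']) (fun s hs => hbound s ⟨hs.1, hs.2.le⟩) 1 (by simp)
    have hx1 : x 1 = y := by simp [hx, hh]
    have hx1' : x' 1 = y + a := by simp [hx', hh, ← add_assoc]
    rw [gronwallBound_of_K_ne_0 hKpos.ne'] at hgr
    simp only [hD, hx1, hx1', one_smul, sub_zero, mul_one, zero_mul, zero_add] at hgr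
    refine hgr.trans (le_of_eq ?_)
    ring
  rw [hasFDerivAt_iff_isLittleO_nhds_zero]
  have hO : (fun a => c (y + a) - c y - (θ y).flip (c y) a) =O[𝓝 0] fun a : V => ‖a‖ ^ 2 := by
    refine Asymptotics.IsBigO.of_bound (B / K * (Real.exp K - 1)) ?_
    have : ∀ᶠ a : V in 𝓝 0, y + a ∈ S := by
      have hc : ContinuousAt (fun a : V => y + a) 0 := by fun_prop
      refine hc.eventually_mem ?_
      rw [add_zero]
      exact Metric.closedBall_mem_nhds_of_mem hyρ
    filter_upwards [this] with a ha
    simpa using key a ha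
  exact hO.trans_isLittleO (Asymptotics.isLittleO_norm_pow_id one_lt_two)

end Radial

/-! ### Horizontal fields, vertical fields and curvature -/

theorem two_le_infty : (2 : WithTop ℕ∞) ≤ ∞ := WithTop.coe_le_coe.2 le_top

section HorizontalFields

variable {V : Type*} [NormedAddCommGroup V] [NormedSpace ℝ V]

/-- The horizontal lift `(a, -B a v)` of a constant vector `a`, for the linear connection with
connection form `B` on the trivial bundle `V × V`. -/
def horizField (B : V → V →L[ℝ] V →L[ℝ] V) (a : V) : V × V → V × V :=
  fun p => (a, -(B p.1 a p.2))

/-- The vertical vector field `(0, N v)` of a field `N` of endomorphisms. -/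
def vertField (N : V → V →L[ℝ] V) : V × V → V × V := fun p => (0, N p.1 p.2)

/-- The covariant derivative of a field `N` of endomorphisms in the direction `a`. -/
def covDeriv (B : V → V →L[ℝ] V →L[ℝ] V) (a : V) (N : V → V →L[ℝ] V) (x : V) : V →L[ℝ] V :=
  fderiv ℝ N x a + (B x a).comp (N x) - (N x).comp (B x a)

/-- The curvature `R(a, b)` of the connection with connection form `B`. -/
def curv (B : V → V →L[ℝ] V →L[ℝ] V) (x a b : V) : V →L[ℝ] V :=
  fderiv ℝ B x a b - fderiv ℝ B x b a + (B x a).comp (B x b) - (B x b).comp (B x a)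

theorem curv_apply (B : V → V →L[ℝ] V →L[ℝ] V) (x a b v : V) :
    curv B x a b v = fderiv ℝ B x a b v - fderiv ℝ B x b a v + B x a (B x b v)
      - B x b (B x a v) := by
  simp [curv]

theorem curv_add_left (B : V → V →L[ℝ] V →L[ℝ] V) (x a a' b : V) :
    curv B x (a + a') b = curv B x a b + curv B x a' b := by
  ext v; simp only [curv_apply, map_add, add_apply]; abel

theorem curv_smul_left (B : V → V →L[ℝ] V →L[ℝ] V) (x a b : V) (r : ℝ) :
    curv B x (r • a) b = r • curv B x a b := by
  ext v; simp only [curv_apply, map_smul, smul_apply, smul_sub, smul_add]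

theorem curv_swap (B : V → V →L[ℝ] V →L[ℝ] V) (x a b : V) :
    curv B x b a = -curv B x a b := by
  ext v; simp only [curv_apply, neg_apply]; abel

theorem curv_add_right (B : V → V →L[ℝ] V →L[ℝ] V) (x a b b' : V) :
    curv B x a (b + b') = curv B x a b + curv B x a b' := by
  rw [curv_swap, curv_add_left, curv_swap B x a b, curv_swap B x a b', neg_add, neg_neg, neg_neg]

theorem curv_smul_right (B : V → V →L[ℝ] V →L[ℝ] V) (x a b : V) (r : ℝ) :
    curv B x a (r • b) = r • curv B x a b := by
  rw [curv_swap, curv_smul_left, curv_swap B x a b, smul_neg, neg_neg]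

theorem hasFDerivAt_horizField {B : V → V →L[ℝ] V →L[ℝ] V} {p : V × V}
    (hB : DifferentiableAt ℝ B p.1) (a : V) :
    ∃ D : V × V →L[ℝ] V × V, HasFDerivAt (horizField B a) D p ∧
      ∀ q : V × V, D q = (0, -(fderiv ℝ B p.1 q.1 a p.2 + B p.1 a q.2)) := by
  have h1 : HasFDerivAt (fun q : V × V => B q.1)
      ((fderiv ℝ B p.1).comp (ContinuousLinearMap.fst ℝ V V)) p :=
    hB.hasFDerivAt.comp p hasFDerivAt_fst
  have h3 := (h1.clm_apply (hasFDerivAt_const a p)).clm_apply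
    (hasFDerivAt_snd (𝕜 := ℝ) (E := V) (F := V) (p := p))
  refine ⟨_, (hasFDerivAt_const a p).prodMk h3.neg, fun q => ?_⟩
  simp [add_comm]

theorem hasFDerivAt_vertField {N : V → V →L[ℝ] V} {p : V × V}
    (hN : DifferentiableAt ℝ N p.1) :
    ∃ D : V × V →L[ℝ] V × V, HasFDerivAt (vertField N) D p ∧
      ∀ q : V × V, D q = (0, fderiv ℝ N p.1 q.1 p.2 + N p.1 q.2) := by
  have h1 : HasFDerivAt (fun q : V × V => N q.1)
      ((fderiv ℝ N p.1).comp (ContinuousLinearMap.fst ℝ V V)) p :=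
    hN.hasFDerivAt.comp p hasFDerivAt_fst
  have h3 := h1.clm_apply (hasFDerivAt_snd (𝕜 := ℝ) (E := V) (F := V) (p := p))
  refine ⟨_, (hasFDerivAt_const (0 : V) p).prodMk h3, fun q => ?_⟩
  simp [add_comm]

theorem lieBracket_horiz_horiz {B : V → V →L[ℝ] V →L[ℝ] V} {p : V × V}
    (hB : DifferentiableAt ℝ B p.1) (a b : V) :
    VectorField.lieBracket ℝ (horizField B a) (horizField B b) p
      = (0, -(curv B p.1 a b p.2)) := by
  obtain ⟨D, hD, hDq⟩ := hasFDerivAt_horizField hB a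
  obtain ⟨D', hD', hDq'⟩ := hasFDerivAt_horizField hB b
  simp only [VectorField.lieBracket_eq]
  rw [hD.fderiv, hD'.fderiv, hDq, hDq', curv_apply]
  simp only [horizField, map_neg, Prod.mk_sub_mk, sub_self]
  congr 1; abel

theorem lieBracket_horiz_vert {B : V → V →L[ℝ] V →L[ℝ] V} {N : V → V →L[ℝ] V} {p : V × V}
    (hB : DifferentiableAt ℝ B p.1) (hN : DifferentiableAt ℝ N p.1) (a : V) :
    VectorField.lieBracket ℝ (horizField B a) (vertField N) p = vertField (covDeriv B a N) p := by
  obtain ⟨D, hD, hDq⟩ := hasFDerivAt_horizField hB a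
  obtain ⟨D', hD', hDq'⟩ := hasFDerivAt_vertField hN
  simp only [VectorField.lieBracket_eq]
  rw [hD.fderiv, hD'.fderiv, hDq, hDq']
  simp only [horizField, vertField, covDeriv, map_zero, map_neg, Prod.mk_sub_mk, sub_self, zero_add,
    add_apply, sub_apply, ContinuousLinearMap.comp_apply, zero_apply]
  congr 1; abel

/-- First integrals of two vector fields are first integrals of their Lie bracket. -/
theorem fderiv_lieBracket_eq_zero {W : Type*} [NormedAddCommGroup W] [NormedSpace ℝ W]
    {A : Set W} (hA : IsOpen A) {F : W → ℝ} (hF : ContDiffOn ℝ 2 F A) {X Y : W → W} {p : W}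
    (hp : p ∈ A) (hX : DifferentiableAt ℝ X p) (hY : DifferentiableAt ℝ Y p)
    (hFX : ∀ q ∈ A, fderiv ℝ F q (X q) = 0) (hFY : ∀ q ∈ A, fderiv ℝ F q (Y q) = 0) :
    fderiv ℝ F p (VectorField.lieBracket ℝ X Y p) = 0 := by
  have hFp : ContDiffAt ℝ 2 F p := hF.contDiffAt (hA.mem_nhds hp)
  have hsymm : IsSymmSndFDerivAt ℝ F p := hFp.isSymmSndFDerivAt (by simp)
  have hd : DifferentiableAt ℝ (fderiv ℝ F) p :=
    (hFp.fderiv_right (m := 1) (by norm_num)).differentiableAt (by norm_num)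
  have aux : ∀ Z : W → W, DifferentiableAt ℝ Z p → (∀ q ∈ A, fderiv ℝ F q (Z q) = 0) →
      ∀ w, fderiv ℝ F p (fderiv ℝ Z p w) = -fderiv ℝ (fderiv ℝ F) p w (Z p) := by
    intro Z hZ hFZ w
    have h1 := hd.hasFDerivAt.clm_apply hZ.hasFDerivAt
    have h2 : HasFDerivAt (fun q => fderiv ℝ F q (Z q)) (0 : W →L[ℝ] ℝ) p :=
      (hasFDerivAt_const (0 : ℝ) p).congr_of_eventuallyEq
        (by filter_upwards [hA.mem_nhds hp] with q hq using hFZ q hq)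
    have h3 := congrArg (fun f : W →L[ℝ] ℝ => f w) (h1.unique h2)
    simp at h3
    linarith
  simp only [VectorField.lieBracket_eq, map_sub]
  rw [aux Y hY hFY, aux X hX hFX, hsymm (X p) (Y p)]
  ring

variable {B : V → V →L[ℝ] V →L[ℝ] V} {M : Set V} {A : Set (V × V)} {F : V × V → ℝ}

/-- A function that is constant along the horizontal fields is invariant under the curvature. -/
theorem fderiv_curv_eq_zero (hM : IsOpen M) (hA : IsOpen A) (hAM : ∀ p ∈ A, p.1 ∈ M)
    (hB : ContDiffOn ℝ ∞ B M) (hF : ContDiffOn ℝ ∞ F A)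
    (hhor : ∀ p ∈ A, ∀ a, fderiv ℝ F p (horizField B a p) = 0) {p : V × V} (hp : p ∈ A) (a b : V) :
    fderiv ℝ F p (0, curv B p.1 a b p.2) = 0 := by
  have hBp : DifferentiableAt ℝ B p.1 :=
    (hB.contDiffAt (hM.mem_nhds (hAM p hp))).differentiableAt (by simp)
  obtain ⟨D, hD, -⟩ := hasFDerivAt_horizField hBp a
  obtain ⟨D', hD', -⟩ := hasFDerivAt_horizField hBp b
  have h := fderiv_lieBracket_eq_zero hA (hF.of_le two_le_infty) hp
    hD.differentiableAt hD'.differentiableAt (fun q hq => hhor q hq a) (fun q hq => hhor q hq b)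
  rw [lieBracket_horiz_horiz hBp] at h
  have e : ((0 : V), -(curv B p.1 a b p.2)) = -(0, curv B p.1 a b p.2) := by simp
  rw [e, map_neg, neg_eq_zero] at h
  exact h

theorem fderiv_covDeriv_eq_zero (hM : IsOpen M) (hA : IsOpen A) (hAM : ∀ p ∈ A, p.1 ∈ M)
    (hB : ContDiffOn ℝ ∞ B M) (hF : ContDiffOn ℝ ∞ F A)
    (hhor : ∀ p ∈ A, ∀ a, fderiv ℝ F p (horizField B a p) = 0) {N : V → V →L[ℝ] V}
    (hN : ContDiffOn ℝ ∞ N M) (hFN : ∀ p ∈ A, fderiv ℝ F p (vertField N p) = 0)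
    {p : V × V} (hp : p ∈ A) (a : V) :
    fderiv ℝ F p (vertField (covDeriv B a N) p) = 0 := by
  have hBp : DifferentiableAt ℝ B p.1 :=
    (hB.contDiffAt (hM.mem_nhds (hAM p hp))).differentiableAt (by simp)
  have hNp : DifferentiableAt ℝ N p.1 :=
    (hN.contDiffAt (hM.mem_nhds (hAM p hp))).differentiableAt (by simp)
  obtain ⟨D, hD, -⟩ := hasFDerivAt_horizField hBp a
  obtain ⟨D', hD', -⟩ := hasFDerivAt_vertField hNp
  have h := fderiv_lieBracket_eq_zero hA (hF.of_le two_le_infty) hp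
    hD.differentiableAt hD'.differentiableAt (fun q hq => hhor q hq a) hFN
  rwa [lieBracket_horiz_vert hBp hNp] at h

theorem contDiffOn_curv (hM : IsOpen M) (hB : ContDiffOn ℝ ∞ B M) (a b : V) :
    ContDiffOn ℝ ∞ (fun x => curv B x a b) M := by
  have h1 : ContDiffOn ℝ ∞ (fderiv ℝ B) M := hB.fderiv_of_isOpen hM (by simp)
  have hd : ∀ u w : V, ContDiffOn ℝ ∞ (fun x => fderiv ℝ B x u w) M := fun u w =>
    (h1.clm_apply contDiffOn_const).clm_apply contDiffOn_const
  have hb : ∀ u : V, ContDiffOn ℝ ∞ (fun x => B x u) M := fun u => hB.clm_apply contDiffOn_const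
  exact (((hd a b).sub (hd b a)).add ((hb a).clm_comp (hb b))).sub ((hb b).clm_comp (hb a))

theorem contDiffOn_covDeriv (hM : IsOpen M) (hB : ContDiffOn ℝ ∞ B M) {N : V → V →L[ℝ] V}
    (hN : ContDiffOn ℝ ∞ N M) (a : V) : ContDiffOn ℝ ∞ (covDeriv B a N) M := by
  have h1 : ContDiffOn ℝ ∞ (fderiv ℝ N) M := hN.fderiv_of_isOpen hM (by simp)
  have hb : ContDiffOn ℝ ∞ (fun x => B x a) M := hB.clm_apply contDiffOn_const
  exact ((h1.clm_apply contDiffOn_const).add (hb.clm_comp hN)).sub (hN.clm_comp hb)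

/-- The algebraic Bianchi identity of a torsion-free connection. -/
theorem curv_bianchi (hM : IsOpen M) (hB : ContDiffOn ℝ ∞ B M)
    (hsymm : ∀ x ∈ M, ∀ a b, B x a b = B x b a) {x : V} (hx : x ∈ M) (a b c : V) :
    curv B x a b c + curv B x b c a + curv B x c a b = 0 := by
  have hd : ∀ u v w : V, fderiv ℝ B x u v w = fderiv ℝ B x u w v := by
    intro u v w
    have hBx : DifferentiableAt ℝ B x :=
      (hB.contDiffAt (hM.mem_nhds hx)).differentiableAt (by simp)
    have e : ∀ v w : V, HasFDerivAt (fun y => B y v w) (((ContinuousLinearMap.apply ℝ V w).comp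
        (ContinuousLinearMap.apply ℝ (V →L[ℝ] V) v)).comp (fderiv ℝ B x)) x := fun v w =>
      ((ContinuousLinearMap.apply ℝ V w).comp
        (ContinuousLinearMap.apply ℝ (V →L[ℝ] V) v)).hasFDerivAt.comp x hBx.hasFDerivAt
    have h2 := (e v w).congr_of_eventuallyEq (f₁ := fun y => B y w v)
      (by filter_upwards [hM.mem_nhds hx] with y hy using hsymm y hy w v)
    have := congrArg (fun f : V →L[ℝ] V => f u) (h2.unique (e w v))
    simpa using this
  simp only [curv_apply]
  rw [hd a c b, hd b a c, hd c b a, hsymm x hx b c, hsymm x hx a c, hsymm x hx b a]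
  abel

end HorizontalFields

/-! ### The canonical connection of a Berwald function -/

theorem sum_smul_e (w : R4) : ∑ a, w a • e a = w := by
  ext i; simp [e, Pi.single_apply]

theorem map_eq_sum_e {E : Type*} [AddCommGroup E] [Module ℝ E] (f : R4 →ₗ[ℝ] E) (w : R4) :
    f w = ∑ a, w a • f (e a) := by
  conv_lhs => rw [← sum_smul_e w]
  simp

/-- The connection form of the affine connection with coefficients `Γ`: `connForm Γ x h v` is the
vector with components `Γ^c_{ab}(x) h^a v^b`. -/
def connForm (Γ : ConnCoeff) (x : R4) : R4 →L[ℝ] R4 →L[ℝ] R4 :=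
  ∑ c, ∑ a, ∑ b, Γ x c a b • (ContinuousLinearMap.proj (R := ℝ) (φ := fun _ : Fin 4 => ℝ) a).smulRight
    ((ContinuousLinearMap.proj (R := ℝ) (φ := fun _ : Fin 4 => ℝ) b).smulRight (e c))

theorem connForm_apply (Γ : ConnCoeff) (x h v : R4) (c : Fin 4) :
    connForm Γ x h v c = ∑ a, ∑ b, Γ x c a b * h a * v b := by
  simp only [connForm, Finset.sum_apply, smul_apply,
    ContinuousLinearMap.smulRight_apply, ContinuousLinearMap.proj_apply, Pi.smul_apply, smul_eq_mul,
    e, Pi.single_apply, sum_apply]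
  rw [Finset.sum_eq_single c]
  · refine Finset.sum_congr rfl fun a _ => Finset.sum_congr rfl fun b _ => ?_
    simp; ring
  · intro c' _ hc
    simp [Ne.symm hc]
  · simp

theorem connForm_e_e (Γ : ConnCoeff) (x : R4) (a b c : Fin 4) :
    connForm Γ x (e a) (e b) c = Γ x c a b := by
  rw [connForm_apply]
  simp [e, Pi.single_apply]

theorem contDiffOn_connForm {Γ : ConnCoeff} {M : Set R4}
    (h : ∀ c a b, ContDiffOn ℝ ∞ (fun x => Γ x c a b) M) : ContDiffOn ℝ ∞ (connForm Γ) M := by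
  unfold connForm
  exact ContDiffOn.sum fun c _ => ContDiffOn.sum fun a _ => ContDiffOn.sum fun b _ =>
    (h c a b).smul contDiffOn_const

theorem connForm_symm {Γ : ConnCoeff} {x : R4} (h : ∀ c a b, Γ x c a b = Γ x c b a) (a b : R4) :
    connForm Γ x a b = connForm Γ x b a := by
  ext c
  rw [connForm_apply, connForm_apply, Finset.sum_comm]
  refine Finset.sum_congr rfl fun i _ => Finset.sum_congr rfl fun j _ => ?_
  rw [h c j i]; ring

section Spray

variable {M : Set R4} {A : Set TR4} {L : TR4 → ℝ} {Γ : ConnCoeff}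

theorem IsPseudoFinsler.fst_mem (hL : IsPseudoFinsler M A L) {p : TR4} (hp : p ∈ A) : p.1 ∈ M := by
  rw [← hL.conic.proj]; exact ⟨p, hp, rfl⟩

theorem contDiffOn_fderiv_apply {W : Type*} [NormedAddCommGroup W] [NormedSpace ℝ W] {A : Set W}
    (hA : IsOpen A) {F : W → ℝ} (hF : ContDiffOn ℝ ∞ F A) (w : W) :
    ContDiffOn ℝ ∞ (fun p => fderiv ℝ F p w) A :=
  (hF.fderiv_of_isOpen hA (by simp)).clm_apply contDiffOn_const

theorem contDiffOn_det {W : Type*} [NormedAddCommGroup W] [NormedSpace ℝ W] {A : Set W}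
    {g : W → Matrix (Fin 4) (Fin 4) ℝ} (hg : ∀ i j, ContDiffOn ℝ ∞ (fun x => g x i j) A) :
    ContDiffOn ℝ ∞ (fun x => (g x).det) A := by
  simp only [Matrix.det_apply]
  exact ContDiffOn.sum fun σ _ => (contDiffOn_prod fun i _ => hg _ _).const_smul _

theorem contDiffOn_inv_apply {W : Type*} [NormedAddCommGroup W] [NormedSpace ℝ W] {A : Set W}
    {g : W → Matrix (Fin 4) (Fin 4) ℝ} (hg : ∀ i j, ContDiffOn ℝ ∞ (fun x => g x i j) A)
    (hdet : ∀ x ∈ A, (g x).det ≠ 0) (i j : Fin 4) :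
    ContDiffOn ℝ ∞ (fun x => (g x)⁻¹ i j) A := by
  simp only [Matrix.inv_def, Ring.inverse_eq_inv', Matrix.smul_apply, Matrix.adjugate_apply,
    smul_eq_mul]
  refine ((contDiffOn_det hg).inv hdet).mul (contDiffOn_det fun k l => ?_)
  simp only [Matrix.updateRow_apply]
  split_ifs
  · exact contDiffOn_const
  · exact hg k l

theorem IsPseudoFinsler.contDiffOn_fundTensor (hL : IsPseudoFinsler M A L) (i j : Fin 4) :
    ContDiffOn ℝ ∞ (fun p => fundTensor L p i j) A := by
  simp only [fundTensor, Matrix.of_apply, dv]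
  exact contDiffOn_const.mul (contDiffOn_fderiv_apply hL.conic.isOpen
    (contDiffOn_fderiv_apply hL.conic.isOpen hL.smooth _) _)

theorem IsPseudoFinsler.contDiffOn_sprayCoeff (hL : IsPseudoFinsler M A L) (a : Fin 4) :
    ContDiffOn ℝ ∞ (sprayCoeff L a) A := by
  have hA := hL.conic.isOpen
  have h1 : ∀ b, ContDiffOn ℝ ∞ (fun p => fderiv ℝ L p (0, e b)) A := fun b =>
    contDiffOn_fderiv_apply hA hL.smooth _
  unfold sprayCoeff
  refine contDiffOn_const.mul (ContDiffOn.sum fun b _ => ?_)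
  refine (contDiffOn_inv_apply hL.contDiffOn_fundTensor hL.nondegenerate a b).mul ?_
  refine ContDiffOn.sub (ContDiffOn.sum fun c _ => ContDiffOn.mul ?_ ?_) ?_
  · exact ((ContinuousLinearMap.proj (R := ℝ) (φ := fun _ : Fin 4 => ℝ) c).comp
      (ContinuousLinearMap.snd ℝ R4 R4)).contDiff.contDiffOn
  · exact contDiffOn_fderiv_apply hA (h1 b) _
  · exact contDiffOn_fderiv_apply hA hL.smooth _

theorem two_mul_sprayCoeff (hB : IsCanonicalConnection M A L Γ) {p : TR4} (hp : p ∈ A)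
    (c : Fin 4) : 2 * sprayCoeff L c p = connForm Γ p.1 p.2 p.2 c := by
  rw [hB.2 p hp c, connForm_apply]

/-- The coefficients of the canonical connection are smooth: they are second differences, with a
fixed step, of the spray coefficients along the fibres. -/
theorem IsCanonicalConnection.contDiffOn (hL : IsPseudoFinsler M A L)
    (hB : IsCanonicalConnection M A L Γ) (c a b : Fin 4) :
    ContDiffOn ℝ ∞ (fun x => Γ x c a b) M := by
  intro x hx
  have hA := hL.conic.isOpen
  obtain ⟨⟨x', v⟩, hp, rfl⟩ : x ∈ Prod.fst '' A := by rw [hL.conic.proj]; exact hx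
  simp only at hx ⊢
  have hcont : ∀ k : R4, ∀ᶠ s : ℝ in 𝓝 0, (x', v + s • k) ∈ A := fun k => by
    have hc : ContinuousAt (fun s : ℝ => ((x', v + s • k) : TR4)) 0 := by fun_prop
    exact hc.eventually_mem (by simpa using hA.mem_nhds hp)
  have hev := (hcont (e a)).and ((hcont (e b)).and (hcont (e a + e b)))
  obtain ⟨s, ⟨h1, h2, h3⟩, hs⟩ :=
    ((hev.filter_mono nhdsWithin_le_nhds).and (self_mem_nhdsWithin (s := {(0 : ℝ)}ᶜ))).exists
  have hs0 : s ≠ 0 := hs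
  have hG : ∀ w : R4, (x', w) ∈ A →
      ContDiffAt ℝ ∞ (fun y : R4 => sprayCoeff L c (y, w)) x' := fun w hw =>
    ((hL.contDiffOn_sprayCoeff c).contDiffAt (hA.mem_nhds hw)).comp x'
      (f := fun y : R4 => ((y, w) : TR4)) (contDiffAt_id.prodMk contDiffAt_const)
  have hcx : ∀ w : R4, (x', w) ∈ A → ∀ᶠ y in 𝓝 x', (y, w) ∈ A := fun w hw => by
    have hc : ContinuousAt (fun y : R4 => ((y, w) : TR4)) x' := by fun_prop
    exact hc.eventually_mem (hA.mem_nhds hw)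
  have hsm : ContDiffAt ℝ ∞ (fun y : R4 => (s ^ 2)⁻¹ * (sprayCoeff L c (y, v + s • (e a + e b)) -
      sprayCoeff L c (y, v + s • e a) - sprayCoeff L c (y, v + s • e b) + sprayCoeff L c (y, v))) x' :=
    contDiffAt_const.mul ((((hG _ h3).sub (hG _ h1)).sub (hG _ h2)).add (hG _ hp))
  refine (hsm.congr_of_eventuallyEq ?_).contDiffWithinAt
  filter_upwards [hcx _ h1, hcx _ h2, hcx _ h3, hcx _ hp] with y y1 y2 y3 y4
  have hyM : y ∈ M := hL.fst_mem y4
  have hsy := connForm_symm (hB.1 y hyM)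
  have q := fun w hw => two_mul_sprayCoeff (p := (y, w)) hB hw c
  have q1 := q _ y1
  have q2 := q _ y2
  have q3 := q _ y3
  have q4 := q _ y4
  simp only [map_add, map_smul, add_apply, smul_apply, Pi.add_apply, Pi.smul_apply,
    smul_eq_mul, hsy _ v, hsy (e b) (e a)] at q1 q2 q3 q4
  rw [← connForm_e_e Γ y a b c, eq_inv_mul_iff_mul_eq₀ (pow_ne_zero 2 hs0)]
  linarith

theorem IsPseudoFinsler.euler (hL : IsPseudoFinsler M A L) {p : TR4} (hp : p ∈ A) :
    fderiv ℝ L p (0, p.2) = 2 * L p := by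
  obtain ⟨x, v⟩ := p
  have hd : DifferentiableAt ℝ L (x, v) :=
    (hL.smooth.contDiffAt (hL.conic.isOpen.mem_nhds hp)).differentiableAt (by simp)
  have h1 : HasDerivAt (fun c : ℝ => ((x, c • v) : TR4)) (0, v) 1 := by
    have := ((hasDerivAt_id (1 : ℝ)).smul_const v)
    simpa using (hasDerivAt_const (1 : ℝ) x).prodMk this
  have h2 : HasDerivAt (fun c : ℝ => L (x, c • v)) (fderiv ℝ L (x, v) (0, v)) 1 :=
    HasFDerivAt.comp_hasDerivAt (f := fun c : ℝ => ((x, c • v) : TR4)) 1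
      (by simpa using hd.hasFDerivAt) h1
  have h3 : HasDerivAt (fun c : ℝ => c ^ 2 * L (x, v)) (2 * L (x, v)) 1 := by
    simpa using (hasDerivAt_pow 2 (1 : ℝ)).mul_const (L (x, v))
  refine h2.unique (h3.congr_of_eventuallyEq ?_)
  filter_upwards [lt_mem_nhds (zero_lt_one' ℝ)] with c hc using hL.homogeneous x v hp c hc

theorem IsPseudoFinsler.differentiableAt_fderiv (hL : IsPseudoFinsler M A L) {p : TR4}
    (hp : p ∈ A) : DifferentiableAt ℝ (fderiv ℝ L) p :=
  (((hL.smooth.fderiv_of_isOpen hL.conic.isOpen (m := ∞) (by simp)).contDiffAt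
    (hL.conic.isOpen.mem_nhds hp))).differentiableAt (by simp)

theorem IsPseudoFinsler.fderiv_fderiv_apply (hL : IsPseudoFinsler M A L) {p : TR4}
    (hp : p ∈ A) (q w : TR4) :
    fderiv ℝ (fun p => fderiv ℝ L p q) p w = fderiv ℝ (fderiv ℝ L) p w q := by
  rw [((hL.differentiableAt_fderiv hp).hasFDerivAt.clm_apply (hasFDerivAt_const q p)).fderiv]
  simp

theorem IsPseudoFinsler.isSymm (hL : IsPseudoFinsler M A L) {p : TR4} (hp : p ∈ A) (q w : TR4) :
    fderiv ℝ (fderiv ℝ L) p q w = fderiv ℝ (fderiv ℝ L) p w q :=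
  ((hL.smooth.contDiffAt (hL.conic.isOpen.mem_nhds hp)).isSymmSndFDerivAt
    (by simpa using two_le_infty)) q w

theorem IsPseudoFinsler.fundTensor_apply (hL : IsPseudoFinsler M A L) {p : TR4} (hp : p ∈ A)
    (a b : Fin 4) : fundTensor L p a b = (1 / 2) * fderiv ℝ (fderiv ℝ L) p (0, e a) (0, e b) := by
  change 1 / 2 * fderiv ℝ (fun q => fderiv ℝ L q (0, e b)) p (0, e a) = _
  rw [hL.fderiv_fderiv_apply hp]

theorem map_vert_eq_sum (f : TR4 →L[ℝ] ℝ) (w : R4) : f (0, w) = ∑ a, w a * f (0, e a) := by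
  have := map_eq_sum_e (f.toLinearMap.comp (LinearMap.inr ℝ R4 R4)) w
  simpa using this

theorem map_hor_eq_sum (f : TR4 →L[ℝ] ℝ) (w : R4) : f (w, 0) = ∑ a, w a * f (e a, 0) := by
  have := map_eq_sum_e (f.toLinearMap.comp (LinearMap.inl ℝ R4 R4)) w
  simpa using this

theorem IsPseudoFinsler.hessian_nondegenerate (hL : IsPseudoFinsler M A L) {p : TR4} (hp : p ∈ A)
    {w : R4} (hw : ∀ k : R4, fderiv ℝ (fderiv ℝ L) p (0, k) (0, w) = 0) : w = 0 := by
  refine Matrix.eq_zero_of_mulVec_eq_zero (hL.nondegenerate p hp) ?_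
  ext a
  have h := hw (e a)
  rw [map_vert_eq_sum] at h
  simp only [Matrix.mulVec, dotProduct, hL.fundTensor_apply hp, Pi.zero_apply]
  rw [← mul_zero (1 / 2 : ℝ), ← h, Finset.mul_sum]
  exact Finset.sum_congr rfl fun b _ => by ring

/-- The defining equation of the spray, with the inverse of the metric tensor eliminated. -/
theorem spray_equation (hL : IsPseudoFinsler M A L) (hB : IsCanonicalConnection M A L Γ)
    {p : TR4} (hp : p ∈ A) (b : R4) :
    fderiv ℝ (fderiv ℝ L) p (p.2, 0) (0, b) - fderiv ℝ L p (b, 0) =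
      fderiv ℝ (fderiv ℝ L) p (0, b) (0, connForm Γ p.1 p.2 p.2) := by
  have key : ∀ b : Fin 4, fderiv ℝ (fderiv ℝ L) p (p.2, 0) (0, e b) - fderiv ℝ L p (e b, 0) =
      fderiv ℝ (fderiv ℝ L) p (0, e b) (0, connForm Γ p.1 p.2 p.2) := by
    set E : R4 := fun b => (∑ c, p.2 c * dx c (dv b L) p) - dx b L p with hE
    have hG : ∀ a, 4 * sprayCoeff L a p = ((fundTensor L p)⁻¹.mulVec E) a := fun a => by
      simp only [sprayCoeff, Matrix.mulVec, dotProduct, hE]; ring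
    have hinv : (fundTensor L p).mulVec ((fundTensor L p)⁻¹.mulVec E) = E := by
      rw [Matrix.mulVec_mulVec, Matrix.mul_nonsing_inv _ (hL.nondegenerate p hp).isUnit,
        Matrix.one_mulVec]
    intro b
    have h1 := congrFun hinv b
    have h2 : E b = fderiv ℝ (fderiv ℝ L) p (p.2, 0) (0, e b) - fderiv ℝ L p (e b, 0) := by
      have h3 := map_hor_eq_sum ((fderiv ℝ (fun q => fderiv ℝ L q (0, e b)) p)) p.2
      rw [hL.fderiv_fderiv_apply hp] at h3
      rw [h3]
      rfl
    rw [← h2, ← h1, map_vert_eq_sum, Matrix.mulVec, dotProduct]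
    refine Finset.sum_congr rfl fun a _ => ?_
    rw [← hG, hL.fundTensor_apply hp, ← two_mul_sprayCoeff hB hp]
    ring
  have e1 := map_vert_eq_sum (fderiv ℝ (fderiv ℝ L) p (p.2, 0)) b
  have e2 := map_hor_eq_sum (fderiv ℝ L p) b
  have e3 := map_vert_eq_sum ((fderiv ℝ (fderiv ℝ L) p).flip (0, connForm Γ p.1 p.2 p.2)) b
  simp only [ContinuousLinearMap.flip_apply] at e3
  rw [e1, e2, e3, ← Finset.sum_sub_distrib]
  exact Finset.sum_congr rfl fun a _ => by rw [← key a]; ring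

theorem prod_sub_split (f : TR4 →L[ℝ] ℝ) (a b : R4) : f (a, -b) = f (a, 0) - f (0, b) := by
  rw [← map_sub]; simp

/-- A Berwald function is constant along its horizontal vector fields. -/
theorem fderiv_horizField_eq_zero (hM : IsOpen M) (hL : IsPseudoFinsler M A L)
    (hB : IsCanonicalConnection M A L Γ) {p : TR4} (hp : p ∈ A) (b : R4) :
    fderiv ℝ L p (horizField (connForm Γ) b p) = 0 := by
  have hA := hL.conic.isOpen
  have hsm := contDiffOn_connForm (hB.contDiffOn hL)
  -- the spray field `(v, -Γ v v)` annihilates `L`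
  have hS : ∀ q ∈ A, fderiv ℝ L q (q.2, -(connForm Γ q.1 q.2 q.2)) = 0 := by
    intro q hq
    have h1 := spray_equation hL hB hq q.2
    have h2 : ∀ w : TR4, fderiv ℝ (fderiv ℝ L) q w (0, q.2) + fderiv ℝ L q (0, w.2) =
        2 * fderiv ℝ L q w := by
      intro w
      have d1 := (hL.differentiableAt_fderiv hq).hasFDerivAt.clm_apply
        ((hasFDerivAt_const (0 : R4) q).prodMk
          (hasFDerivAt_snd (𝕜 := ℝ) (E := R4) (F := R4) (p := q)))
      have d2 : HasFDerivAt (fun q => 2 * L q) ((2 : ℝ) • fderiv ℝ L q) q :=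
        ((hL.smooth.contDiffAt (hA.mem_nhds hq)).differentiableAt (by simp)).hasFDerivAt.const_mul 2
      have d3 := d1.unique (d2.congr_of_eventuallyEq
        (by filter_upwards [hA.mem_nhds hq] with z hz using hL.euler hz))
      have d4 := congrArg (fun f : TR4 →L[ℝ] ℝ => f w) d3
      simp at d4
      linarith
    have h3 := h2 (q.2, 0)
    have h4 := h2 (0, connForm Γ q.1 q.2 q.2)
    rw [hL.isSymm hq (0, connForm Γ q.1 q.2 q.2)] at h4
    rw [prod_sub_split]
    simp only [Prod.mk_zero_zero, map_zero] at h3 h4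
    linarith
  have hBp : DifferentiableAt ℝ (connForm Γ) p.1 :=
    (hsm.contDiffAt (hM.mem_nhds (hL.fst_mem hp))).differentiableAt (by simp)
  have c1 : HasFDerivAt (fun q : TR4 => connForm Γ q.1)
      ((fderiv ℝ (connForm Γ) p.1).comp (ContinuousLinearMap.fst ℝ R4 R4)) p :=
    hBp.hasFDerivAt.comp p hasFDerivAt_fst
  have c2 := hasFDerivAt_snd (𝕜 := ℝ) (E := R4) (F := R4) (p := p)
  have c3 := (hL.differentiableAt_fderiv hp).hasFDerivAt.clm_apply
    (c2.prodMk ((c1.clm_apply c2).clm_apply c2).neg)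
  have c4 := c3.unique ((hasFDerivAt_const (0 : ℝ) p).congr_of_eventuallyEq
    (by filter_upwards [hA.mem_nhds hp] with z hz using hS z hz))
  have c5 := congrArg (fun f : TR4 →L[ℝ] ℝ => f (0, b)) c4
  simp [connForm_symm (hB.1 _ (hL.fst_mem hp)) b p.2] at c5
  have h1 := spray_equation hL hB hp b
  rw [hL.isSymm hp, ← sub_eq_zero] at h1
  rw [horizField, connForm_symm (hB.1 _ (hL.fst_mem hp)) b p.2]
  have s1 : ∀ x : R4, fderiv ℝ L p (b, -x + -x) =
      fderiv ℝ L p (b, 0) - 2 * fderiv ℝ L p (0, x) := fun x => by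
    have : ((b, -x + -x) : TR4) = (b, 0) - (2 : ℝ) • (0, x) := by
      ext i <;> simp; ring
    rw [this, map_sub, map_smul, smul_eq_mul]
  rw [s1, prod_sub_split] at c5
  rw [prod_sub_split]
  linarith

theorem nonlinConn_eq (hM : IsOpen M) (hL : IsPseudoFinsler M A L)
    (hB : IsCanonicalConnection M A L Γ) {p : TR4} (hp : p ∈ A) (a b : Fin 4) :
    nonlinConn L b a p = connForm Γ p.1 (e a) p.2 b := by
  have hBp : DifferentiableAt ℝ (connForm Γ) p.1 :=
    ((contDiffOn_connForm (hB.contDiffOn hL)).contDiffAt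
      (hM.mem_nhds (hL.fst_mem hp))).differentiableAt (by simp)
  have c1 : HasFDerivAt (fun q : TR4 => connForm Γ q.1)
      ((fderiv ℝ (connForm Γ) p.1).comp (ContinuousLinearMap.fst ℝ R4 R4)) p :=
    hBp.hasFDerivAt.comp p hasFDerivAt_fst
  have c2 := hasFDerivAt_snd (𝕜 := ℝ) (E := R4) (F := R4) (p := p)
  have c3 := ((ContinuousLinearMap.proj (R := ℝ) (φ := fun _ : Fin 4 => ℝ) b).hasFDerivAt.comp p
    ((c1.clm_apply c2).clm_apply c2)).const_mul (1 / 2)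
  have c4 := c3.congr_of_eventuallyEq (f₁ := sprayCoeff L b)
    (by
      filter_upwards [hL.conic.isOpen.mem_nhds hp] with q hq
      have := two_mul_sprayCoeff hB hq b
      simp only [Function.comp, ContinuousLinearMap.proj_apply]
      linarith)
  rw [nonlinConn, dv, c4.fderiv]
  simp [connForm_symm (hB.1 _ (hL.fst_mem hp)) (e a) p.2]
  ring

theorem horiz_eq (hM : IsOpen M) (hL : IsPseudoFinsler M A L)
    (hB : IsCanonicalConnection M A L Γ) {p : TR4} (hp : p ∈ A) (a : Fin 4) :
    horiz L a p = horizField (connForm Γ) (e a) p := by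
  simp only [horiz, horizField]
  congr 1
  ext b
  rw [nonlinConn_eq hM hL hB hp]; rfl

end Spray

/-! ### Pseudo-Minkowski functions and linear Killing fields -/

/-- `ℓ` is a pseudo-Minkowski function on the open set `Ω` of a single tangent space: a smooth
solution of the Euler equation of degree `2` with nondegenerate Hessian. -/
structure IsMinkowski (ℓ : R4 → ℝ) (Ω : Set R4) : Prop where
  isOpen : IsOpen Ω
  smooth : ContDiffOn ℝ ∞ ℓ Ω
  euler : ∀ v ∈ Ω, fderiv ℝ ℓ v v = 2 * ℓ v
  nondegenerate : ∀ v ∈ Ω, ∀ w, (∀ k, fderiv ℝ (fderiv ℝ ℓ) v k w = 0) → w = 0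

theorem IsMinkowski.mono {ℓ : R4 → ℝ} {Ω Ω' : Set R4} (h : IsMinkowski ℓ Ω) (hΩ' : IsOpen Ω')
    (hsub : Ω' ⊆ Ω) : IsMinkowski ℓ Ω' :=
  ⟨hΩ', h.smooth.mono hsub, fun v hv => h.euler v (hsub hv),
    fun v hv => h.nondegenerate v (hsub hv)⟩

namespace IsMinkowski

variable {ℓ : R4 → ℝ} {Ω : Set R4}

theorem differentiableAt (h : IsMinkowski ℓ Ω) {v : R4} (hv : v ∈ Ω) : DifferentiableAt ℝ ℓ v :=
  (h.smooth.contDiffAt (h.isOpen.mem_nhds hv)).differentiableAt (by simp)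

theorem differentiableAt_fderiv (h : IsMinkowski ℓ Ω) {v : R4} (hv : v ∈ Ω) :
    DifferentiableAt ℝ (fderiv ℝ ℓ) v :=
  ((h.smooth.fderiv_of_isOpen h.isOpen (m := ∞) (by simp)).contDiffAt
    (h.isOpen.mem_nhds hv)).differentiableAt (by simp)

theorem continuousOn_fderiv (h : IsMinkowski ℓ Ω) : ContinuousOn (fderiv ℝ ℓ) Ω := fun _ hv =>
  (h.differentiableAt_fderiv hv).continuousAt.continuousWithinAt

/-- Differentiating the relation `dℓ_v(Z v) = 0`. -/
theorem fderiv_of_kills (h : IsMinkowski ℓ Ω) {Z : R4 → R4} {Z' : R4 →L[ℝ] R4} {v : R4}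
    (hv : v ∈ Ω) (hZ : HasFDerivAt Z Z' v) (hz : ∀ w ∈ Ω, fderiv ℝ ℓ w (Z w) = 0) (k : R4) :
    fderiv ℝ (fderiv ℝ ℓ) v k (Z v) + fderiv ℝ ℓ v (Z' k) = 0 := by
  have c1 := (h.differentiableAt_fderiv hv).hasFDerivAt.clm_apply hZ
  have c2 := c1.unique ((hasFDerivAt_const (0 : ℝ) v).congr_of_eventuallyEq
    (by filter_upwards [h.isOpen.mem_nhds hv] with z hz' using hz z hz'))
  have c3 := congrArg (fun f : R4 →L[ℝ] ℝ => f k) c2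
  simp at c3
  linarith

/-- A fixed vector that annihilates `ℓ` on an open set vanishes. -/
theorem eq_zero_of_kills (h : IsMinkowski ℓ Ω) (hne : Ω.Nonempty) {w : R4}
    (hw : ∀ v ∈ Ω, fderiv ℝ ℓ v w = 0) : w = 0 := by
  obtain ⟨v, hv⟩ := hne
  refine h.nondegenerate v hv w fun k => ?_
  simpa using h.fderiv_of_kills hv (hasFDerivAt_const w v) hw k

/-- Uniqueness of the connection: a symmetric bilinear map `T` whose partial maps `T a` all
preserve `ℓ` vanishes. -/
theorem symmetric_eq_zero (h : IsMinkowski ℓ Ω) (hne : Ω.Nonempty) {T : R4 →L[ℝ] R4 →L[ℝ] R4}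
    (hsymm : ∀ a b, T a b = T b a) (hT : ∀ v ∈ Ω, ∀ a, fderiv ℝ ℓ v (T a v) = 0) : T = 0 := by
  have h1 : ∀ v ∈ Ω, T v v = 0 := by
    intro v hv
    refine h.nondegenerate v hv _ fun k => ?_
    have := h.fderiv_of_kills hv (T v).hasFDerivAt (fun w hw => hT w hw v) k
    rwa [hsymm v k, hT v hv k, add_zero] at this
  obtain ⟨v, hv⟩ := hne
  have h2 : ∀ k, T v k = 0 ∧ T k k = 0 := by
    intro k
    have hc : ∀ᶠ s : ℝ in 𝓝 0, v + s • k ∈ Ω ∧ v + (-s) • k ∈ Ω := by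
      have c1 : ContinuousAt (fun s : ℝ => v + s • k) 0 := by fun_prop
      have c2 : ContinuousAt (fun s : ℝ => v + (-s) • k) 0 := by fun_prop
      exact (c1.eventually_mem (by simpa using h.isOpen.mem_nhds hv)).and
        (c2.eventually_mem (by simpa using h.isOpen.mem_nhds hv))
    obtain ⟨s, ⟨hs1, hs2⟩, hs⟩ := ((hc.filter_mono nhdsWithin_le_nhds).and
      (self_mem_nhdsWithin (s := {(0 : ℝ)}ᶜ))).exists
    have hs0 : s ≠ 0 := hs
    have e1 := h1 _ hs1
    have e2 := h1 _ hs2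
    simp only [map_add, map_smul, add_apply, smul_apply, h1 v hv, hsymm k v] at e1 e2
    constructor
    · ext i
      have f1 := congrFun e1 i
      have f2 := congrFun e2 i
      simp at f1 f2
      have : s * T v k i = 0 := by linarith
      simpa [hs0] using this
    · ext i
      have f1 := congrFun e1 i
      have f2 := congrFun e2 i
      simp at f1 f2
      have : s * (s * T k k i) = 0 := by linarith
      simpa [hs0] using this
  ext a b i
  have e := (h2 (a + b)).2
  simp only [map_add, add_apply, (h2 a).2, (h2 b).2, hsymm b a] at e
  have := congrFun e i
  simp at this
  simpa using this

end IsMinkowski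

section Fibre

variable {M : Set R4} {A : Set TR4} {L : TR4 → ℝ} {Γ : ConnCoeff}

theorem IsPseudoFinsler.isOpen_fibre (hL : IsPseudoFinsler M A L) (x : R4) :
    IsOpen {v : R4 | (x, v) ∈ A} :=
  hL.conic.isOpen.preimage (by fun_prop : Continuous fun v : R4 => ((x, v) : TR4))

theorem IsPseudoFinsler.fderiv_fibre (hL : IsPseudoFinsler M A L) {x v : R4} (hv : (x, v) ∈ A)
    (w : R4) : fderiv ℝ (fun v => L (x, v)) v w = fderiv ℝ L (x, v) (0, w) := by
  have hd : DifferentiableAt ℝ L (x, v) :=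
    (hL.smooth.contDiffAt (hL.conic.isOpen.mem_nhds hv)).differentiableAt (by simp)
  have := hd.hasFDerivAt.comp v ((hasFDerivAt_const x v).prodMk (hasFDerivAt_id v))
  rw [show (fun v => L (x, v)) = L ∘ Prod.mk x from rfl, this.fderiv]
  simp

theorem IsPseudoFinsler.isMinkowski_fibre (hL : IsPseudoFinsler M A L) (x : R4) :
    IsMinkowski (fun v => L (x, v)) {v | (x, v) ∈ A} := by
  refine ⟨hL.isOpen_fibre x, ?_, ?_, ?_⟩
  · exact hL.smooth.comp (by fun_prop : ContDiff ℝ ∞ fun v : R4 => ((x, v) : TR4)).contDiffOn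
      fun v hv => hv
  · intro v hv
    rw [hL.fderiv_fibre hv]
    exact hL.euler hv
  · intro v hv w hw
    refine hL.hessian_nondegenerate hv fun k => ?_
    rw [← hw k]
    have e1 : ∀ w : R4, HasFDerivAt (fun v => fderiv ℝ (fun v => L (x, v)) v w)
        (((fderiv ℝ (fderiv ℝ L) (x, v)).flip (0, w)).comp (ContinuousLinearMap.inr ℝ R4 R4)) v := by
      intro w
      have c0 := (hL.differentiableAt_fderiv hv).hasFDerivAt.comp v
        ((hasFDerivAt_const x v).prodMk (hasFDerivAt_id v))
      have c1 := c0.clm_apply (hasFDerivAt_const ((0 : R4), w) v)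
      refine (c1.congr_of_eventuallyEq ?_).congr_fderiv ?_
      · filter_upwards [(hL.isOpen_fibre x).mem_nhds hv] with z hz
        exact hL.fderiv_fibre hz w
      · ext k; simp
    have hsm : ContDiffOn ℝ ∞ (fun v => L (x, v)) {v | (x, v) ∈ A} :=
      hL.smooth.comp (by fun_prop : ContDiff ℝ ∞ fun v : R4 => ((x, v) : TR4)).contDiffOn
        fun v hv => hv
    have hdd : DifferentiableAt ℝ (fderiv ℝ (fun v => L (x, v))) v :=
      ((hsm.fderiv_of_isOpen (hL.isOpen_fibre x) (m := ∞) (by simp)).contDiffAt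
        ((hL.isOpen_fibre x).mem_nhds hv)).differentiableAt (by simp)
    have e2 := (hdd.hasFDerivAt.clm_apply (hasFDerivAt_const w v)).unique (e1 w)
    have e3 := congrArg (fun f : R4 →L[ℝ] ℝ => f k) e2
    simp at e3
    exact e3.symm

theorem IsPseudoFinsler.fibre_nonempty (hL : IsPseudoFinsler M A L) {x : R4} (hx : x ∈ M) :
    {v : R4 | (x, v) ∈ A}.Nonempty := by
  obtain ⟨⟨x', v⟩, hp, rfl⟩ : x ∈ Prod.fst '' A := by rw [hL.conic.proj]; exact hx
  exact ⟨v, hp⟩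

/-- The linear vector field `x ↦ ε x` is a Killing field of `L`: its complete lift
annihilates `L`. -/
def IsLinearKilling (A : Set TR4) (L : TR4 → ℝ) (ε : R4 →L[ℝ] R4) : Prop :=
  ∀ p ∈ A, fderiv ℝ L p (ε p.1, ε p.2) = 0

variable {ε : R4 →L[ℝ] R4}

/-- The covariant derivative of a Killing field preserves `L`. -/
theorem IsLinearKilling.fderiv_nabla_eq_zero (hε : IsLinearKilling A L ε) (hM : IsOpen M)
    (hL : IsPseudoFinsler M A L) (hB : IsCanonicalConnection M A L Γ) {p : TR4} (hp : p ∈ A) :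
    fderiv ℝ L p (0, ε p.2 + connForm Γ p.1 (ε p.1) p.2) = 0 := by
  have h1 := hε p hp
  have h2 := fderiv_horizField_eq_zero hM hL hB hp (ε p.1)
  have e : ((0 : R4), ε p.2 + connForm Γ p.1 (ε p.1) p.2) =
      (ε p.1, ε p.2) - horizField (connForm Γ) (ε p.1) p := by simp [horizField]
  rw [e, map_sub, h1, h2, sub_zero]

/-- The canonical connection is invariant under linear Killing fields. -/
theorem IsLinearKilling.lieDeriv_connForm (hε : IsLinearKilling A L ε) (hM : IsOpen M)
    (hL : IsPseudoFinsler M A L) (hB : IsCanonicalConnection M A L Γ) {x : R4} (hx : x ∈ M)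
    (a v : R4) :
    fderiv ℝ (connForm Γ) x (ε x) a v + connForm Γ x a (ε v) + connForm Γ x (ε a) v =
      ε (connForm Γ x a v) := by
  have hA := hL.conic.isOpen
  have hsm := contDiffOn_connForm (hB.contDiffOn hL)
  have hd : ∀ y ∈ M, DifferentiableAt ℝ (connForm Γ) y := fun y hy =>
    (hsm.contDiffAt (hM.mem_nhds hy)).differentiableAt (by simp)
  set B := connForm Γ with hBdef
  let T : R4 →L[ℝ] R4 →L[ℝ] R4 := fderiv ℝ B x (ε x) + ((B x).flip.comp ε).flip + (B x).comp ε -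
    ((ContinuousLinearMap.compL ℝ R4 R4 R4) ε).comp (B x)
  have hT : ∀ a v, T a v = fderiv ℝ B x (ε x) a v + B x a (ε v) + B x (ε a) v - ε (B x a v) :=
    fun a v => by simp [T]
  have hsym : ∀ a b, T a b = T b a := by
    intro a b
    have hs := connForm_symm (hB.1 x hx)
    have hds : fderiv ℝ B x (ε x) a b = fderiv ℝ B x (ε x) b a := by
      have e : ∀ v w : R4, HasFDerivAt (fun y => B y v w) (((ContinuousLinearMap.apply ℝ R4 w).comp
          (ContinuousLinearMap.apply ℝ (R4 →L[ℝ] R4) v)).comp (fderiv ℝ B x)) x := fun v w =>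
        ((ContinuousLinearMap.apply ℝ R4 w).comp
          (ContinuousLinearMap.apply ℝ (R4 →L[ℝ] R4) v)).hasFDerivAt.comp x (hd x hx).hasFDerivAt
      have h2 := (e a b).congr_of_eventuallyEq (f₁ := fun y => B y b a)
        (by filter_upwards [hM.mem_nhds hx] with y hy using connForm_symm (hB.1 y hy) b a)
      have := congrArg (fun f : R4 →L[ℝ] R4 => f (ε x)) (h2.unique (e b a))
      simpa using this
    rw [hT, hT, hds, hs a b, hs a (ε b), hs (ε a) b]
    abel
  have hkill : ∀ v ∈ {v : R4 | (x, v) ∈ A}, ∀ a, fderiv ℝ (fun v => L (x, v)) v (T a v) = 0 := by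
    intro v hv a
    rw [hL.fderiv_fibre hv]
    obtain ⟨D, hD, hDq⟩ := hasFDerivAt_horizField (p := (x, v)) (hd x hx) a
    have hX : HasFDerivAt (fun p : TR4 => ((ε p.1, ε p.2) : TR4))
        ((ε.comp (ContinuousLinearMap.fst ℝ R4 R4)).prod
          (ε.comp (ContinuousLinearMap.snd ℝ R4 R4))) (x, v) :=
      (ε.hasFDerivAt.comp _ hasFDerivAt_fst).prodMk (ε.hasFDerivAt.comp _ hasFDerivAt_snd)
    have h1 := fderiv_lieBracket_eq_zero hA (hL.smooth.of_le two_le_infty) hv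
      hX.differentiableAt hD.differentiableAt hε
      (fun q hq => fderiv_horizField_eq_zero hM hL hB hq a)
    have h2 := fderiv_horizField_eq_zero hM hL hB hv (ε a)
    simp only [VectorField.lieBracket_eq, hX.fderiv] at h1
    rw [hD.fderiv, hDq] at h1
    have e : ((0 : R4), T a v) = -((((0 : R4), -(fderiv ℝ B x (ε x) a v + B x a (ε v))) -
        ((ε.comp (ContinuousLinearMap.fst ℝ R4 R4)).prod
          (ε.comp (ContinuousLinearMap.snd ℝ R4 R4))) (horizField B a (x, v))) +
        horizField B (ε a) (x, v)) := by
      rw [hT]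
      ext i <;> simp [horizField]
      ring
    rw [e, map_neg, map_add, h1, h2]
    simp
  have := (hL.isMinkowski_fibre x).symmetric_eq_zero (hL.fibre_nonempty hx) hsym hkill
  have e := hT a v
  rw [this] at e
  simp only [zero_apply] at e
  exact (sub_eq_zero.1 e.symm)

/-- At a zero of a linear Killing field `ε`, the curvature is equivariant under `ε`. -/
theorem IsLinearKilling.curv_equivariant (hε : IsLinearKilling A L ε) (hM : IsOpen M)
    (hL : IsPseudoFinsler M A L) (hB : IsCanonicalConnection M A L Γ) {x : R4} (hx : x ∈ M)
    (hεx : ε x = 0) (a b v : R4) :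
    curv (connForm Γ) x (ε a) b v + curv (connForm Γ) x a (ε b) v +
      curv (connForm Γ) x a b (ε v) = ε (curv (connForm Γ) x a b v) := by
  have hsm := contDiffOn_connForm (hB.contDiffOn hL)
  have hsm1 := hsm.fderiv_of_isOpen hM (m := ∞) (by simp)
  have hd : DifferentiableAt ℝ (connForm Γ) x :=
    (hsm.contDiffAt (hM.mem_nhds hx)).differentiableAt (by simp)
  have hd1 : DifferentiableAt ℝ (fderiv ℝ (connForm Γ)) x :=
    (hsm1.contDiffAt (hM.mem_nhds hx)).differentiableAt (by simp)
  set B := connForm Γ with hBdef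
  have E0 : ∀ a v, B x (ε a) v = ε (B x a v) - B x a (ε v) := fun a v => by
    have := hε.lieDeriv_connForm hM hL hB hx a v
    rw [hεx, map_zero, zero_apply, zero_apply, zero_add] at this
    rw [← this]; abel
  have E1 : ∀ c a v, fderiv ℝ B x (ε c) a v = ε (fderiv ℝ B x c a v) -
      fderiv ℝ B x c a (ε v) - fderiv ℝ B x c (ε a) v := by
    intro c a v
    have c0 : ∀ u w : R4, HasFDerivAt (fun y => B y u w) (((ContinuousLinearMap.apply ℝ R4 w).comp
          (ContinuousLinearMap.apply ℝ (R4 →L[ℝ] R4) u)).comp (fderiv ℝ B x)) x := fun u w =>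
        ((ContinuousLinearMap.apply ℝ R4 w).comp
          (ContinuousLinearMap.apply ℝ (R4 →L[ℝ] R4) u)).hasFDerivAt.comp x hd.hasFDerivAt
    have c1 := ((hd1.hasFDerivAt.clm_apply ε.hasFDerivAt).clm_apply
      (hasFDerivAt_const a x)).clm_apply (hasFDerivAt_const v x)
    have c2 := (c1.add (c0 a (ε v))).add (c0 (ε a) v)
    have c3 := ε.hasFDerivAt.comp x (c0 a v)
    have c4 := c2.unique (c3.congr_of_eventuallyEq (by
      filter_upwards [hM.mem_nhds hx] with y hy using hε.lieDeriv_connForm hM hL hB hy a v))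
    have c5 := congrArg (fun f : R4 →L[ℝ] R4 => f c) c4
    simp [hεx] at c5
    rw [← c5]; abel
  simp only [curv_apply, E0, E1, map_sub, map_add]
  abel

end Fibre

section

open Matrix

/-! ### Linear symmetries and quadratic functions -/

/-- The matrix `N` is an infinitesimal linear symmetry of `ℓ` on `Ω`. -/
def IsSym (ℓ : R4 → ℝ) (Ω : Set R4) (N : Matrix (Fin 4) (Fin 4) ℝ) : Prop :=
  ∀ v ∈ Ω, fderiv ℝ ℓ v (N *ᵥ v) = 0

/-- `ℓ` agrees with a quadratic form on no nonempty open subset of `Ω`. -/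
def IsNowhereQuadratic (ℓ : R4 → ℝ) (Ω : Set R4) : Prop :=
  ∀ Ω' ⊆ Ω, IsOpen Ω' → Ω'.Nonempty →
    ¬ ∃ G : Matrix (Fin 4) (Fin 4) ℝ, ∀ v ∈ Ω', ℓ v = v ⬝ᵥ (G *ᵥ v)

theorem eq_zero_of_analytic {f : R4 → ℝ} (hf : ContDiff ℝ ω f) {Ω : Set R4}
    (hΩ : IsOpen Ω) (hne : Ω.Nonempty) (h : ∀ v ∈ Ω, f v = 0) (v : R4) : f v = 0 := by
  obtain ⟨v₀, hv₀⟩ := hne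
  exact congrFun ((contDiff_omega_iff_analyticOnNhd.1 hf).eq_of_eventuallyEq (g := fun _ => 0) (fun _ _ => analyticAt_const)
    (by filter_upwards [hΩ.mem_nhds hv₀] with w hw using h w hw)) v

/-- A nonzero polynomial function has a nonzero value in every nonempty open set. -/
theorem exists_ne_zero_of_analytic {f : R4 → ℝ} (hf : ContDiff ℝ ω f) {Ω : Set R4}
    (hΩ : IsOpen Ω) (hne : Ω.Nonempty) {w : R4} (hw : f w ≠ 0) : ∃ v ∈ Ω, f v ≠ 0 := by
  by_contra! h
  exact hw (eq_zero_of_analytic hf hΩ hne h w)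

theorem mulVec_four (N : Matrix (Fin 4) (Fin 4) ℝ) (v : R4) (i : Fin 4) :
    (N *ᵥ v) i = N i 0 * v 0 + N i 1 * v 1 + N i 2 * v 2 + N i 3 * v 3 := by
  simp [Matrix.mulVec, dotProduct, Fin.sum_univ_four]

theorem fderiv_four (ℓ : R4 → ℝ) (v w : R4) :
    fderiv ℝ ℓ v w = w 0 * fderiv ℝ ℓ v (e 0) + w 1 * fderiv ℝ ℓ v (e 1) +
      w 2 * fderiv ℝ ℓ v (e 2) + w 3 * fderiv ℝ ℓ v (e 3) := by
  have := map_eq_sum_e (fderiv ℝ ℓ v).toLinearMap w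
  simpa [Fin.sum_univ_four] using this

namespace IsSym

variable {ℓ : R4 → ℝ} {Ω : Set R4} {N N' : Matrix (Fin 4) (Fin 4) ℝ}

theorem mono {Ω' : Set R4} (h : IsSym ℓ Ω N) (hsub : Ω' ⊆ Ω) : IsSym ℓ Ω' N :=
  fun v hv => h v (hsub hv)

theorem add (h : IsSym ℓ Ω N) (h' : IsSym ℓ Ω N') : IsSym ℓ Ω (N + N') := fun v hv => by
  rw [add_mulVec, map_add, h v hv, h' v hv, add_zero]

theorem smul (h : IsSym ℓ Ω N) (c : ℝ) : IsSym ℓ Ω (c • N) := fun v hv => by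
  rw [smul_mulVec, map_smul, h v hv, smul_zero]

theorem neg (h : IsSym ℓ Ω N) : IsSym ℓ Ω (-N) := by simpa using h.smul (-1)

theorem sub (h : IsSym ℓ Ω N) (h' : IsSym ℓ Ω N') : IsSym ℓ Ω (N - N') := by
  simpa [sub_eq_add_neg] using h.add h'.neg

theorem comm (hℓ : IsMinkowski ℓ Ω) (h : IsSym ℓ Ω N) (h' : IsSym ℓ Ω N') :
    IsSym ℓ Ω (N * N' - N' * N) := by
  intro v hv
  have hd : ∀ K : Matrix (Fin 4) (Fin 4) ℝ,
      HasFDerivAt (fun w : R4 => K *ᵥ w) (LinearMap.toContinuousLinearMap K.mulVecLin) v :=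
    fun K => (LinearMap.toContinuousLinearMap K.mulVecLin).hasFDerivAt
  have := fderiv_lieBracket_eq_zero hℓ.isOpen (hℓ.smooth.of_le two_le_infty) hv
    (hd N').differentiableAt (hd N).differentiableAt h' h
  simp only [VectorField.lieBracket_eq, (hd N).fderiv, (hd N').fderiv] at this
  rw [sub_mulVec, ← mulVec_mulVec, ← mulVec_mulVec]
  exact this

end IsSym

section Quadratic

variable {ℓ : R4 → ℝ} {Ω : Set R4}

theorem hasFDerivAt_quadratic {G : Matrix (Fin 4) (Fin 4) ℝ} (hG : G.IsSymm) (v : R4) :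
    ∃ D : R4 →L[ℝ] ℝ, HasFDerivAt (fun v : R4 => v ⬝ᵥ (G *ᵥ v)) D v ∧
      ∀ w, D w = 2 * (w ⬝ᵥ (G *ᵥ v)) := by
  let b : R4 →L[ℝ] R4 →L[ℝ] ℝ := LinearMap.toContinuousLinearMap
    (LinearMap.toContinuousLinearMap.toLinearMap ∘ₗ (Matrix.toLinearMap₂' ℝ G))
  have hb : ∀ v w, b v w = v ⬝ᵥ (G *ᵥ w) := fun v w => by
    simp [b, Matrix.toLinearMap₂'_apply']
  have h1 := b.hasFDerivAt.clm_apply (hasFDerivAt_id v)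
  refine ⟨_, h1.congr_of_eventuallyEq (Eventually.of_forall fun w => (hb w w).symm), fun w => ?_⟩
  simp only [_root_.add_apply, ContinuousLinearMap.comp_apply, ContinuousLinearMap.flip_apply, id,
    ContinuousLinearMap.id_apply, hb]
  have : v ⬝ᵥ (G *ᵥ w) = w ⬝ᵥ (G *ᵥ v) := by
    rw [dotProduct_mulVec, ← mulVec_transpose, hG.eq, dotProduct_comm]
  rw [this]; ring

/-- If the differential of `ℓ` is everywhere proportional to that of a quadratic form `q`, then
`ℓ / q` is locally constant where `q ≠ 0`, so `ℓ` is quadratic there. -/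
theorem IsMinkowski.quadratic_of_proportional (h : IsMinkowski ℓ Ω)
    {G : Matrix (Fin 4) (Fin 4) ℝ} (hG : G.IsSymm)
    (hp : ∀ v ∈ Ω, ∃ c : ℝ, ∀ w, fderiv ℝ ℓ v w = c * (w ⬝ᵥ (G *ᵥ v)))
    {v₀ : R4} (hv₀ : v₀ ∈ Ω) (hq : v₀ ⬝ᵥ (G *ᵥ v₀) ≠ 0) :
    ∃ Ω' ⊆ Ω, IsOpen Ω' ∧ v₀ ∈ Ω' ∧ ∃ c : ℝ, ∀ v ∈ Ω', ℓ v = c * (v ⬝ᵥ (G *ᵥ v)) := by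
  have hcq : ContinuousAt (fun v : R4 => v ⬝ᵥ (G *ᵥ v)) v₀ := by
    obtain ⟨D, hD, -⟩ := hasFDerivAt_quadratic hG v₀
    exact hD.continuousAt
  obtain ⟨r, hr, hball⟩ := Metric.eventually_nhds_iff_ball.1
    ((h.isOpen.eventually_mem hv₀).and (hcq.eventually_ne hq))
  have hder : ∀ v ∈ Metric.ball v₀ r, HasFDerivAt (fun v => ℓ v * (v ⬝ᵥ (G *ᵥ v))⁻¹)
      (0 : R4 →L[ℝ] ℝ) v := by
    intro v hv
    obtain ⟨hvΩ, hqv⟩ := hball v hv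
    obtain ⟨D, hD, hDw⟩ := hasFDerivAt_quadratic hG v
    refine ((h.differentiableAt hvΩ).hasFDerivAt.mul
      ((hasDerivAt_inv hqv).comp_hasFDerivAt v hD)).congr_fderiv ?_
    obtain ⟨c, hc⟩ := hp v hvΩ
    have hE := h.euler v hvΩ
    rw [hc] at hE
    ext w
    simp only [_root_.smul_apply, _root_.add_apply, smul_eq_mul, hDw, hc, _root_.zero_apply,
      Function.comp_apply]
    field_simp
    linear_combination (w ⬝ᵥ (G *ᵥ v)) * hE
  refine ⟨Metric.ball v₀ r, fun v hv => (hball v hv).1, Metric.isOpen_ball,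
    Metric.mem_ball_self hr, ℓ v₀ * (v₀ ⬝ᵥ (G *ᵥ v₀))⁻¹, fun v hv => ?_⟩
  have := (convex_ball v₀ r).is_const_of_fderivWithin_eq_zero (𝕜 := ℝ)
    (f := fun v => ℓ v * (v ⬝ᵥ (G *ᵥ v))⁻¹)
    (fun v hv => (hder v hv).differentiableAt.differentiableWithinAt)
    (fun v hv => by
      rw [fderivWithin_of_isOpen Metric.isOpen_ball hv, (hder v hv).fderiv])
    hv (Metric.mem_ball_self hr)
  rw [← this, inv_mul_cancel_right₀ (hball v hv).2]

theorem contDiff_quadratic (G : Matrix (Fin 4) (Fin 4) ℝ) :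
    ContDiff ℝ ω (fun v : R4 => v ⬝ᵥ (G *ᵥ v)) := by
  simp only [dotProduct, Matrix.mulVec, Fin.sum_univ_four]
  fun_prop

theorem IsMinkowski.not_proportional (h : IsMinkowski ℓ Ω) (hne : Ω.Nonempty)
    (hnq : IsNowhereQuadratic ℓ Ω) {G : Matrix (Fin 4) (Fin 4) ℝ} (hG : G.IsSymm)
    (hp : ∀ v ∈ Ω, ∃ c : ℝ, ∀ w, fderiv ℝ ℓ v w = c * (w ⬝ᵥ (G *ᵥ v)))
    {w : R4} (hw : w ⬝ᵥ (G *ᵥ w) ≠ 0) : False := by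
  obtain ⟨v, hv, hqv⟩ := exists_ne_zero_of_analytic (contDiff_quadratic G) h.isOpen hne hw
  obtain ⟨Ω', hsub, hopen, hvΩ', c, hc⟩ := h.quadratic_of_proportional hG hp hv hqv
  refine hnq Ω' hsub hopen ⟨v, hvΩ'⟩ ⟨c • G, fun v hv => ?_⟩
  rw [hc v hv, smul_mulVec, dotProduct_smul, smul_eq_mul]

end Quadratic

section Conj

variable {ℓ : R4 → ℝ} {Ω : Set R4} {P Q : Matrix (Fin 4) (Fin 4) ℝ}

theorem mulVec_cancel (hPQ : P * Q = 1) (v : R4) : P *ᵥ (Q *ᵥ v) = v := by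
  rw [mulVec_mulVec, hPQ, one_mulVec]

theorem contDiff_mulVec (P : Matrix (Fin 4) (Fin 4) ℝ) : ContDiff ℝ ∞ fun v : R4 => P *ᵥ v :=
  (LinearMap.toContinuousLinearMap P.mulVecLin).contDiff

theorem hasFDerivAt_mulVec (P : Matrix (Fin 4) (Fin 4) ℝ) (v : R4) :
    HasFDerivAt (fun w : R4 => P *ᵥ w) (LinearMap.toContinuousLinearMap P.mulVecLin) v :=
  (LinearMap.toContinuousLinearMap P.mulVecLin).hasFDerivAt

theorem IsMinkowski.fderiv_comp (h : IsMinkowski ℓ Ω) {v : R4} (hv : P *ᵥ v ∈ Ω) (w : R4) :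
    fderiv ℝ (fun v => ℓ (P *ᵥ v)) v w = fderiv ℝ ℓ (P *ᵥ v) (P *ᵥ w) := by
  have := (h.differentiableAt hv).hasFDerivAt.comp v (hasFDerivAt_mulVec P v)
  rw [show (fun v => ℓ (P *ᵥ v)) = ℓ ∘ fun v => P *ᵥ v from rfl, this.fderiv]
  rfl

/-- Pseudo-Minkowski functions are preserved by linear changes of coordinates. -/
theorem IsMinkowski.comp (h : IsMinkowski ℓ Ω) (hQP : Q * P = 1) (hPQ : P * Q = 1) :
    IsMinkowski (fun v => ℓ (P *ᵥ v)) {v | P *ᵥ v ∈ Ω} := by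
  have hopen : IsOpen {v : R4 | P *ᵥ v ∈ Ω} := h.isOpen.preimage (contDiff_mulVec P).continuous
  have hsm : ContDiffOn ℝ ∞ (fun v => ℓ (P *ᵥ v)) {v | P *ᵥ v ∈ Ω} :=
    h.smooth.comp (contDiff_mulVec P).contDiffOn fun v hv => hv
  refine ⟨hopen, hsm, fun v hv => ?_, fun v hv w hw => ?_⟩
  · rw [h.fderiv_comp hv]; exact h.euler _ hv
  · have hdd : DifferentiableAt ℝ (fderiv ℝ (fun v => ℓ (P *ᵥ v))) v :=
      ((hsm.fderiv_of_isOpen hopen (m := ∞) (by simp)).contDiffAt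
        (hopen.mem_nhds hv)).differentiableAt (by simp)
    have e1 := hdd.hasFDerivAt.clm_apply (hasFDerivAt_const w v)
    have e2 := ((h.differentiableAt_fderiv hv).hasFDerivAt.comp v
      (hasFDerivAt_mulVec P v)).clm_apply (hasFDerivAt_const (P *ᵥ w) v)
    have e3 := e1.unique (e2.congr_of_eventuallyEq (by
      filter_upwards [hopen.mem_nhds hv] with z hz using h.fderiv_comp hz w))
    have key : ∀ k, fderiv ℝ (fderiv ℝ ℓ) (P *ᵥ v) (P *ᵥ k) (P *ᵥ w) = 0 := by
      intro k
      have e4 := congrArg (fun f : R4 →L[ℝ] ℝ => f k) e3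
      simp [hw k] at e4
      exact e4.symm
    have hPw : P *ᵥ w = 0 := h.nondegenerate _ hv _ fun k => by
      have := key (Q *ᵥ k)
      rwa [mulVec_cancel hPQ] at this
    rw [← mulVec_cancel hQP w, hPw, mulVec_zero]

theorem IsNowhereQuadratic.comp (hnq : IsNowhereQuadratic ℓ Ω)
    (hQP : Q * P = 1) (hPQ : P * Q = 1) :
    IsNowhereQuadratic (fun v => ℓ (P *ᵥ v)) {v | P *ᵥ v ∈ Ω} := by
  rintro Ω' hsub hopen ⟨v₀, hv₀⟩ ⟨G, hG⟩
  refine hnq {w | Q *ᵥ w ∈ Ω'} (fun w hw => ?_)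
    (hopen.preimage (contDiff_mulVec Q).continuous) ⟨P *ᵥ v₀, ?_⟩ ⟨Qᵀ * G * Q, fun w hw => ?_⟩
  · have := hsub hw
    simpa [mulVec_cancel hPQ] using this
  · simpa [mulVec_cancel hQP] using hv₀
  · have := hG _ hw
    simp only [mulVec_cancel hPQ] at this
    rw [this, ← mulVec_mulVec, ← mulVec_mulVec, dotProduct_mulVec w Qᵀ, vecMul_transpose]

theorem isSym_conj (h : IsMinkowski ℓ Ω) (hQP : Q * P = 1) (hPQ : P * Q = 1)
    (N : Matrix (Fin 4) (Fin 4) ℝ) :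
    IsSym (fun v => ℓ (P *ᵥ v)) {v | P *ᵥ v ∈ Ω} N ↔ IsSym ℓ Ω (P * N * Q) := by
  constructor
  · intro hN w hw
    have hw' : P *ᵥ (Q *ᵥ w) ∈ Ω := by rwa [mulVec_cancel hPQ]
    have := hN (Q *ᵥ w) hw'
    rw [h.fderiv_comp hw', mulVec_cancel hPQ] at this
    rwa [← mulVec_mulVec, ← mulVec_mulVec]
  · intro hN v hv
    rw [h.fderiv_comp hv]
    have := hN (P *ᵥ v) hv
    rwa [← mulVec_mulVec, ← mulVec_mulVec, mulVec_cancel hQP] at this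

end Conj

end

section

open Matrix

/-! ### Symmetries of rotation invariant functions -/

section Dense

variable {ℓ : R4 → ℝ} {Ω : Set R4}

/-- A continuous function that vanishes off the zero set of a nonzero analytic function is zero. -/
theorem eq_zero_of_dense (hΩ : IsOpen Ω) {f φ : R4 → ℝ} (hf : ContinuousOn f Ω)
    (hφ : ContDiff ℝ ω φ) {w : R4} (hw : φ w ≠ 0) (h : ∀ v ∈ Ω, φ v ≠ 0 → f v = 0) :
    ∀ v ∈ Ω, f v = 0 := by
  intro v hv
  by_contra hne
  have hopen : IsOpen (Ω ∩ f ⁻¹' {0}ᶜ) := hf.isOpen_inter_preimage hΩ isOpen_compl_singleton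
  obtain ⟨u, ⟨hu, hfu⟩, hφu⟩ := exists_ne_zero_of_analytic hφ hopen ⟨v, hv, hne⟩ hw
  exact hfu (h u hu hφu)

theorem isOpen_inter_ne_zero (hΩ : IsOpen Ω) {φ : R4 → ℝ} (hφ : ContDiff ℝ ω φ) :
    IsOpen (Ω ∩ {v | φ v ≠ 0}) :=
  hΩ.inter (isOpen_ne_fun hφ.continuous continuous_const)

theorem IsMinkowski.eq_zero_of_kills_dense (h : IsMinkowski ℓ Ω) (hne : Ω.Nonempty)
    {φ : R4 → ℝ} (hφ : ContDiff ℝ ω φ) {w : R4} (hw : φ w ≠ 0) {k : R4}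
    (hk : ∀ v ∈ Ω, φ v ≠ 0 → fderiv ℝ ℓ v k = 0) : k = 0 :=
  h.eq_zero_of_kills hne
    (eq_zero_of_dense h.isOpen (h.continuousOn_fderiv.clm_apply continuousOn_const) hφ hw hk)

theorem IsMinkowski.isSym_of_dense (h : IsMinkowski ℓ Ω)
    {φ : R4 → ℝ} (hφ : ContDiff ℝ ω φ) {w : R4} (hw : φ w ≠ 0) {N : Matrix (Fin 4) (Fin 4) ℝ}
    (hN : ∀ v ∈ Ω, φ v ≠ 0 → fderiv ℝ ℓ v (N *ᵥ v) = 0) : IsSym ℓ Ω N :=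
  eq_zero_of_dense h.isOpen
    (h.continuousOn_fderiv.clm_apply (contDiff_mulVec N).continuous.continuousOn) hφ hw hN

theorem IsMinkowski.not_proportional_dense (h : IsMinkowski ℓ Ω) (hne : Ω.Nonempty)
    (hnq : IsNowhereQuadratic ℓ Ω) {φ : R4 → ℝ} (hφ : ContDiff ℝ ω φ) {u : R4} (hu : φ u ≠ 0)
    {G : Matrix (Fin 4) (Fin 4) ℝ} (hG : G.IsSymm)
    (hp : ∀ v ∈ Ω, φ v ≠ 0 → ∃ c : ℝ, ∀ w, fderiv ℝ ℓ v w = c * (w ⬝ᵥ (G *ᵥ v)))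
    {w : R4} (hw : w ⬝ᵥ (G *ᵥ w) ≠ 0) : False := by
  obtain ⟨v, hv, hφv⟩ := exists_ne_zero_of_analytic hφ h.isOpen hne hu
  have hsub : Ω ∩ {v | φ v ≠ 0} ⊆ Ω := inter_subset_left
  exact (h.mono (isOpen_inter_ne_zero h.isOpen hφ) hsub).not_proportional ⟨v, hv, hφv⟩
    (fun Ω' hΩ' => hnq Ω' (hΩ'.trans hsub)) hG (fun v hv => hp v hv.1 hv.2) hw

end Dense

/-- The generator of the rotations of the last two coordinates. -/
def Jstd : Matrix (Fin 4) (Fin 4) ℝ := !![0, 0, 0, 0; 0, 0, 0, 0; 0, 0, 0, -1; 0, 0, 1, 0]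

theorem Jstd_mulVec (v : R4) : Jstd *ᵥ v = ![0, 0, -v 3, v 2] := by
  ext i; fin_cases i <;> simp [Jstd, mulVec_four]

/-- The action of the rotation generator on matrices by commutators. -/
def adJ (N : Matrix (Fin 4) (Fin 4) ℝ) : Matrix (Fin 4) (Fin 4) ℝ := Jstd * N - N * Jstd

theorem adJ_eq (N : Matrix (Fin 4) (Fin 4) ℝ) :
    adJ N = !![0, 0, -N 0 3, N 0 2; 0, 0, -N 1 3, N 1 2;
      -N 3 0, -N 3 1, -N 3 2 - N 2 3, N 2 2 - N 3 3; N 2 0, N 2 1, N 2 2 - N 3 3, N 2 3 + N 3 2] := by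
  ext i j
  fin_cases i <;> fin_cases j <;>
    (simp only [adJ, Matrix.sub_apply, Matrix.mul_apply, Fin.sum_univ_four]; simp [Jstd]; try ring)

/-- The squared radius in the plane that `Jstd` rotates. -/
def zsq (v : R4) : ℝ := v 2 ^ 2 + v 3 ^ 2

theorem contDiff_zsq : ContDiff ℝ ω zsq := by unfold zsq; fun_prop

theorem zsq_e_two : zsq (e 2) ≠ 0 := by simp [zsq, e]

/-- The factor `h` such that `dℓ = h (v₂ dv₂ + v₃ dv₃)` on the plane rotated by `Jstd`. -/
def radial (ℓ : R4 → ℝ) (v : R4) : ℝ :=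
  (v 2 * fderiv ℝ ℓ v (e 2) + v 3 * fderiv ℝ ℓ v (e 3)) / zsq v

/-- In the splitting of `ℝ⁴` into the plane fixed by `Jstd` and the plane it rotates, the endomorphism
`u + z ↦ (w · z) p + s(u) w` attached to a vector `p` and a covector `s` of the fixed plane and to
the vector `w = (f, g)` of the rotated plane. -/
def kmat (p₀ p₁ s₀ s₁ f g : ℝ) : Matrix (Fin 4) (Fin 4) ℝ :=
  !![0, 0, p₀ * f, p₀ * g; 0, 0, p₁ * f, p₁ * g; f * s₀, f * s₁, 0, 0; g * s₀, g * s₁, 0, 0]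

/-- `(p, s)` is a pair of a vector and a covector of the plane fixed by `Jstd` that satisfies
`dℓ(p) + h s = 0`, where `h` is the radial factor of `ℓ`. This means that all the matrices
`kmat p s f g` are symmetries of the rotation invariant function `ℓ`; see `IsPair.isSym`. -/
def IsPair (ℓ : R4 → ℝ) (Ω : Set R4) (p₀ p₁ s₀ s₁ : ℝ) : Prop :=
  ∀ v ∈ Ω, zsq v ≠ 0 →
    p₀ * fderiv ℝ ℓ v (e 0) + p₁ * fderiv ℝ ℓ v (e 1) + radial ℓ v * (s₀ * v 0 + s₁ * v 1) = 0

section Std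

variable {ℓ : R4 → ℝ} {Ω : Set R4} {N : Matrix (Fin 4) (Fin 4) ℝ}
  {p₀ p₁ s₀ s₁ q₀ q₁ t₀ t₁ : ℝ}

theorem fderiv_mulVec (N : Matrix (Fin 4) (Fin 4) ℝ) (v : R4) :
    fderiv ℝ ℓ v (N *ᵥ v) =
      (N 0 0 * v 0 + N 0 1 * v 1 + N 0 2 * v 2 + N 0 3 * v 3) * fderiv ℝ ℓ v (e 0) +
      (N 1 0 * v 0 + N 1 1 * v 1 + N 1 2 * v 2 + N 1 3 * v 3) * fderiv ℝ ℓ v (e 1) +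
      (N 2 0 * v 0 + N 2 1 * v 1 + N 2 2 * v 2 + N 2 3 * v 3) * fderiv ℝ ℓ v (e 2) +
      (N 3 0 * v 0 + N 3 1 * v 1 + N 3 2 * v 2 + N 3 3 * v 3) * fderiv ℝ ℓ v (e 3) := by
  rw [fderiv_four]; simp only [mulVec_four]

theorem fderiv_eq_radial (hJ : IsSym ℓ Ω Jstd) {v : R4} (hv : v ∈ Ω) (hz : zsq v ≠ 0) :
    fderiv ℝ ℓ v (e 2) = radial ℓ v * v 2 ∧ fderiv ℝ ℓ v (e 3) = radial ℓ v * v 3 := by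
  have h := hJ v hv
  rw [fderiv_mulVec] at h
  simp [Jstd] at h
  unfold radial
  constructor
  · field_simp
    simp only [zsq]
    linear_combination -v 3 * h
  · field_simp
    simp only [zsq]
    linear_combination v 2 * h

theorem fderiv_mulVec_radial (hJ : IsSym ℓ Ω Jstd) {v : R4} (hv : v ∈ Ω) (hz : zsq v ≠ 0)
    (N : Matrix (Fin 4) (Fin 4) ℝ) :
    fderiv ℝ ℓ v (N *ᵥ v) =
      (N 0 0 * v 0 + N 0 1 * v 1 + N 0 2 * v 2 + N 0 3 * v 3) * fderiv ℝ ℓ v (e 0) +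
      (N 1 0 * v 0 + N 1 1 * v 1 + N 1 2 * v 2 + N 1 3 * v 3) * fderiv ℝ ℓ v (e 1) +
      radial ℓ v * ((N 2 0 * v 0 + N 2 1 * v 1 + N 2 2 * v 2 + N 2 3 * v 3) * v 2 +
      (N 3 0 * v 0 + N 3 1 * v 1 + N 3 2 * v 2 + N 3 3 * v 3) * v 3) := by
  rw [fderiv_mulVec, (fderiv_eq_radial hJ hv hz).1, (fderiv_eq_radial hJ hv hz).2]
  ring

theorem radial_ne_zero (h : IsMinkowski ℓ Ω) (hJ : IsSym ℓ Ω Jstd) {v : R4} (hv : v ∈ Ω)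
    (hz : zsq v ≠ 0) : radial ℓ v ≠ 0 := by
  intro h0
  have h2 := (fderiv_eq_radial hJ hv hz).1
  have h3 := (fderiv_eq_radial hJ hv hz).2
  rw [h0, zero_mul] at h2 h3
  have hk := h.nondegenerate v hv (Jstd *ᵥ v) fun k => by
    have := h.fderiv_of_kills hv (hasFDerivAt_mulVec Jstd v) hJ k
    have e1 : fderiv ℝ ℓ v (LinearMap.toContinuousLinearMap Jstd.mulVecLin k) = 0 := by
      show fderiv ℝ ℓ v (Jstd *ᵥ k) = 0
      rw [fderiv_four, Jstd_mulVec, h2, h3]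
      simp
    rwa [e1, add_zero] at this
  rw [Jstd_mulVec] at hk
  have a2 := congrFun hk 2
  have a3 := congrFun hk 3
  simp at a2 a3
  exact hz (by simp [zsq, a2, a3])

theorem isSym_adJ (h : IsMinkowski ℓ Ω) (hJ : IsSym ℓ Ω Jstd) (hN : IsSym ℓ Ω N) :
    IsSym ℓ Ω (adJ N) := hJ.comm h hN

/-- The component of weight two under the rotations vanishes: the lower block of a symmetry
commutes with the rotations. -/
theorem IsSym.lower_block (h : IsMinkowski ℓ Ω) (hne : Ω.Nonempty) (hN : IsSym ℓ Ω N)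
    (hJ : IsSym ℓ Ω Jstd) : N 2 2 = N 3 3 ∧ N 2 3 = -N 3 2 := by
  have a1 := isSym_adJ h hJ hN
  have a2 := isSym_adJ h hJ a1
  have a4 := isSym_adJ h hJ (isSym_adJ h hJ a2)
  -- `ad J` has the eigenvalues `0, ±i, ±2i`, and `(ad J ^ 2 + ad J ^ 4) / 12` is the projection to
  -- the part of weight two
  have w := (a2.add a4).smul (1 / 12)
  have hpoly : ∀ v : R4, (N 2 2 - N 3 3) * (v 2 ^ 2 - v 3 ^ 2) +
      2 * (N 2 3 + N 3 2) * v 2 * v 3 = 0 := by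
    refine eq_zero_of_analytic (by fun_prop) h.isOpen hne
      (eq_zero_of_dense h.isOpen (by fun_prop) contDiff_zsq zsq_e_two fun v hv hz => ?_)
    have := w v hv
    rw [fderiv_mulVec_radial hJ hv hz] at this
    simp [adJ_eq, -mul_eq_zero] at this
    have hr := radial_ne_zero h hJ hv hz
    have e1 : radial ℓ v * ((N 2 2 - N 3 3) * (v 2 ^ 2 - v 3 ^ 2) +
      2 * (N 2 3 + N 3 2) * v 2 * v 3) = 0 := by linear_combination 2 * this
    exact (mul_eq_zero.1 e1).resolve_left hr
  have b1 := hpoly ![0, 0, 1, 0]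
  have b2 := hpoly ![0, 0, 1, 1]
  simp at b1 b2
  constructor <;> linarith

/-- The off-diagonal part of a symmetry is a symmetry. -/
theorem IsSym.offDiag (h : IsMinkowski ℓ Ω) (hN : IsSym ℓ Ω N)
    (hJ : IsSym ℓ Ω Jstd) : IsSym ℓ Ω !![0, 0, N 0 2, N 0 3; 0, 0, N 1 2, N 1 3;
      N 2 0, N 2 1, 0, 0; N 3 0, N 3 1, 0, 0] := by
  have a1 := isSym_adJ h hJ hN
  have a2 := isSym_adJ h hJ a1
  have a4 := isSym_adJ h hJ (isSym_adJ h hJ a2)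
  -- `-(4 ad J ^ 2 + ad J ^ 4) / 3` is the projection to the part of weight one
  convert ((a2.smul 4).add a4).smul (-1 / 3) using 1
  ext i j
  fin_cases i <;> fin_cases j <;> simp [adJ_eq] <;> ring

/-- The two columns of the off-diagonal part of a symmetry, together with the corresponding rows,
form pairs. -/
theorem IsSym.isPair (h : IsMinkowski ℓ Ω) (hN : IsSym ℓ Ω N) (hJ : IsSym ℓ Ω Jstd) :
    IsPair ℓ Ω (N 0 2) (N 1 2) (N 2 0) (N 2 1) ∧ IsPair ℓ Ω (N 0 3) (N 1 3) (N 3 0) (N 3 1) := by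
  have a := hN.offDiag h hJ
  have b := isSym_adJ h hJ a
  have key : ∀ v ∈ Ω, zsq v ≠ 0 →
      N 0 2 * fderiv ℝ ℓ v (e 0) + N 1 2 * fderiv ℝ ℓ v (e 1) +
        radial ℓ v * (N 2 0 * v 0 + N 2 1 * v 1) = 0 ∧
      N 0 3 * fderiv ℝ ℓ v (e 0) + N 1 3 * fderiv ℝ ℓ v (e 1) +
        radial ℓ v * (N 3 0 * v 0 + N 3 1 * v 1) = 0 := by
    intro v hv hz
    have a' := a v hv
    have b' := b v hv
    rw [fderiv_mulVec_radial hJ hv hz] at a' b'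
    simp [adJ_eq] at a' b'
    constructor
    · refine (mul_eq_zero.1 (?_ : zsq v * _ = 0)).resolve_left hz
      simp only [zsq]
      linear_combination v 2 * a' + v 3 * b'
    · refine (mul_eq_zero.1 (?_ : zsq v * _ = 0)).resolve_left hz
      simp only [zsq]
      linear_combination v 3 * a' - v 2 * b'
  exact ⟨fun v hv hz => (key v hv hz).1, fun v hv hz => (key v hv hz).2⟩

theorem IsPair.isSym (h : IsMinkowski ℓ Ω) (hJ : IsSym ℓ Ω Jstd)
    (hp : IsPair ℓ Ω p₀ p₁ s₀ s₁) (f g : ℝ) : IsSym ℓ Ω (kmat p₀ p₁ s₀ s₁ f g) := by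
  refine h.isSym_of_dense contDiff_zsq zsq_e_two fun v hv hz => ?_
  rw [fderiv_mulVec_radial hJ hv hz]
  simp [kmat]
  linear_combination (f * v 2 + g * v 3) * hp v hv hz

theorem IsPair.sub_smul (hp : IsPair ℓ Ω p₀ p₁ s₀ s₁) (hq : IsPair ℓ Ω q₀ q₁ t₀ t₁) (c : ℝ) :
    IsPair ℓ Ω (q₀ - c * p₀) (q₁ - c * p₁) (t₀ - c * s₀) (t₁ - c * s₁) := fun v hv hz => by
  linear_combination hq v hv hz - c * hp v hv hz

/-- The commutator of the symmetries of two pairs has a lower block that commutes with rotations,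
which forces `s(q) = t(p)`. -/
theorem IsPair.reciprocity (h : IsMinkowski ℓ Ω) (hne : Ω.Nonempty) (hJ : IsSym ℓ Ω Jstd)
    (hp : IsPair ℓ Ω p₀ p₁ s₀ s₁) (hq : IsPair ℓ Ω q₀ q₁ t₀ t₁) :
    s₀ * q₀ + s₁ * q₁ = t₀ * p₀ + t₁ * p₁ := by
  have := (((hp.isSym h hJ 1 0).comm h (hq.isSym h hJ 1 0)).lower_block h hne hJ).1
  simp [kmat] at this
  linarith

theorem IsPair.covector_eq_zero (h : IsMinkowski ℓ Ω) (hne : Ω.Nonempty) (hJ : IsSym ℓ Ω Jstd)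
    (hp : IsPair ℓ Ω 0 0 s₀ s₁) : s₀ = 0 ∧ s₁ = 0 := by
  have hpoly : ∀ v : R4, s₀ * v 0 + s₁ * v 1 = 0 := by
    refine eq_zero_of_analytic (by fun_prop) h.isOpen hne
      (eq_zero_of_dense h.isOpen (by fun_prop) contDiff_zsq zsq_e_two fun v hv hz => ?_)
    have := hp v hv hz
    simp only [zero_mul, zero_add] at this
    exact (mul_eq_zero.1 this).resolve_left (radial_ne_zero h hJ hv hz)
  have b0 := hpoly (e 0)
  have b1 := hpoly (e 1)
  simp [e] at b0 b1
  exact ⟨b0, b1⟩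

theorem IsPair.vector_eq_zero (h : IsMinkowski ℓ Ω) (hne : Ω.Nonempty)
    (hp : IsPair ℓ Ω p₀ p₁ 0 0) : p₀ = 0 ∧ p₁ = 0 := by
  have := h.eq_zero_of_kills_dense hne contDiff_zsq zsq_e_two (k := ![p₀, p₁, 0, 0])
    fun v hv hz => by
      have := hp v hv hz
      rw [fderiv_four]
      simpa using this
  have b0 := congrFun this 0
  have b1 := congrFun this 1
  simpa using And.intro b0 b1

/-- The differential of `ℓ` cannot be a multiple of a block-diagonal quadratic form. -/
theorem not_block_quadratic (h : IsMinkowski ℓ Ω) (hne : Ω.Nonempty)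
    (hnq : IsNowhereQuadratic ℓ Ω) (hJ : IsSym ℓ Ω Jstd) {φ : R4 → ℝ} (hφ : ContDiff ℝ ω φ)
    {u : R4} (hu : φ u ≠ 0) (a b c : ℝ)
    (h0 : ∀ v ∈ Ω, zsq v ≠ 0 → φ v ≠ 0 →
      fderiv ℝ ℓ v (e 0) = radial ℓ v * (a * v 0 + b * v 1) ∧
      fderiv ℝ ℓ v (e 1) = radial ℓ v * (b * v 0 + c * v 1)) : False := by
  obtain ⟨u', hu', hzu'⟩ := exists_ne_zero_of_analytic contDiff_zsq
    (isOpen_inter_ne_zero isOpen_univ hφ) ⟨u, mem_univ _, hu⟩ zsq_e_two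
  refine h.not_proportional_dense hne hnq (contDiff_zsq.mul hφ) (mul_ne_zero hzu' hu'.2)
    (G := !![a, b, 0, 0; b, c, 0, 0; 0, 0, 1, 0; 0, 0, 0, 1]) ?_ (fun v hv hφv => ?_) (w := e 2) ?_
  · ext i j; fin_cases i <;> fin_cases j <;> rfl
  · obtain ⟨hz, hv'⟩ := mul_ne_zero_iff.1 hφv
    refine ⟨radial ℓ v, fun w => ?_⟩
    rw [fderiv_four, (fderiv_eq_radial hJ hv hz).1, (fderiv_eq_radial hJ hv hz).2,
      (h0 v hv hz hv').1, (h0 v hv hz hv').2]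
    simp [dotProduct, mulVec_four, Fin.sum_univ_four]
    ring
  · simp [dotProduct, mulVec_four, Fin.sum_univ_four, e]

/-- Any two pairs are linearly dependent, since two independent ones force `ℓ` to be quadratic. -/
theorem IsPair.det_eq_zero (h : IsMinkowski ℓ Ω) (hne : Ω.Nonempty)
    (hnq : IsNowhereQuadratic ℓ Ω) (hJ : IsSym ℓ Ω Jstd)
    (hp : IsPair ℓ Ω p₀ p₁ s₀ s₁) (hq : IsPair ℓ Ω q₀ q₁ t₀ t₁) : p₀ * q₁ - p₁ * q₀ = 0 := by
  by_contra hd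
  replace hd : p₀ * q₁ - p₁ * q₀ ≠ 0 := hd
  have hrec := hp.reciprocity h hne hJ hq
  -- solve the two relations for the differential of `ℓ` along the fixed plane
  obtain ⟨a, ha⟩ : ∃ a, a * (p₀ * q₁ - p₁ * q₀) = -(q₁ * s₀ - p₁ * t₀) :=
    ⟨_, div_mul_cancel₀ _ hd⟩
  obtain ⟨b, hb⟩ : ∃ b, b * (p₀ * q₁ - p₁ * q₀) = -(q₁ * s₁ - p₁ * t₁) :=
    ⟨_, div_mul_cancel₀ _ hd⟩
  obtain ⟨c, hc⟩ : ∃ c, c * (p₀ * q₁ - p₁ * q₀) = -(p₀ * t₁ - q₀ * s₁) :=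
    ⟨_, div_mul_cancel₀ _ hd⟩
  refine not_block_quadratic h hne hnq hJ contDiff_zsq zsq_e_two a b c fun v hv hz _ => ?_
  have e1 := hp v hv hz
  have e2 := hq v hv hz
  constructor
  · refine mul_left_cancel₀ hd ?_
    linear_combination q₁ * e1 - p₁ * e2 - radial ℓ v * (v 0 * ha + v 1 * hb)
  · refine mul_left_cancel₀ hd ?_
    linear_combination p₀ * e2 - q₀ * e1 - radial ℓ v * (v 0 * hb + v 1 * hc) +
      radial ℓ v * v 0 * hrec

theorem IsPair.proportional (h : IsMinkowski ℓ Ω) (hne : Ω.Nonempty)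
    (hnq : IsNowhereQuadratic ℓ Ω) (hJ : IsSym ℓ Ω Jstd)
    (hp : IsPair ℓ Ω p₀ p₁ s₀ s₁) (hq : IsPair ℓ Ω q₀ q₁ t₀ t₁) (hp0 : p₀ ≠ 0 ∨ p₁ ≠ 0) :
    ∃ c, q₀ = c * p₀ ∧ q₁ = c * p₁ ∧ t₀ = c * s₀ ∧ t₁ = c * s₁ := by
  have hd := hp.det_eq_zero h hne hnq hJ hq
  obtain ⟨c, h0, h1⟩ : ∃ c, q₀ = c * p₀ ∧ q₁ = c * p₁ := by
    rcases hp0 with h0 | h0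
    · refine ⟨q₀ / p₀, by field_simp, ?_⟩
      field_simp; linear_combination hd
    · refine ⟨q₁ / p₁, ?_, by field_simp⟩
      field_simp; linear_combination -hd
  have := hp.sub_smul hq c
  rw [h0, h1, sub_self, sub_self] at this
  have := this.covector_eq_zero h hne hJ
  exact ⟨c, h0, h1, by linarith [this.1], by linarith [this.2]⟩

theorem IsPair.covector_ne_zero (h : IsMinkowski ℓ Ω) (hne : Ω.Nonempty)
    (hp : IsPair ℓ Ω p₀ p₁ s₀ s₁) (hp0 : p₀ ≠ 0 ∨ p₁ ≠ 0) : s₀ ≠ 0 ∨ s₁ ≠ 0 := by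
  by_contra! hs
  rw [hs.1, hs.2] at hp
  have := hp.vector_eq_zero h hne
  tauto

end Std

end

section

open Matrix

/-! ### Rotation equivariant curvature tensors -/

theorem adJ_eq_zero {m : Matrix (Fin 4) (Fin 4) ℝ} (hm : adJ m = 0) :
    m 0 2 = 0 ∧ m 0 3 = 0 ∧ m 1 2 = 0 ∧ m 1 3 = 0 ∧ m 2 0 = 0 ∧ m 2 1 = 0 ∧ m 3 0 = 0 ∧
      m 3 1 = 0 ∧ m 3 3 = m 2 2 ∧ m 2 3 = -m 3 2 := by
  rw [adJ_eq] at hm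
  have f := fun i j => congrFun (congrFun hm i) j
  have h02 := f 0 2
  have h03 := f 0 3
  have h12 := f 1 2
  have h13 := f 1 3
  have h20 := f 2 0
  have h21 := f 2 1
  have h30 := f 3 0
  have h31 := f 3 1
  have h22 := f 2 2
  have h23 := f 2 3
  simp at h02 h03 h12 h13 h20 h21 h30 h31 h22 h23
  refine ⟨h03, h02, h13, h12, h30, h31, h20, h21, by linarith, by linarith⟩

/-- A matrix of weight one under the rotations is off-diagonal. -/
theorem adJ_adJ_eq_neg {m : Matrix (Fin 4) (Fin 4) ℝ} (hm : adJ (adJ m) = -m) :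
    m 0 0 = 0 ∧ m 0 1 = 0 ∧ m 1 0 = 0 ∧ m 1 1 = 0 ∧ m 2 2 = 0 ∧ m 2 3 = 0 ∧ m 3 2 = 0 ∧
      m 3 3 = 0 := by
  simp only [adJ_eq] at hm
  have f := fun i j => congrFun (congrFun hm i) j
  have h00 := f 0 0
  have h01 := f 0 1
  have h10 := f 1 0
  have h11 := f 1 1
  have h22 := f 2 2
  have h23 := f 2 3
  have h32 := f 3 2
  have h33 := f 3 3
  simp at h00 h01 h10 h11 h22 h23 h32 h33
  refine ⟨h00, h01, h10, h11, ?_, ?_, ?_, ?_⟩ <;> linarith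

theorem exists_zsq_mul_ne_zero {φ : R4 → ℝ} (hφ : ContDiff ℝ ω φ) {w : R4} (hw : φ w ≠ 0) :
    ∃ u, zsq u * φ u ≠ 0 := by
  obtain ⟨u, hu, hzu⟩ := exists_ne_zero_of_analytic contDiff_zsq
    (isOpen_inter_ne_zero isOpen_univ hφ) ⟨w, mem_univ _, hw⟩ zsq_e_two
  exact ⟨u, mul_ne_zero hzu hu.2⟩

section Curvature

variable {ℓ : R4 → ℝ} {Ω : Set R4} {N m : Matrix (Fin 4) (Fin 4) ℝ} {p₀ p₁ s₀ s₁ : ℝ}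

/-- If the three vectors obtained from a symmetry `kmat p s f g`, its rotation and a block-diagonal
symmetry `m` are dependent everywhere, the lower block of `m` is trace-free. -/
theorem lower_trace_eq_zero_of_dependent (hΩ : IsOpen Ω) (hne : Ω.Nonempty)
    (hp0 : p₀ ≠ 0 ∨ p₁ ≠ 0) (hs0 : s₀ ≠ 0 ∨ s₁ ≠ 0) {f g : ℝ} (hfg : f ≠ 0 ∨ g ≠ 0)
    (hm : adJ m = 0)
    (hdep : ∀ v ∈ Ω, ∃ a b c : ℝ, (a ≠ 0 ∨ b ≠ 0 ∨ c ≠ 0) ∧ a • (kmat p₀ p₁ s₀ s₁ f g *ᵥ v) +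
      b • (kmat p₀ p₁ s₀ s₁ (-g) f *ᵥ v) + c • (m *ᵥ v) = 0) : m 2 2 = 0 := by
  obtain ⟨h02, h03, h12, h13, h20, h21, h30, h31, h33, h23⟩ := adJ_eq_zero hm
  have hφ : ContDiff ℝ ω fun v : R4 => s₀ * v 0 + s₁ * v 1 := by fun_prop
  have hφw : s₀ * (![s₀, s₁, 0, 0] : R4) 0 + s₁ * (![s₀, s₁, 0, 0] : R4) 1 ≠ 0 := by
    have h2 : s₀ ^ 2 + s₁ ^ 2 ≠ 0 := by rcases hs0 with h | h <;> positivity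
    simpa [sq] using h2
  have key : ∀ v ∈ Ω, s₀ * v 0 + s₁ * v 1 ≠ 0 →
      (s₀ * v 0 + s₁ * v 1) * (m 0 0 * v 0 + m 0 1 * v 1) - m 2 2 * zsq v * p₀ = 0 ∧
      (s₀ * v 0 + s₁ * v 1) * (m 1 0 * v 0 + m 1 1 * v 1) - m 2 2 * zsq v * p₁ = 0 := by
    intro v hv hD
    obtain ⟨a, b, c, habc, h⟩ := hdep v hv
    have f0 := congrFun h 0
    have f1 := congrFun h 1
    have f2 := congrFun h 2
    have f3 := congrFun h 3
    simp only [Pi.add_apply, Pi.smul_apply, mulVec_four, Pi.zero_apply] at f0 f1 f2 f3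
    simp [kmat, h02, h03, h12, h13, h20, h21, h30, h31, h33, h23] at f0 f1 f2 f3
    have hc : c ≠ 0 := by
      rintro rfl
      have e1 : a * f - b * g = 0 :=
        (mul_eq_zero.1 (by linear_combination f2 : (s₀ * v 0 + s₁ * v 1) * _ = 0)).resolve_left hD
      have e2 : a * g + b * f = 0 :=
        (mul_eq_zero.1 (by linear_combination f3 : (s₀ * v 0 + s₁ * v 1) * _ = 0)).resolve_left hD
      have hfg2 : f ^ 2 + g ^ 2 ≠ 0 := by rcases hfg with h | h <;> positivity
      have ha : a = 0 := (mul_eq_zero.1 (by linear_combination f * e1 + g * e2 :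
        a * (f ^ 2 + g ^ 2) = 0)).resolve_right hfg2
      have hb : b = 0 := (mul_eq_zero.1 (by linear_combination f * e2 - g * e1 :
        b * (f ^ 2 + g ^ 2) = 0)).resolve_right hfg2
      simp [ha, hb] at habc
    constructor
    · refine (mul_eq_zero.1 (?_ : c * _ = 0)).resolve_left hc
      simp only [zsq]
      linear_combination (s₀ * v 0 + s₁ * v 1) * f0 - p₀ * (v 2 * f2 + v 3 * f3)
    · refine (mul_eq_zero.1 (?_ : c * _ = 0)).resolve_left hc
      simp only [zsq]
      linear_combination (s₀ * v 0 + s₁ * v 1) * f1 - p₁ * (v 2 * f2 + v 3 * f3)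
  have hz := contDiff_zsq
  have c0 := eq_zero_of_analytic (f := fun v => (s₀ * v 0 + s₁ * v 1) *
      (m 0 0 * v 0 + m 0 1 * v 1) - m 2 2 * zsq v * p₀) (by fun_prop) hΩ hne
    (eq_zero_of_dense hΩ (by have := hz.continuous; fun_prop) hφ hφw
      fun v hv hD => (key v hv hD).1) (e 2)
  have c1 := eq_zero_of_analytic (f := fun v => (s₀ * v 0 + s₁ * v 1) *
      (m 1 0 * v 0 + m 1 1 * v 1) - m 2 2 * zsq v * p₁) (by fun_prop) hΩ hne
    (eq_zero_of_dense hΩ (by have := hz.continuous; fun_prop) hφ hφw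
      fun v hv hD => (key v hv hD).2) (e 2)
  simp [e, zsq] at c0 c1
  tauto

/-- A block-diagonal symmetry with nonzero trace on the lower block excludes symmetries of weight
one, if all symmetries in question span at most two directions everywhere. -/
theorem weight_one_eq_zero (h : IsMinkowski ℓ Ω) (hne : Ω.Nonempty)
    (hnq : IsNowhereQuadratic ℓ Ω) (hJ : IsSym ℓ Ω Jstd) (hN : IsSym ℓ Ω N)
    (hN1 : adJ (adJ N) = -N) (hm : adJ m = 0) (hm2 : m 2 2 ≠ 0)
    (hdep : ∀ v ∈ Ω, ∃ a b c : ℝ, (a ≠ 0 ∨ b ≠ 0 ∨ c ≠ 0) ∧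
      a • (N *ᵥ v) + b • (adJ N *ᵥ v) + c • (m *ᵥ v) = 0) : N = 0 := by
  obtain ⟨h00, h01, h10, h11, h22, h23, h32, h33⟩ := adJ_adJ_eq_neg hN1
  obtain ⟨hp2, hp3⟩ := hN.isPair h hJ
  have hadJ : ∀ p₀ p₁ s₀ s₁ f g : ℝ, adJ (kmat p₀ p₁ s₀ s₁ f g) = kmat p₀ p₁ s₀ s₁ (-g) f := by
    intro p₀ p₁ s₀ s₁ f g
    rw [adJ_eq]
    ext i j; fin_cases i <;> fin_cases j <;> simp [kmat]
  have hk : ∀ p₀ p₁ s₀ s₁ f g : ℝ, IsPair ℓ Ω p₀ p₁ s₀ s₁ → (p₀ ≠ 0 ∨ p₁ ≠ 0) →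
      (f ≠ 0 ∨ g ≠ 0) → N = kmat p₀ p₁ s₀ s₁ f g → False := by
    rintro p₀ p₁ s₀ s₁ f g hp hp0 hfg rfl
    refine hm2 (lower_trace_eq_zero_of_dependent h.isOpen hne hp0 (hp.covector_ne_zero h hne hp0)
      hfg hm fun v hv => ?_)
    simpa only [hadJ] using hdep v hv
  have k2 : N 0 2 = 0 ∧ N 1 2 = 0 := by
    by_contra hp0
    have hp0 : N 0 2 ≠ 0 ∨ N 1 2 ≠ 0 := by tauto
    obtain ⟨c, c0, c1, c2, c3⟩ := hp2.proportional h hne hnq hJ hp3 hp0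
    refine hk _ _ _ _ 1 c hp2 hp0 (by simp) ?_
    ext i j
    fin_cases i <;> fin_cases j <;> simp [kmat, *] <;> ring
  have k3 : N 0 3 = 0 ∧ N 1 3 = 0 := by
    by_contra hp0
    have hp0 : N 0 3 ≠ 0 ∨ N 1 3 ≠ 0 := by tauto
    obtain ⟨c, c0, c1, c2, c3⟩ := hp3.proportional h hne hnq hJ hp2 hp0
    refine hk _ _ _ _ c 1 hp3 hp0 (by simp) ?_
    ext i j
    fin_cases i <;> fin_cases j <;> simp [kmat, h00, h01, h10, h11, h22, h23, h32, h33, c2, c3] <;>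
      linarith
  rw [k2.1, k2.2] at hp2
  rw [k3.1, k3.2] at hp3
  obtain ⟨l2, l2'⟩ := hp2.covector_eq_zero h hne hJ
  obtain ⟨l3, l3'⟩ := hp3.covector_eq_zero h hne hJ
  ext i j
  fin_cases i <;> fin_cases j <;> simp [*]

/-- A rotation equivariant algebraic curvature family of symmetries which is trace-free and spans
at most two directions everywhere is trace-free on the lower block. -/
theorem curvature_lower_trace (h : IsMinkowski ℓ Ω) (hne : Ω.Nonempty)
    (hnq : IsNowhereQuadratic ℓ Ω) (hJ : IsSym ℓ Ω Jstd)
    {R : Fin 4 → Fin 4 → Matrix (Fin 4) (Fin 4) ℝ} (hR : ∀ i j, IsSym ℓ Ω (R i j))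
    (hanti : ∀ i j, R i j = -R j i)
    (hbianchi : ∀ i j k l, R i j l k + R j k l i + R k i l j = 0)
    (htr : ∀ i j, (R i j).trace = 0)
    (e01 : adJ (R 0 1) = 0) (e23 : adJ (R 2 3) = 0)
    (e02 : adJ (R 0 2) = R 0 3) (e03 : adJ (R 0 3) = -R 0 2)
    (e12 : adJ (R 1 2) = R 1 3) (e13 : adJ (R 1 3) = -R 1 2)
    (hdep : ∀ v ∈ Ω, ∀ i j k l m n, ∃ a b c : ℝ, (a ≠ 0 ∨ b ≠ 0 ∨ c ≠ 0) ∧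
      a • (R i j *ᵥ v) + b • (R k l *ᵥ v) + c • (R m n *ᵥ v) = 0) (i j : Fin 4) :
    R i j 2 2 + R i j 3 3 = 0 := by
  -- if the lower block of `R 0 1` or `R 2 3` had a trace, the components `R 0 2` and `R 1 2` of
  -- weight one would vanish, against the Bianchi identity or the vanishing of the total trace
  have w02 : adJ (adJ (R 0 2)) = -R 0 2 := by rw [e02, e03]
  have w12 : adJ (adJ (R 1 2)) = -R 1 2 := by rw [e12, e13]
  have z : ∀ m n, adJ (R m n) = 0 → R m n 2 2 ≠ 0 → R 0 2 = 0 ∧ R 1 2 = 0 := by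
    intro m n hmn h2
    constructor
    · refine weight_one_eq_zero h hne hnq hJ (hR 0 2) w02 hmn h2 fun v hv => ?_
      rw [e02]; exact hdep v hv _ _ _ _ _ _
    · refine weight_one_eq_zero h hne hnq hJ (hR 1 2) w12 hmn h2 fun v hv => ?_
      rw [e12]; exact hdep v hv _ _ _ _ _ _
  have t01 : R 0 1 2 2 = 0 := by
    by_contra hc
    obtain ⟨h1, h2⟩ := z 0 1 e01 hc
    have := hbianchi 0 1 2 2
    rw [h2, hanti 2 0, h1] at this
    simp at this
    exact hc this
  have t23 : R 2 3 2 2 = 0 := by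
    by_contra hc
    obtain ⟨h1, h2⟩ := z 2 3 e23 hc
    have e1 : R 0 3 = 0 := by rw [← e02, h1]; simp [adJ]
    have e2 : R 1 3 = 0 := by rw [← e12, h2]; simp [adJ]
    have b0 := hbianchi 2 3 0 0
    have b1 := hbianchi 2 3 1 1
    rw [hanti 3 0, e1, h1] at b0
    rw [hanti 3 1, e2, h2] at b1
    simp at b0 b1
    have := htr 2 3
    rw [Matrix.trace, Fin.sum_univ_four] at this
    simp only [diag_apply] at this
    rw [b0, b1, (adJ_eq_zero e23).2.2.2.2.2.2.2.2.1] at this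
    exact hc (by linarith)
  have t01' : R 0 1 3 3 = 0 := by rw [(adJ_eq_zero e01).2.2.2.2.2.2.2.2.1, t01]
  have t23' : R 2 3 3 3 = 0 := by rw [(adJ_eq_zero e23).2.2.2.2.2.2.2.2.1, t23]
  have w03 : adJ (adJ (R 0 3)) = -R 0 3 := by rw [e03, ← e02]; simp [adJ]; abel
  have w13 : adJ (adJ (R 1 3)) = -R 1 3 := by rw [e13, ← e12]; simp [adJ]; abel
  obtain ⟨-, -, -, -, a2, -, -, a3⟩ := adJ_adJ_eq_neg w02
  obtain ⟨-, -, -, -, b2, -, -, b3⟩ := adJ_adJ_eq_neg w12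
  obtain ⟨-, -, -, -, c2, -, -, c3⟩ := adJ_adJ_eq_neg w03
  obtain ⟨-, -, -, -, d2, -, -, d3⟩ := adJ_adJ_eq_neg w13
  have up : ∀ i j, i < j → R i j 2 2 + R i j 3 3 = 0 := by
    intro i j hij
    fin_cases i <;> fin_cases j <;> first
      | exact absurd hij (by decide)
      | simp [t01, t01', t23, t23', a2, a3, b2, b3, c2, c3, d2, d3]
  rcases lt_trichotomy i j with hij | rfl | hij
  · exact up i j hij
  · have a2 := congrFun (congrFun (hanti i i) 2) 2
    have a3 := congrFun (congrFun (hanti i i) 3) 3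
    simp only [Matrix.neg_apply] at a2 a3
    linarith
  · rw [hanti i j]
    have := up j i hij
    simp only [Matrix.neg_apply]
    linarith

end Curvature

end

section

open Matrix

/-! ### Invariant forms in the presence of a pair -/

/-- A matrix whose quadratic form vanishes is antisymmetric. -/
theorem add_transpose_eq_zero {M : Matrix (Fin 4) (Fin 4) ℝ} (h : ∀ v : R4, v ⬝ᵥ (M *ᵥ v) = 0) :
    M + Mᵀ = 0 := by
  ext i j
  have h1 := h (e i + e j)
  have h2 := h (e i)
  have h3 := h (e j)
  simp only [e, mulVec_add, dotProduct_add, add_dotProduct, mulVec_single_one,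
    single_one_dotProduct, col_apply] at h1 h2 h3
  simp only [Matrix.add_apply, transpose_apply, Matrix.zero_apply]
  linarith

/-- The matrix `N` becomes trace-free on both blocks in some basis in which the rotation generator
is a symmetry of `ℓ`. -/
def IsBlockTraceFree (ℓ : R4 → ℝ) (Ω : Set R4) (N : Matrix (Fin 4) (Fin 4) ℝ) : Prop :=
  ∃ P Q : Matrix (Fin 4) (Fin 4) ℝ, Q * P = 1 ∧ P * Q = 1 ∧ IsSym ℓ Ω (P * Jstd * Q) ∧
    (Q * N * P) 0 0 + (Q * N * P) 1 1 = 0 ∧ (Q * N * P) 2 2 + (Q * N * P) 3 3 = 0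

/-- There is a nondegenerate symmetric bilinear form, of any signature, for which all block trace-free
symmetries of `ℓ` are antisymmetric. -/
def HasInvariantForm (ℓ : R4 → ℝ) (Ω : Set R4) : Prop :=
  ∃ q : Matrix (Fin 4) (Fin 4) ℝ, q.IsSymm ∧ q.det ≠ 0 ∧
    ∀ N, IsSym ℓ Ω N → IsBlockTraceFree ℓ Ω N → q * N + (q * N)ᵀ = 0

section Conj

variable {ℓ : R4 → ℝ} {Ω : Set R4} {P Q N : Matrix (Fin 4) (Fin 4) ℝ}

theorem conj_conj (hPQ : P * Q = 1) (N : Matrix (Fin 4) (Fin 4) ℝ) :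
    P * (Q * N * P) * Q = N := by
  calc P * (Q * N * P) * Q = (P * Q) * N * (P * Q) := by simp only [Matrix.mul_assoc]
    _ = N := by rw [hPQ, Matrix.one_mul, Matrix.mul_one]

theorem IsSym.conj (hN : IsSym ℓ Ω N) (h : IsMinkowski ℓ Ω) (hQP : Q * P = 1) (hPQ : P * Q = 1) :
    IsSym (fun v => ℓ (P *ᵥ v)) {v | P *ᵥ v ∈ Ω} (Q * N * P) := by
  rw [isSym_conj h hQP hPQ, conj_conj hPQ]
  exact hN

theorem nonempty_comp (hPQ : P * Q = 1) (hne : Ω.Nonempty) : {v : R4 | P *ᵥ v ∈ Ω}.Nonempty := by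
  obtain ⟨v, hv⟩ := hne
  exact ⟨Q *ᵥ v, by simpa [mulVec_cancel hPQ] using hv⟩

theorem IsBlockTraceFree.conj (hN : IsBlockTraceFree ℓ Ω N) (h : IsMinkowski ℓ Ω)
    (hQP : Q * P = 1) (hPQ : P * Q = 1) :
    IsBlockTraceFree (fun v => ℓ (P *ᵥ v)) {v | P *ᵥ v ∈ Ω} (Q * N * P) := by
  obtain ⟨P', Q', h1, h2, hJ, ha, hb⟩ := hN
  have e : (Q' * P) * (Q * N * P) * (Q * P') = Q' * N * P' := by
    calc (Q' * P) * (Q * N * P) * (Q * P') = Q' * (P * Q) * N * (P * Q) * P' := by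
          simp only [Matrix.mul_assoc]
      _ = Q' * N * P' := by rw [hPQ, Matrix.mul_one, Matrix.mul_one]
  refine ⟨Q * P', Q' * P, ?_, ?_, ?_, by rw [e]; exact ha, by rw [e]; exact hb⟩
  · calc Q' * P * (Q * P') = Q' * (P * Q) * P' := by simp only [Matrix.mul_assoc]
      _ = 1 := by rw [hPQ, Matrix.mul_one, h1]
  · calc Q * P' * (Q' * P) = Q * (P' * Q') * P := by simp only [Matrix.mul_assoc]
      _ = 1 := by rw [h2, Matrix.mul_one, hQP]
  · have := hJ.conj h hQP hPQ
    convert this using 1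
    simp only [Matrix.mul_assoc]

theorem HasInvariantForm.of_comp (h : IsMinkowski ℓ Ω) (hQP : Q * P = 1) (hPQ : P * Q = 1)
    (hf : HasInvariantForm (fun v => ℓ (P *ᵥ v)) {v | P *ᵥ v ∈ Ω}) : HasInvariantForm ℓ Ω := by
  obtain ⟨q, hq, hdet, hskew⟩ := hf
  refine ⟨Qᵀ * q * Q, ?_, ?_, fun N hN hgood => ?_⟩
  · rw [Matrix.IsSymm, transpose_mul, transpose_mul, transpose_transpose, hq.eq, Matrix.mul_assoc]
  · have : Q.det * P.det = 1 := by rw [← det_mul, hQP, det_one]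
    rw [det_mul, det_mul, det_transpose]
    exact mul_ne_zero (mul_ne_zero (left_ne_zero_of_mul_eq_one this) hdet)
      (left_ne_zero_of_mul_eq_one this)
  · have := hskew _ (hN.conj h hQP hPQ) (hgood.conj h hQP hPQ)
    have e : Qᵀ * q * Q * N = Qᵀ * (q * (Q * N * P)) * Q := by
      calc Qᵀ * q * Q * N = Qᵀ * q * Q * N * (P * Q) := by rw [hPQ, Matrix.mul_one]
        _ = _ := by simp only [Matrix.mul_assoc]
    rw [e, transpose_mul, transpose_mul, transpose_transpose, ← Matrix.mul_assoc Qᵀ (q * _)ᵀ Q,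
      ← Matrix.add_mul, ← Matrix.mul_add, this, Matrix.mul_zero, Matrix.zero_mul]

end Conj

theorem Jstd_cube : Jstd * Jstd * Jstd = -Jstd := by
  ext i j
  fin_cases i <;> fin_cases j <;> simp [Jstd]

section Pair

variable {ℓ : R4 → ℝ} {Ω : Set R4} {P Q N : Matrix (Fin 4) (Fin 4) ℝ} {p₀ p₁ s₀ s₁ : ℝ}

/-- Commutators of a symmetry with the symmetries of a pair yield another pair, hence a multiple
of the first one. -/
theorem IsPair.exists_eigenvalue (hp : IsPair ℓ Ω p₀ p₁ s₀ s₁) (h : IsMinkowski ℓ Ω)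
    (hne : Ω.Nonempty) (hnq : IsNowhereQuadratic ℓ Ω) (hJ : IsSym ℓ Ω Jstd)
    (hp0 : p₀ ≠ 0 ∨ p₁ ≠ 0) (hN : IsSym ℓ Ω N) :
    ∃ c, N 0 0 * p₀ + N 0 1 * p₁ - p₀ * N 2 2 = c * p₀ ∧
      N 1 0 * p₀ + N 1 1 * p₁ - p₁ * N 2 2 = c * p₁ ∧
      N 2 2 * s₀ - (s₀ * N 0 0 + s₁ * N 1 0) = c * s₀ ∧
      N 2 2 * s₁ - (s₀ * N 0 1 + s₁ * N 1 1) = c * s₁ := by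
  have hq := ((hN.comm h (hp.isSym h hJ 1 0)).isPair h hJ).1
  obtain ⟨c, h0, h1, h2, h3⟩ := hp.proportional h hne hnq hJ hq hp0
  refine ⟨c, ?_, ?_, ?_, ?_⟩
  · rw [← h0]; simp only [Matrix.sub_apply, Matrix.mul_apply, Fin.sum_univ_four]; simp [kmat]
  · rw [← h1]; simp only [Matrix.sub_apply, Matrix.mul_apply, Fin.sum_univ_four]; simp [kmat]
  · rw [← h2]; simp only [Matrix.sub_apply, Matrix.mul_apply, Fin.sum_univ_four]; simp [kmat]
  · rw [← h3]; simp only [Matrix.sub_apply, Matrix.mul_apply, Fin.sum_univ_four]; simp [kmat]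

/-- The annihilator of the plane rotated by `Jstd` together with the vector of a pair is a common
eigencovector of all symmetries. -/
theorem IsPair.exists_vecMul_eq (hp : IsPair ℓ Ω p₀ p₁ s₀ s₁) (h : IsMinkowski ℓ Ω)
    (hne : Ω.Nonempty) (hnq : IsNowhereQuadratic ℓ Ω) (hJ : IsSym ℓ Ω Jstd)
    (hp0 : p₀ ≠ 0 ∨ p₁ ≠ 0) (hN : IsSym ℓ Ω N) :
    ∃ c : ℝ, ![-p₁, p₀, 0, 0] ᵥ* N = c • ![-p₁, p₀, 0, 0] := by
  obtain ⟨c, h0, h1, -, -⟩ := hp.exists_eigenvalue h hne hnq hJ hp0 hN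
  have h2 := hp.det_eq_zero h hne hnq hJ (hN.isPair h hJ).1
  have h3 := hp.det_eq_zero h hne hnq hJ (hN.isPair h hJ).2
  have hev : p₀ * (N 1 0 * p₀ + N 1 1 * p₁) = p₁ * (N 0 0 * p₀ + N 0 1 * p₁) := by
    linear_combination p₀ * h1 - p₁ * h0
  obtain ⟨c', k0, k1⟩ : ∃ c', -p₁ * N 0 0 + p₀ * N 1 0 = c' * -p₁ ∧
      -p₁ * N 0 1 + p₀ * N 1 1 = c' * p₀ := by
    rcases hp0 with hp0 | hp0
    · refine ⟨(-p₁ * N 0 1 + p₀ * N 1 1) / p₀, ?_, by field_simp⟩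
      field_simp
      linear_combination hev
    · refine ⟨(-p₁ * N 0 0 + p₀ * N 1 0) / -p₁, by field_simp, ?_⟩
      field_simp
      linear_combination hev
  refine ⟨c', ?_⟩
  ext j
  fin_cases j <;> simp [Matrix.vecMul, dotProduct, Fin.sum_univ_four]
  · linarith
  · linarith
  · linarith
  · linarith

/-- In the presence of a pair, block trace-free symmetries kill the common eigencovector. -/
theorem IsPair.vecMul_eq_zero (hp : IsPair ℓ Ω p₀ p₁ s₀ s₁) (h : IsMinkowski ℓ Ω)
    (hne : Ω.Nonempty) (hnq : IsNowhereQuadratic ℓ Ω) (hJ : IsSym ℓ Ω Jstd)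
    (hp0 : p₀ ≠ 0 ∨ p₁ ≠ 0) (hN : IsSym ℓ Ω N) (htr : N 0 0 + N 1 1 = 0)
    (hlow : N 2 2 + N 3 3 = 0) : ![-p₁, p₀, 0, 0] ᵥ* N = 0 := by
  obtain ⟨hl1, hl2⟩ := hN.lower_block h hne hJ
  have h22 : N 2 2 = 0 := by linarith
  have h33 : N 3 3 = 0 := by linarith
  have h11 : N 1 1 = -N 0 0 := by linarith
  obtain ⟨μ, h0, h1, h2, h3⟩ := hp.exists_eigenvalue h hne hnq hJ hp0 hN
  rw [h22, h11] at h1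
  rw [h22] at h0 h2
  rw [h22, h11] at h3
  have d2 := hp.det_eq_zero h hne hnq hJ (hN.isPair h hJ).1
  have d3 := hp.det_eq_zero h hne hnq hJ (hN.isPair h hJ).2
  have hμ : μ = 0 := by
    by_contra hμ
    have hsp : s₀ * p₀ + s₁ * p₁ = 0 := by
      have : μ * (s₀ * p₀ + s₁ * p₁) = 0 := by
        linear_combination (-s₀ / 2) * h0 - s₁ / 2 * h1 - p₀ / 2 * h2 - p₁ / 2 * h3
      exact (mul_eq_zero.1 this).resolve_left hμ
    have hn : p₀ ^ 2 + p₁ ^ 2 ≠ 0 := by rcases hp0 with h | h <;> positivity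
    -- the quadratic form invariant under the upper block whose value on `p` is `-s`
    obtain ⟨τ, hτ⟩ : ∃ τ, τ * (μ * (p₀ ^ 2 + p₁ ^ 2)) = -s₀ * p₁ + s₁ * p₀ :=
      ⟨_, div_mul_cancel₀ _ (mul_ne_zero hμ hn)⟩
    have t0 : τ * μ * p₁ = -s₀ := mul_left_cancel₀ hn (by linear_combination p₁ * hτ + p₀ * hsp)
    have t1 : τ * μ * p₀ = s₁ := mul_left_cancel₀ hn (by linear_combination p₀ * hτ - p₁ * hsp)
    refine not_block_quadratic h hne hnq hJ (φ := fun v => p₁ * v 0 - p₀ * v 1) (by fun_prop)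
      (u := ![p₁, -p₀, 0, 0]) (by simp; intro h; apply hn; linear_combination h)
      (τ * N 1 0) (-(τ * N 0 0)) (-(τ * N 0 1)) fun v hv hz hφ => ?_
    have c1 := hp v hv hz
    have c2 := (hN.sub (hN.offDiag h hJ)) v hv
    rw [fderiv_mulVec_radial hJ hv hz] at c2
    simp only [Matrix.sub_apply] at c2
    simp [h22, h33, h11, hl2] at c2
    have hD := mul_ne_zero hμ hφ
    constructor
    · refine mul_left_cancel₀ hD ?_
      linear_combination (N 1 0 * v 0 - N 0 0 * v 1) * c1 - p₁ * c2 -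
        (v 0 * fderiv ℝ ℓ v (e 0)) * h1 + v 1 * fderiv ℝ ℓ v (e 0) * h0 - radial ℓ v *
          (N 1 0 * v 0 - N 0 0 * v 1) * (v 0 * t0 - v 1 * t1)
    · refine mul_left_cancel₀ hD ?_
      linear_combination p₀ * c2 - (N 0 0 * v 0 + N 0 1 * v 1) * c1 -
        (v 0 * fderiv ℝ ℓ v (e 1)) * h1 + v 1 * fderiv ℝ ℓ v (e 1) * h0 + radial ℓ v *
          (N 0 0 * v 0 + N 0 1 * v 1) * (v 0 * t0 - v 1 * t1)
  rw [hμ] at h0 h1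
  ext j
  fin_cases j <;> simp [Matrix.vecMul, dotProduct, Fin.sum_univ_four]
  · linarith
  · rw [h11]; linarith
  · linarith
  · linarith

/-- A symmetry that kills the common eigencovector is antisymmetric for every form extending the
one that `ℓ` induces on the kernel of the eigencovector. -/
theorem IsPair.skew_of_vecMul_eq_zero (hp : IsPair ℓ Ω p₀ p₁ s₀ s₁) (h : IsMinkowski ℓ Ω)
    (hne : Ω.Nonempty) (hJ : IsSym ℓ Ω Jstd) (hp0 : p₀ ≠ 0 ∨ p₁ ≠ 0) (hN : IsSym ℓ Ω N)
    (hσ : ![-p₁, p₀, 0, 0] ᵥ* N = 0) {x y : ℝ} (hx : x * p₀ + y * p₁ = -s₀)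
    (hy : y * p₀ - x * p₁ = -s₁) {q : Matrix (Fin 4) (Fin 4) ℝ}
    (hq : q = !![x, y, 0, 0; y, -x, 0, 0; 0, 0, 1, 0; 0, 0, 0, 1]) :
    q * N + (q * N)ᵀ = 0 := by
  subst hq
  refine add_transpose_eq_zero ?_
  have hn : p₀ ^ 2 + p₁ ^ 2 ≠ 0 := by rcases hp0 with h | h <;> positivity
  refine eq_zero_of_analytic (contDiff_quadratic _) h.isOpen hne
    (eq_zero_of_dense h.isOpen (contDiff_quadratic _).continuous.continuousOn contDiff_zsq zsq_e_two
      fun v hv hz => ?_)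
  have c1 := hp v hv hz
  have c2 := hN v hv
  rw [fderiv_four, (fderiv_eq_radial hJ hv hz).1, (fderiv_eq_radial hJ hv hz).2] at c2
  have c3 : -p₁ * (N *ᵥ v) 0 + p₀ * (N *ᵥ v) 1 = 0 := by
    have : ![-p₁, p₀, 0, 0] ⬝ᵥ (N *ᵥ v) = 0 := by
      rw [dotProduct_mulVec, hσ, zero_dotProduct]
    simpa [dotProduct, Fin.sum_univ_four] using this
  rw [← mulVec_mulVec]
  generalize N *ᵥ v = w at c2 c3 ⊢
  obtain ⟨τ, hτ⟩ : ∃ τ, τ * (p₀ ^ 2 + p₁ ^ 2) = p₀ * w 0 + p₁ * w 1 := ⟨_, div_mul_cancel₀ _ hn⟩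
  have w0 : w 0 = τ * p₀ := mul_left_cancel₀ hn (by linear_combination -p₀ * hτ - p₁ * c3)
  have w1 : w 1 = τ * p₁ := mul_left_cancel₀ hn (by linear_combination -p₁ * hτ + p₀ * c3)
  have hr := radial_ne_zero h hJ hv hz
  refine (mul_eq_zero.1 (?_ : radial ℓ v * _ = 0)).resolve_left hr
  simp only [dotProduct, mulVec_four, Fin.sum_univ_four]
  simp [w0, w1, -mul_eq_zero]
  rw [w0, w1] at c2
  linear_combination c2 - τ * c1 + radial ℓ v * τ * (v 0 * hx + v 1 * hy)

theorem trace_conj (hPQ : P * Q = 1) (N : Matrix (Fin 4) (Fin 4) ℝ) :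
    (Q * N * P).trace = N.trace := by
  rw [Matrix.trace_mul_cycle, hPQ, Matrix.one_mul]

theorem conj_cube (hQP : Q * P = 1) :
    P * Jstd * Q * (P * Jstd * Q) * (P * Jstd * Q) = -(P * Jstd * Q) := by
  calc P * Jstd * Q * (P * Jstd * Q) * (P * Jstd * Q)
      = P * Jstd * (Q * P) * Jstd * (Q * P) * Jstd * Q := by simp only [Matrix.mul_assoc]
    _ = P * (Jstd * Jstd * Jstd) * Q := by rw [hQP]; simp only [Matrix.mul_assoc, Matrix.one_mul]
    _ = -(P * Jstd * Q) := by rw [Jstd_cube]; simp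

theorem trace_Jstd : Jstd.trace = 0 := by simp [Jstd, Matrix.trace, Fin.sum_univ_four]

/-- If there are no pairs in the basis `P`, all symmetries commute with the rotation generator
of that basis. -/
theorem commute_of_no_pair (h : IsMinkowski ℓ Ω) (hne : Ω.Nonempty)
    (hQP : Q * P = 1) (hPQ : P * Q = 1) (hJ : IsSym ℓ Ω (P * Jstd * Q))
    (hnp : ∀ p₀ p₁ s₀ s₁, IsPair (fun v => ℓ (P *ᵥ v)) {v | P *ᵥ v ∈ Ω} p₀ p₁ s₀ s₁ →
      p₀ = 0 ∧ p₁ = 0) (hN : IsSym ℓ Ω N) :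
    adJ (Q * N * P) = 0 ∧ P * Jstd * Q * N = N * (P * Jstd * Q) := by
  have h' := h.comp hQP hPQ
  have hne' := nonempty_comp (P := P) hPQ hne
  have hJ' : IsSym (fun v => ℓ (P *ᵥ v)) {v | P *ᵥ v ∈ Ω} Jstd := (isSym_conj h hQP hPQ _).2 hJ
  have hN' := hN.conj h hQP hPQ
  have e : adJ (Q * N * P) = 0 := by
    obtain ⟨a2, a3⟩ := hN'.isPair h' hJ'
    have b := hN'.lower_block h' hne' hJ'
    generalize Q * N * P = N' at a2 a3 b
    have z2 := hnp _ _ _ _ a2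
    have z3 := hnp _ _ _ _ a3
    rw [z2.1, z2.2] at a2
    rw [z3.1, z3.2] at a3
    have y2 := a2.covector_eq_zero h' hne' hJ'
    have y3 := a3.covector_eq_zero h' hne' hJ'
    rw [adJ_eq]
    ext i j
    fin_cases i <;> fin_cases j <;> simp [z2, z3, y2, y3, b]
  refine ⟨e, ?_⟩
  have e2 : Jstd * (Q * N * P) = Q * N * P * Jstd := sub_eq_zero.1 e
  calc P * Jstd * Q * N = P * (Jstd * (Q * N * P)) * Q := by
        rw [show P * (Jstd * (Q * N * P)) * Q = P * Jstd * Q * N * (P * Q) by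
          simp only [Matrix.mul_assoc], hPQ, Matrix.mul_one]
    _ = (P * Q) * N * (P * Jstd * Q) := by rw [e2]; simp only [Matrix.mul_assoc]
    _ = _ := by rw [hPQ, Matrix.one_mul]

/-- If there is a nonzero pair in one rotation basis, there is one in every rotation basis: otherwise
the rotation generator `K` of the second basis commutes with `Jstd` and with the symmetries of the
pair, so that `K ^ 2 = 0`, which contradicts `K ^ 3 = -K ≠ 0`. -/
theorem IsPair.exists_pair_conj (hp : IsPair ℓ Ω p₀ p₁ s₀ s₁) (h : IsMinkowski ℓ Ω)
    (hne : Ω.Nonempty) (hJ : IsSym ℓ Ω Jstd)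
    (hp0 : p₀ ≠ 0 ∨ p₁ ≠ 0) (hQP : Q * P = 1) (hPQ : P * Q = 1)
    (hJP : IsSym ℓ Ω (P * Jstd * Q)) :
    ∃ p₀ p₁ s₀ s₁, IsPair (fun v => ℓ (P *ᵥ v)) {v | P *ᵥ v ∈ Ω} p₀ p₁ s₀ s₁ ∧
      (p₀ ≠ 0 ∨ p₁ ≠ 0) := by
  by_contra! hnp
  have hcomm : ∀ N, IsSym ℓ Ω N → P * Jstd * Q * N = N * (P * Jstd * Q) := fun N hN =>
    (commute_of_no_pair h hne hQP hPQ hJP hnp hN).2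
  have hcube := conj_cube (P := P) hQP
  have htr : (P * Jstd * Q).trace = 0 := by rw [trace_conj hQP, trace_Jstd]
  have hJ1 : P * Jstd * Q ≠ 0 := by
    intro h0
    have : Jstd = 0 := by rw [← conj_conj hQP Jstd, h0, Matrix.mul_zero, Matrix.zero_mul]
    have := congrFun (congrFun this 3) 2
    simp [Jstd] at this
  generalize P * Jstd * Q = K at *
  have hadj : adJ K = 0 := by
    have := hcomm _ hJ
    rw [adJ, ← this, sub_self]
  obtain ⟨h02, h03, h12, h13, h20, h21, h30, h31, h33, h23⟩ := adJ_eq_zero hadj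
  have hk := hcomm _ (hp.isSym h hJ 1 0)
  have f := fun i j => congrFun (congrFun hk i) j
  have f02 := f 0 2
  have f12 := f 1 2
  have f03 := f 0 3
  have f13 := f 1 3
  simp only [Matrix.mul_apply, Fin.sum_univ_four] at f02 f12 f03 f13
  simp [kmat, h02, h12, h03, h13, h23] at f02 f12 f03 f13
  have k32 : K 3 2 = 0 := by tauto
  have cu := fun i j => congrFun (congrFun hcube i) j
  have k22 : K 2 2 = 0 := by
    have := cu 2 2
    simp only [Matrix.mul_apply, Fin.sum_univ_four, Matrix.neg_apply] at this
    simp [h02, h12, h03, h13, h20, h21, h30, h31, h33, h23, k32] at this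
    have h4 : K 2 2 * (K 2 2 ^ 2 + 1) = 0 := by linear_combination this
    exact (mul_eq_zero.1 h4).resolve_right (by positivity)
  rw [k32] at h23
  rw [k22] at h33
  rw [k22] at f02 f12
  have k11 : K 1 1 = -K 0 0 := by
    rw [Matrix.trace, Fin.sum_univ_four] at htr
    simp only [diag_apply, k22, h33] at htr
    linarith
  rw [k11] at f12
  have hdet : K 0 0 ^ 2 + K 0 1 * K 1 0 = 0 := by
    rcases hp0 with hp0 | hp0
    · refine (mul_eq_zero.1 (?_ : p₀ * _ = 0)).resolve_left hp0
      linear_combination K 0 0 * f02 + K 0 1 * f12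
    · refine (mul_eq_zero.1 (?_ : p₁ * _ = 0)).resolve_left hp0
      linear_combination K 1 0 * f02 - K 0 0 * f12
  have hsq : K * K = 0 := by
    ext i j
    simp only [Matrix.mul_apply, Fin.sum_univ_four, Matrix.zero_apply]
    fin_cases i <;> fin_cases j <;>
      simp [h02, h12, h03, h13, h20, h21, h30, h31, h33, h23, k32, k22, k11, -mul_eq_zero] <;>
      first | linear_combination hdet | linear_combination -hdet | ring
  rw [hsq, Matrix.zero_mul] at hcube
  exact hJ1 (neg_eq_zero.1 hcube.symm)

/-- In the presence of a pair, the invariant form is the one induced by `ℓ` on the kernel of the common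
eigencovector, extended to a nondegenerate form. -/
theorem IsPair.hasInvariantForm (hp : IsPair ℓ Ω p₀ p₁ s₀ s₁) (h : IsMinkowski ℓ Ω)
    (hne : Ω.Nonempty) (hnq : IsNowhereQuadratic ℓ Ω) (hJ : IsSym ℓ Ω Jstd)
    (hp0 : p₀ ≠ 0 ∨ p₁ ≠ 0) : HasInvariantForm ℓ Ω := by
  have hn : p₀ ^ 2 + p₁ ^ 2 ≠ 0 := by rcases hp0 with h | h <;> positivity
  obtain ⟨x, hx⟩ : ∃ x, x * (p₀ ^ 2 + p₁ ^ 2) = -s₀ * p₀ + s₁ * p₁ := ⟨_, div_mul_cancel₀ _ hn⟩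
  obtain ⟨y, hy⟩ : ∃ y, y * (p₀ ^ 2 + p₁ ^ 2) = -s₀ * p₁ - s₁ * p₀ := ⟨_, div_mul_cancel₀ _ hn⟩
  have x1 : x * p₀ + y * p₁ = -s₀ := mul_left_cancel₀ hn (by linear_combination p₀ * hx + p₁ * hy)
  have y1 : y * p₀ - x * p₁ = -s₁ := mul_left_cancel₀ hn (by linear_combination p₀ * hy - p₁ * hx)
  refine ⟨_, ?_, ?_, fun N hN hgood => hp.skew_of_vecMul_eq_zero h hne hJ hp0 hN ?_ x1 y1 rfl⟩
  · ext i j; fin_cases i <;> fin_cases j <;> rfl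
  · have hxy : x ^ 2 + y ^ 2 ≠ 0 := by
      intro h0
      have hx0 : x = 0 := by nlinarith [sq_nonneg x, sq_nonneg y]
      have hy0 : y = 0 := by nlinarith [sq_nonneg x, sq_nonneg y]
      have := hp.covector_ne_zero h hne hp0
      rw [hx0, hy0] at x1 y1
      rcases this with h | h <;> apply h <;> linarith
    have hd : Matrix.det !![x, y, 0, 0; y, -x, 0, 0; 0, 0, 1, 0; 0, 0, 0, (1 : ℝ)] =
        -(x ^ 2 + y ^ 2) := by
      simp [Matrix.det_succ_row_zero, Fin.sum_univ_succ, Fin.succAbove]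
      ring
    rw [hd]
    exact neg_ne_zero.2 hxy
  · obtain ⟨P, Q, hQP, hPQ, hJP, htr, hlow⟩ := hgood
    obtain ⟨π₀, π₁, t₀, t₁, hπ, hπ0⟩ := hp.exists_pair_conj h hne hJ hp0 hQP hPQ hJP
    have h' := h.comp hQP hPQ
    have hne' := nonempty_comp (P := P) hPQ hne
    have hnq' := hnq.comp hQP hPQ
    have hJ' : IsSym (fun v => ℓ (P *ᵥ v)) {v | P *ᵥ v ∈ Ω} Jstd := (isSym_conj h hQP hPQ _).2 hJP
    have hkill := hπ.vecMul_eq_zero h' hne' hnq' hJ' hπ0 (hN.conj h hQP hPQ) htr hlow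
    -- the transformed eigencovector is a multiple of the eigencovector of the new basis
    obtain ⟨σ, hσ⟩ : ∃ σ : R4, σ = ![-p₁, p₀, 0, 0] ᵥ* P := ⟨_, rfl⟩
    have hev : ∀ K, IsSym (fun v => ℓ (P *ᵥ v)) {v | P *ᵥ v ∈ Ω} K → ∃ c : ℝ, σ ᵥ* K = c • σ := by
      intro K hK
      obtain ⟨c, hc⟩ := hp.exists_vecMul_eq h hne hnq hJ hp0 ((isSym_conj h hQP hPQ K).1 hK)
      refine ⟨c, ?_⟩
      rw [hσ, ← smul_vecMul, ← hc, vecMul_vecMul, vecMul_vecMul, Matrix.mul_assoc (P * K), hQP,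
        Matrix.mul_one]
    obtain ⟨c, hc⟩ := hev _ hJ'
    have c2 := congrFun hc 2
    have c3 := congrFun hc 3
    simp [Matrix.vecMul, dotProduct, Fin.sum_univ_four, Jstd] at c2 c3
    have hσ2 : σ 2 = 0 := by
      have : σ 2 * (1 + c ^ 2) = 0 := by linear_combination -c3 - c * c2
      exact (mul_eq_zero.1 this).resolve_right (by positivity)
    have hσ3 : σ 3 = 0 := by rw [c2, hσ2, mul_zero]
    obtain ⟨d, hd⟩ := hev _ (hπ.isSym h' hJ' 1 0)
    have d2 := congrFun hd 2
    simp [Matrix.vecMul, dotProduct, Fin.sum_univ_four, kmat, hσ2, hσ3] at d2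
    have hm : π₀ ^ 2 + π₁ ^ 2 ≠ 0 := by rcases hπ0 with h | h <;> positivity
    obtain ⟨κ, hκ⟩ : ∃ κ, κ * (π₀ ^ 2 + π₁ ^ 2) = -σ 0 * π₁ + σ 1 * π₀ :=
      ⟨_, div_mul_cancel₀ _ hm⟩
    have hσκ : σ = κ • ![-π₁, π₀, 0, 0] := by
      ext j
      fin_cases j <;> simp
      · exact mul_left_cancel₀ hm (by linear_combination π₁ * hκ + π₀ * d2)
      · exact mul_left_cancel₀ hm (by linear_combination -π₀ * hκ + π₁ * d2)
      · exact hσ2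
      · exact hσ3
    have hfin : σ ᵥ* (Q * N * P) = 0 := by rw [hσκ, smul_vecMul, hkill, smul_zero]
    have e1 : (![-p₁, p₀, 0, 0] ᵥ* N) = σ ᵥ* (Q * N * P) ᵥ* Q := by
      rw [hσ, vecMul_vecMul, vecMul_vecMul, ← Matrix.mul_assoc, conj_conj hPQ]
    rw [e1, hfin, zero_vecMul]

end Pair

end

section

open Matrix

/-! ### Invariant forms in the absence of pairs -/

section NoPair

variable {ℓ : R4 → ℝ} {Ω : Set R4} {P Q N N₀ : Matrix (Fin 4) (Fin 4) ℝ}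

theorem IsMinkowski.eq_zero_of_kills_zsq (h : IsMinkowski ℓ Ω) (hne : Ω.Nonempty) {φ : R4 → ℝ}
    (hφ : ContDiff ℝ ω φ) {w : R4} (hw : φ w ≠ 0) {k : R4}
    (hk : ∀ v ∈ Ω, zsq v ≠ 0 → φ v ≠ 0 → fderiv ℝ ℓ v k = 0) : k = 0 := by
  obtain ⟨u, hu⟩ := exists_zsq_mul_ne_zero hφ hw
  exact h.eq_zero_of_kills_dense hne (contDiff_zsq.mul hφ) hu fun v hv hφv =>
    hk v hv (left_ne_zero_of_mul hφv) (right_ne_zero_of_mul hφv)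

theorem trace_block {N : Matrix (Fin 4) (Fin 4) ℝ} :
    N.trace = N 0 0 + N 1 1 + N 2 2 + N 3 3 := by
  simp [Matrix.trace, Fin.sum_univ_four]

/-- The solutions `β + iγ` of `z ^ 3 = -z` are purely imaginary. -/
theorem re_eq_zero_of_cube {β γ : ℝ} (h1 : β ^ 3 - 3 * β * γ ^ 2 = -β)
    (h2 : 3 * β ^ 2 * γ - γ ^ 3 = -γ) : β = 0 := by
  by_contra hβ
  have e1 : β ^ 2 - 3 * γ ^ 2 + 1 = 0 :=
    (mul_eq_zero.1 (by linear_combination h1 : β * _ = 0)).resolve_left hβ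
  by_cases hγ : γ = 0
  · rw [hγ] at e1
    nlinarith [sq_nonneg β]
  · have e2 : 3 * β ^ 2 - γ ^ 2 + 1 = 0 :=
      (mul_eq_zero.1 (by linear_combination h2 : γ * _ = 0)).resolve_left hγ
    nlinarith [sq_nonneg β, sq_nonneg γ]

/-- Without pairs, a symmetry that is trace-free on both blocks of some rotation basis is
trace-free on both blocks of the standard basis: this is read off from the traces of `N` and
`N K ^ 2`, where `K` is the rotation generator of the other basis. -/
theorem blocks_trace_free_of_conj (hN : adJ N = 0) (hQP : Q * P = 1) (hPQ : P * Q = 1)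
    (hK : adJ (P * Jstd * Q) = 0)
    (htr : (Q * N * P) 0 0 + (Q * N * P) 1 1 = 0)
    (hlow : (Q * N * P) 2 2 + (Q * N * P) 3 3 = 0) :
    N 0 0 + N 1 1 = 0 ∧ N 2 2 = 0 ∧ N 3 3 = 0 := by
  have t1 : N.trace = 0 := by
    rw [← trace_conj hPQ N, trace_block]; linarith
  have t2 : (N * (P * Jstd * Q * (P * Jstd * Q))).trace = 0 := by
    have e : Q * (N * (P * Jstd * Q * (P * Jstd * Q))) * P = Q * N * P * (Jstd * Jstd) := by
      calc Q * (N * (P * Jstd * Q * (P * Jstd * Q))) * P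
          = Q * N * P * Jstd * (Q * P) * Jstd * (Q * P) := by simp only [Matrix.mul_assoc]
        _ = _ := by rw [hQP]; simp only [Matrix.mul_assoc, Matrix.mul_one]
    rw [← trace_conj hPQ, e, trace_block]
    generalize Q * N * P = N' at *
    simp only [Matrix.mul_apply, Fin.sum_univ_four]
    simp [Jstd]
    linarith
  have t3 : (P * Jstd * Q * (P * Jstd * Q)).trace = -2 := by
    have e : Q * (P * Jstd * Q * (P * Jstd * Q)) * P = Jstd * Jstd := by
      calc Q * (P * Jstd * Q * (P * Jstd * Q)) * P
          = (Q * P) * Jstd * (Q * P) * Jstd * (Q * P) := by simp only [Matrix.mul_assoc]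
        _ = _ := by rw [hQP]; simp only [Matrix.one_mul, Matrix.mul_one]
    rw [← trace_conj hPQ, e, trace_block]
    simp only [Matrix.mul_apply, Fin.sum_univ_four]
    simp [Jstd]
    norm_num
  have hcube := conj_cube (P := P) hQP
  have t4 : (P * Jstd * Q).trace = 0 := by rw [trace_conj hQP, trace_Jstd]
  generalize P * Jstd * Q = K at *
  obtain ⟨h02, h03, h12, h13, h20, h21, h30, h31, h33, h23⟩ := adJ_eq_zero hN
  obtain ⟨k02, k03, k12, k13, k20, k21, k30, k31, k33, k23⟩ := adJ_eq_zero hK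
  rw [trace_block] at t1 t2 t3 t4
  have cu := fun i j => congrFun (congrFun hcube i) j
  have c22 := cu 2 2
  have c32 := cu 3 2
  simp only [Matrix.mul_apply, Fin.sum_univ_four, Matrix.neg_apply] at c22 c32 t2 t3
  simp only [h02, h03, h12, h13, h20, h21, h30, h31, h33, h23, k02, k03, k12, k13, k20, k21, k30,
    k31, k33, k23] at c22 c32 t1 t2 t3 t4
  rw [h33]
  have hβ : K 2 2 = 0 := by
    refine re_eq_zero_of_cube (γ := K 3 2) ?_ ?_
    · linear_combination c22
    · linear_combination c32
  rw [hβ] at c32 t2 t3 t4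
  have k11 : K 1 1 = -K 0 0 := by linarith
  rw [k11] at t2 t3
  have hγ : K 3 2 * (K 3 2 ^ 2 - 1) = 0 := by linear_combination -c32
  have h22 : N 2 2 = 0 := by
    -- `K ^ 2` is minus the identity on one of the two blocks and vanishes on the other
    rcases mul_eq_zero.1 hγ with hγ | hγ
    · rw [hγ] at t2 t3
      have hδ : K 0 0 ^ 2 + K 0 1 * K 1 0 = -1 := by linarith
      linear_combination (1 / 2) * t2 + (1 / 2) * t1 - (N 0 0 + N 1 1) / 2 * hδ
    · have hδ : K 0 0 ^ 2 + K 0 1 * K 1 0 = 0 := by linarith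
      linear_combination (-1 / 2) * t2 + (N 0 0 + N 1 1) / 2 * hδ - N 2 2 * hγ
  exact ⟨by linarith, h22, h22⟩

/-- Without pairs, all trace-free upper blocks of block trace-free symmetries are multiples of a single
one, `F`, and the invariant form is built from the area form contracted with `F`. -/
theorem hasInvariantForm_of_no_pair (h : IsMinkowski ℓ Ω) (hne : Ω.Nonempty)
    (hJ : IsSym ℓ Ω Jstd) (hcomm : ∀ N, IsSym ℓ Ω N → adJ N = 0)
    (hgood : ∀ N, IsSym ℓ Ω N → IsBlockTraceFree ℓ Ω N →
      N 0 0 + N 1 1 = 0 ∧ N 2 2 = 0 ∧ N 3 3 = 0) : HasInvariantForm ℓ Ω := by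
  have hfd : ∀ N, IsSym ℓ Ω N → N 0 0 + N 1 1 = 0 → N 2 2 = 0 → ∀ v ∈ Ω, zsq v ≠ 0 →
      (N 0 0 * v 0 + N 0 1 * v 1) * fderiv ℝ ℓ v (e 0) +
      (N 1 0 * v 0 - N 0 0 * v 1) * fderiv ℝ ℓ v (e 1) = 0 := by
    intro N hN htr h22 v hv hz
    obtain ⟨h02, h03, h12, h13, h20, h21, h30, h31, h33, h23⟩ := adJ_eq_zero (hcomm N hN)
    have := hN v hv
    rw [fderiv_mulVec_radial hJ hv hz] at this
    simp only [h02, h03, h12, h13, h20, h21, h30, h31, h33, h23, h22] at this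
    linear_combination this - v 1 * fderiv ℝ ℓ v (e 1) * htr
  by_cases hex : ∃ N₀, IsSym ℓ Ω N₀ ∧ N₀ 0 0 + N₀ 1 1 = 0 ∧ N₀ 2 2 = 0 ∧
      (N₀ 0 0 ≠ 0 ∨ N₀ 0 1 ≠ 0 ∨ N₀ 1 0 ≠ 0)
  · obtain ⟨N₀, hN₀, htr₀, h22₀, hnz⟩ := hex
    have hf₀ := hfd N₀ hN₀ htr₀ h22₀
    have hdet : N₀ 0 0 ^ 2 + N₀ 0 1 * N₀ 1 0 ≠ 0 := by
      intro hd
      by_cases hC : N₀ 1 0 = 0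
      · have hA : N₀ 0 0 = 0 := by rw [hC] at hd; simpa using hd
        have hB : N₀ 0 1 ≠ 0 := by tauto
        have := h.eq_zero_of_kills_zsq hne (φ := fun v => v 1) (by fun_prop)
          (w := e 1) (by simp [e]) (k := e 0) fun v hv hz h1 => by
            have := hf₀ v hv hz
            rw [hA, hC] at this
            refine (mul_eq_zero.1 (?_ : N₀ 0 1 * v 1 * _ = 0)).resolve_left (mul_ne_zero hB h1)
            linear_combination this
        have := congrFun this 0
        simp [e] at this
      · have := h.eq_zero_of_kills_zsq hne
          (φ := fun v => N₀ 1 0 * v 0 - N₀ 0 0 * v 1) (by fun_prop)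
          (w := e 0) (by simp [e, hC])
          (k := ![N₀ 0 0, N₀ 1 0, 0, 0]) fun v hv hz h1 => by
            have := hf₀ v hv hz
            rw [fderiv_four]
            refine (mul_eq_zero.1 (?_ : (N₀ 1 0 * v 0 - N₀ 0 0 * v 1) * _ = 0)).resolve_left h1
            simp [-mul_eq_zero]
            linear_combination N₀ 1 0 * this - v 1 * fderiv ℝ ℓ v (e 0) * hd
        have := congrFun this 1
        simp at this
        exact hC this
    refine ⟨!![N₀ 1 0, -N₀ 0 0, 0, 0; -N₀ 0 0, -N₀ 0 1, 0, 0; 0, 0, 1, 0; 0, 0, 0, 1], ?_, ?_,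
      fun N hN hNg => ?_⟩
    · ext i j; fin_cases i <;> fin_cases j <;> rfl
    · have hd : Matrix.det !![N₀ 1 0, -N₀ 0 0, 0, 0; -N₀ 0 0, -N₀ 0 1, 0, 0; 0, 0, 1, 0;
          0, 0, 0, 1] = -(N₀ 0 0 ^ 2 + N₀ 0 1 * N₀ 1 0) := by
        simp [Matrix.det_succ_row_zero, Fin.sum_univ_succ, Fin.succAbove]
        ring
      rw [hd]
      exact neg_ne_zero.2 hdet
    · obtain ⟨htr, h22, h33⟩ := hgood N hN hNg
      have hf := hfd N hN htr h22
      -- the two upper blocks applied to a vector are parallel, as `dℓ` kills both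
      have hpar : ∀ v : R4, (N₀ 0 0 * v 0 + N₀ 0 1 * v 1) * (N 1 0 * v 0 - N 0 0 * v 1) -
          (N₀ 1 0 * v 0 - N₀ 0 0 * v 1) * (N 0 0 * v 0 + N 0 1 * v 1) = 0 := by
        by_contra! hw
        obtain ⟨w, hw⟩ := hw
        have := h.eq_zero_of_kills_zsq hne
          (φ := fun v => (N₀ 0 0 * v 0 + N₀ 0 1 * v 1) * (N 1 0 * v 0 - N 0 0 * v 1) -
          (N₀ 1 0 * v 0 - N₀ 0 0 * v 1) * (N 0 0 * v 0 + N 0 1 * v 1)) (by fun_prop) hw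
          (k := e 0) fun v hv hz h1 => by
            refine (mul_eq_zero.1 (?_ : ((N₀ 0 0 * v 0 + N₀ 0 1 * v 1) * (N 1 0 * v 0 - N 0 0 * v 1) -
              (N₀ 1 0 * v 0 - N₀ 0 0 * v 1) * (N 0 0 * v 0 + N 0 1 * v 1)) * _ = 0)).resolve_left h1
            linear_combination (N 1 0 * v 0 - N 0 0 * v 1) * hf₀ v hv hz -
              (N₀ 1 0 * v 0 - N₀ 0 0 * v 1) * hf v hv hz
        have := congrFun this 0
        simp [e] at this
      obtain ⟨h02, h03, h12, h13, h20, h21, h30, h31, -, h23⟩ := adJ_eq_zero (hcomm N hN)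
      refine add_transpose_eq_zero fun v => ?_
      rw [← mulVec_mulVec]
      simp only [dotProduct, mulVec_four, Fin.sum_univ_four]
      simp [h02, h03, h12, h13, h20, h21, h30, h31, h33, h23, h22, -mul_eq_zero]
      linear_combination -hpar v - v 1 * (N₀ 0 0 * v 0 + N₀ 0 1 * v 1) * htr
  · refine ⟨1, isSymm_one, by simp, fun N hN hNg => ?_⟩
    obtain ⟨htr, h22, h33⟩ := hgood N hN hNg
    have hz : N 0 0 = 0 ∧ N 0 1 = 0 ∧ N 1 0 = 0 := by
      by_contra hc
      exact hex ⟨N, hN, htr, h22, by tauto⟩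
    obtain ⟨h00, h01, h10⟩ := hz
    rw [h00, zero_add] at htr
    obtain ⟨h02, h03, h12, h13, h20, h21, h30, h31, -, h23⟩ := adJ_eq_zero (hcomm N hN)
    rw [Matrix.one_mul]
    ext i j
    fin_cases i <;> fin_cases j <;>
      simp [h02, h03, h12, h13, h20, h21, h30, h31, h33, h23, h22, h00, h01, h10, htr]

/-- If a conjugate of the rotation generator is a symmetry of the nowhere quadratic function `ℓ`,
then its block trace-free symmetries are antisymmetric for a common nondegenerate
symmetric bilinear form. -/
theorem hasInvariantForm (h : IsMinkowski ℓ Ω) (hne : Ω.Nonempty)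
    (hnq : IsNowhereQuadratic ℓ Ω) (hQP : Q * P = 1) (hPQ : P * Q = 1)
    (hJ : IsSym ℓ Ω (P * Jstd * Q)) : HasInvariantForm ℓ Ω := by
  by_cases hex : ∃ P Q : Matrix (Fin 4) (Fin 4) ℝ, Q * P = 1 ∧ P * Q = 1 ∧
      IsSym ℓ Ω (P * Jstd * Q) ∧
      ∃ p₀ p₁ s₀ s₁, IsPair (fun v => ℓ (P *ᵥ v)) {v | P *ᵥ v ∈ Ω} p₀ p₁ s₀ s₁ ∧
        (p₀ ≠ 0 ∨ p₁ ≠ 0)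
  · obtain ⟨P, Q, hQP, hPQ, hJ, p₀, p₁, s₀, s₁, hp, hp0⟩ := hex
    exact .of_comp h hQP hPQ (hp.hasInvariantForm (h.comp hQP hPQ) (nonempty_comp hPQ hne)
      (hnq.comp hQP hPQ) ((isSym_conj h hQP hPQ _).2 hJ) hp0)
  · push Not at hex
    have hcomm : ∀ P Q : Matrix (Fin 4) (Fin 4) ℝ, Q * P = 1 → P * Q = 1 →
        IsSym ℓ Ω (P * Jstd * Q) → ∀ N, IsSym ℓ Ω N → adJ (Q * N * P) = 0 :=
      fun P Q hQP hPQ hJ N hN => (commute_of_no_pair h hne hQP hPQ hJ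
        (fun p₀ p₁ s₀ s₁ hp => by
          by_contra hc
          by_cases h0 : p₀ = 0
          · exact hc ⟨h0, (hex P Q hQP hPQ hJ p₀ p₁ s₀ s₁ hp).2⟩
          · exact h0 (hex P Q hQP hPQ hJ p₀ p₁ s₀ s₁ hp).1) hN).1
    refine .of_comp h hQP hPQ (hasInvariantForm_of_no_pair (h.comp hQP hPQ)
      (nonempty_comp hPQ hne) ((isSym_conj h hQP hPQ _).2 hJ) (fun N hN => ?_)
      fun N hN hNg => ?_)
    · have := hcomm P Q hQP hPQ hJ _ ((isSym_conj h hQP hPQ _).1 hN)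
      rwa [conj_conj hQP] at this
    · have hcomm' : ∀ N, IsSym (fun v => ℓ (P *ᵥ v)) {v | P *ᵥ v ∈ Ω} N → adJ N = 0 := by
        intro N hN
        have := hcomm P Q hQP hPQ hJ _ ((isSym_conj h hQP hPQ _).1 hN)
        rwa [conj_conj hQP] at this
      obtain ⟨P', Q', h1, h2, hJ', ha, hb⟩ := hNg
      exact blocks_trace_free_of_conj (hcomm' N hN) h1 h2 (hcomm' _ hJ') ha hb

end NoPair

end

section

open Matrix

/-! ### The curvature as a family of matrices, and rotations of space -/

/-- The matrix of an endomorphism of `ℝ⁴`. -/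
def toMat (f : R4 →L[ℝ] R4) : Matrix (Fin 4) (Fin 4) ℝ := LinearMap.toMatrix' f.toLinearMap

theorem toMat_mulVec (f : R4 →L[ℝ] R4) (v : R4) : toMat f *ᵥ v = f v :=
  LinearMap.toMatrix'_mulVec f.toLinearMap v

theorem toMat_apply (f : R4 →L[ℝ] R4) (i j : Fin 4) : toMat f i j = f (e j) i :=
  LinearMap.toMatrix'_apply f.toLinearMap i j

theorem toMat_neg (f : R4 →L[ℝ] R4) : toMat (-f) = -toMat f := by
  ext i j; simp [toMat_apply]

/-- Two matrices with the same action on vectors are equal. -/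
theorem ext_mulVec {N N' : Matrix (Fin 4) (Fin 4) ℝ} (h : ∀ v : R4, N *ᵥ v = N' *ᵥ v) : N = N' := by
  ext i j
  have := congrFun (h (e j)) i
  simpa [e, mulVec_single_one] using this

section CurvatureTensor

variable {M : Set R4} {A : Set TR4} {L : TR4 → ℝ} {Γ : ConnCoeff}

theorem curv_map_sum (B : R4 → R4 →L[ℝ] R4 →L[ℝ] R4) (x : R4) (g : R4 →ₗ[ℝ] R4) (a b : R4) :
    curv B x (g a) (g b) = ∑ i, ∑ j, (a i * b j) • curv B x (g (e i)) (g (e j)) := by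
  let f : R4 →ₗ[ℝ] R4 →ₗ[ℝ] R4 →L[ℝ] R4 := (LinearMap.mk₂ ℝ (curv B x)
    (curv_add_left B x) (fun r a b => curv_smul_left B x a b r)
    (curv_add_right B x) (fun r a b => curv_smul_right B x a b r)).compl₁₂ g g
  have h1 : f a = ∑ i, a i • f (e i) := map_eq_sum_e f a
  have h2 : ∀ i, f (e i) b = ∑ j, b j • f (e i) (e j) := fun i => map_eq_sum_e (f (e i)) b
  change f a b = _
  rw [h1]
  simp only [LinearMap.sum_apply, LinearMap.smul_apply, h2, Finset.smul_sum, smul_smul]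
  rfl

theorem curv_sum (B : R4 → R4 →L[ℝ] R4 →L[ℝ] R4) (x a b : R4) :
    curv B x a b = ∑ i, ∑ j, (a i * b j) • curv B x (e i) (e j) :=
  curv_map_sum B x LinearMap.id a b

theorem curv_apply_mem_verticalHolonomy (hM : IsOpen M) (hL : IsPseudoFinsler M A L)
    (hB : IsCanonicalConnection M A L Γ) {x v : R4} (hp : (x, v) ∈ A) (a b : R4) :
    ((0 : R4), curv (connForm Γ) x a b v) ∈ verticalHolonomy L (x, v) := by
  have hBp : DifferentiableAt ℝ (connForm Γ) x :=
    ((contDiffOn_connForm (hB.contDiffOn hL)).contDiffAt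
      (hM.mem_nhds (hL.fst_mem hp))).differentiableAt (by simp)
  refine ⟨?_, by simp⟩
  have key : ∀ i j, ((0 : R4), curv (connForm Γ) x (e i) (e j) v) ∈
      holonomyDistribution L (x, v) := by
    intro i j
    have hmem : VectorField.lieBracket ℝ (horiz L i) (horiz L j) (x, v) ∈
        holonomyDistribution L (x, v) :=
      Submodule.subset_span ⟨_, .bracket i _ (.base j), rfl⟩
    have ev : ∀ k, horiz L k =ᶠ[𝓝 (x, v)] horizField (connForm Γ) (e k) := fun k => by
      filter_upwards [hL.conic.isOpen.mem_nhds hp] with q hq using horiz_eq hM hL hB hq k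
    rw [(ev i).lieBracket_vectorField_eq (ev j), lieBracket_horiz_horiz hBp] at hmem
    have := Submodule.neg_mem _ hmem
    simpa using this
  have e1 : ((0 : R4), curv (connForm Γ) x a b v) =
      ∑ i, ∑ j, (a i * b j) • ((0 : R4), curv (connForm Γ) x (e i) (e j) v) := by
    rw [curv_sum, ← LinearMap.inr_apply (R := ℝ) (M := R4)]
    simp only [_root_.sum_apply, _root_.smul_apply, map_sum, map_smul, LinearMap.inr_apply]
  rw [e1]
  exact Submodule.sum_mem _ fun i _ => Submodule.sum_mem _ fun j _ =>
    Submodule.smul_mem _ _ (key i j)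

theorem isSym_curv (hM : IsOpen M) (hL : IsPseudoFinsler M A L)
    (hB : IsCanonicalConnection M A L Γ) (x a b : R4) :
    IsSym (fun v => L (x, v)) {v | (x, v) ∈ A} (toMat (curv (connForm Γ) x a b)) := by
  intro v hv
  rw [toMat_mulVec, hL.fderiv_fibre hv]
  have h1 : ∀ p ∈ A, p.1 ∈ M := fun p hp => hL.fst_mem hp
  have h2 : ∀ p ∈ A, ∀ a, fderiv ℝ L p (horizField (connForm Γ) a p) = 0 :=
    fun p hp a => fderiv_horizField_eq_zero hM hL hB hp a
  have hv' : ((x, v) : TR4) ∈ A := hv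
  have h3 := fderiv_curv_eq_zero hM hL.conic.isOpen h1 (contDiffOn_connForm (hB.contDiffOn hL))
    hL.smooth h2 hv' a b
  convert h3

theorem fderiv_connForm_eq_pd {x : R4} (hBx : DifferentiableAt ℝ (connForm Γ) x) (c a b i : Fin 4) :
    fderiv ℝ (connForm Γ) x (e c) (e b) (e i) a = pd c (fun y => Γ y a b i) x := by
  have h1 := ((hBx.hasFDerivAt.clm_apply (hasFDerivAt_const (e b) x)).clm_apply
    (hasFDerivAt_const (e i) x))
  have h2 := (ContinuousLinearMap.proj (R := ℝ) (φ := fun _ : Fin 4 => ℝ) a).hasFDerivAt.comp x h1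
  have h3 : (fun y => Γ y a b i) = (ContinuousLinearMap.proj (R := ℝ) (φ := fun _ : Fin 4 => ℝ) a) ∘
      fun y => connForm Γ y (e b) (e i) := by
    ext y; simp [connForm_e_e]
  rw [pd, h3, h2.fderiv]
  simp

theorem affineCurv_eq {x : R4} (hBx : DifferentiableAt ℝ (connForm Γ) x) (i a b c : Fin 4) :
    affineCurv Γ x i a b c = curv (connForm Γ) x (e c) (e b) (e i) a := by
  rw [curv_apply]
  simp only [Pi.add_apply, Pi.sub_apply, fderiv_connForm_eq_pd hBx, affineCurv]
  have h : ∀ c b, connForm Γ x (e c) (connForm Γ x (e b) (e i)) a = ∑ d, Γ x a c d * Γ x d b i := by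
    intro c b
    have := map_eq_sum_e (connForm Γ x (e c)).toLinearMap (connForm Γ x (e b) (e i))
    rw [show connForm Γ x (e c) (connForm Γ x (e b) (e i)) =
      ∑ d, connForm Γ x (e b) (e i) d • connForm Γ x (e c) (e d) from this]
    simp only [Finset.sum_apply, Pi.smul_apply, connForm_e_e, smul_eq_mul]
    exact Finset.sum_congr rfl fun d _ => mul_comm _ _
  rw [h, h, Finset.sum_sub_distrib]
  ring

/-- The antisymmetric part of the Ricci tensor is the trace of the curvature. -/
theorem ricci_sub_ricci (hM : IsOpen M) (hL : IsPseudoFinsler M A L)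
    (hB : IsCanonicalConnection M A L Γ) {x : R4} (hx : x ∈ M) (b c : Fin 4) :
    ricci Γ x b c - ricci Γ x c b = (toMat (curv (connForm Γ) x (e b) (e c))).trace := by
  have hsm := contDiffOn_connForm (hB.contDiffOn hL)
  have hBx : DifferentiableAt ℝ (connForm Γ) x :=
    (hsm.contDiffAt (hM.mem_nhds hx)).differentiableAt (by simp)
  simp only [ricci, affineCurv_eq hBx, Matrix.trace, diag_apply, toMat_apply,
    ← Finset.sum_sub_distrib]
  refine Finset.sum_congr rfl fun a _ => ?_
  have := congrFun (curv_bianchi hM hsm (fun y hy => connForm_symm (hB.1 y hy)) hx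
    (e a) (e c) (e b)) a
  have h1 := congrFun (congrArg (fun f : R4 →L[ℝ] R4 => f (e a))
    (curv_swap (connForm Γ) x (e b) (e c))) a
  have h2 := congrFun (congrArg (fun f : R4 →L[ℝ] R4 => f (e c))
    (curv_swap (connForm Γ) x (e a) (e b))) a
  simp only [Pi.add_apply, Pi.zero_apply, _root_.neg_apply, Pi.neg_apply] at this h1 h2
  linarith

theorem trace_curv_eq_zero (hM : IsOpen M) (hL : IsPseudoFinsler M A L)
    (hB : IsCanonicalConnection M A L Γ) {x : R4} (hx : x ∈ M)
    (hric : ∀ b c, ricci Γ x b c = ricci Γ x c b) (a b : R4) :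
    (toMat (curv (connForm Γ) x a b)).trace = 0 := by
  have h0 : ∀ i j, ∑ k, curv (connForm Γ) x (e i) (e j) (e k) k = 0 := by
    intro i j
    have := ricci_sub_ricci hM hL hB hx i j
    rw [hric i j, sub_self, Matrix.trace] at this
    simp only [diag_apply, toMat_apply] at this
    exact this.symm
  simp only [Matrix.trace, diag_apply, toMat_apply]
  rw [curv_sum]
  simp only [_root_.sum_apply, Finset.sum_apply, _root_.smul_apply, Pi.smul_apply, smul_eq_mul]
  rw [Finset.sum_comm]
  refine Finset.sum_eq_zero fun i _ => ?_
  rw [Finset.sum_comm]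
  refine Finset.sum_eq_zero fun j _ => ?_
  rw [← Finset.mul_sum, h0, mul_zero]

end CurvatureTensor

section Rotations

/-- The cross product with the vector `(w₁, w₂, w₃)` of the space `ℝ³`. -/
def crossMat (w₁ w₂ w₃ : ℝ) : Matrix (Fin 4) (Fin 4) ℝ :=
  !![0, 0, 0, 0; 0, 0, -w₃, w₂; 0, w₃, 0, -w₁; 0, -w₂, w₁, 0]

theorem exists_unit_vector (x : R4) : ∃ w₁ w₂ w₃ : ℝ, w₁ ^ 2 + w₂ ^ 2 + w₃ ^ 2 = 1 ∧
    crossMat w₁ w₂ w₃ *ᵥ x = 0 := by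
  by_cases hx : x 1 ^ 2 + x 2 ^ 2 + x 3 ^ 2 = 0
  · have h1 : x 1 = 0 := by nlinarith [sq_nonneg (x 1), sq_nonneg (x 2), sq_nonneg (x 3)]
    have h2 : x 2 = 0 := by nlinarith [sq_nonneg (x 1), sq_nonneg (x 2), sq_nonneg (x 3)]
    have h3 : x 3 = 0 := by nlinarith [sq_nonneg (x 1), sq_nonneg (x 2), sq_nonneg (x 3)]
    refine ⟨1, 0, 0, by norm_num, ?_⟩
    ext i
    rw [mulVec_four]
    fin_cases i <;> simp [crossMat, h1, h2, h3]
  · set r := √(x 1 ^ 2 + x 2 ^ 2 + x 3 ^ 2) with hr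
    have hr2 : r ^ 2 = x 1 ^ 2 + x 2 ^ 2 + x 3 ^ 2 := Real.sq_sqrt (by positivity)
    have hr0 : r ≠ 0 := by
      intro h0; rw [h0] at hr2; exact hx (by rw [← hr2]; norm_num)
    refine ⟨x 1 / r, x 2 / r, x 3 / r, ?_, ?_⟩
    · field_simp; exact hr2.symm
    · ext i
      rw [mulVec_four]
      fin_cases i <;> simp [crossMat] <;> ring

theorem exists_unit_normal (w₁ w₂ w₃ : ℝ) : ∃ z₁ z₂ z₃ : ℝ, z₁ ^ 2 + z₂ ^ 2 + z₃ ^ 2 = 1 ∧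
    w₁ * z₁ + w₂ * z₂ + w₃ * z₃ = 0 := by
  by_cases hx : w₁ ^ 2 + w₂ ^ 2 = 0
  · have h1 : w₁ = 0 := by nlinarith [sq_nonneg w₁, sq_nonneg w₂]
    have h2 : w₂ = 0 := by nlinarith [sq_nonneg w₁, sq_nonneg w₂]
    exact ⟨1, 0, 0, by norm_num, by rw [h1]; ring⟩
  · set r := √(w₁ ^ 2 + w₂ ^ 2) with hr
    have hr2 : r ^ 2 = w₁ ^ 2 + w₂ ^ 2 := Real.sq_sqrt (by positivity)
    have hr0 : r ≠ 0 := by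
      intro h0; rw [h0] at hr2; exact hx (by rw [← hr2]; norm_num)
    refine ⟨-w₂ / r, w₁ / r, 0, ?_, ?_⟩
    · field_simp; linarith
    · field_simp; ring

/-- The rotation generator about a unit vector has the standard form in an orthonormal basis. -/
theorem exists_rotation_basis {w₁ w₂ w₃ : ℝ} (hw : w₁ ^ 2 + w₂ ^ 2 + w₃ ^ 2 = 1) :
    ∃ P Q : Matrix (Fin 4) (Fin 4) ℝ, Q * P = 1 ∧ P * Q = 1 ∧
      P * Jstd * Q = crossMat w₁ w₂ w₃ := by
  obtain ⟨z₁, z₂, z₃, hz, hwz⟩ := exists_unit_normal w₁ w₂ w₃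
  let P : Matrix (Fin 4) (Fin 4) ℝ := !![1, 0, 0, 0; 0, w₁, z₁, w₂ * z₃ - w₃ * z₂;
    0, w₂, z₂, w₃ * z₁ - w₁ * z₃; 0, w₃, z₃, w₁ * z₂ - w₂ * z₁]
  have hQP : Pᵀ * P = 1 := by
    ext i j
    simp only [Matrix.mul_apply, Fin.sum_univ_four, transpose_apply]
    fin_cases i <;> fin_cases j <;> simp [P, -mul_eq_zero]
    · linear_combination hw
    · linear_combination hwz
    · ring
    · linear_combination hwz
    · linear_combination hz
    · ring
    · ring
    · ring
    · linear_combination (w₁ ^ 2 + w₂ ^ 2 + w₃ ^ 2) * hz + hw -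
        (w₁ * z₁ + w₂ * z₂ + w₃ * z₃) * hwz
  have hPQ : P * Pᵀ = 1 := mul_eq_one_comm.1 hQP
  refine ⟨P, Pᵀ, hQP, hPQ, ?_⟩
  have e1 : P * Jstd = crossMat w₁ w₂ w₃ * P := by
    ext i j
    simp only [Matrix.mul_apply, Fin.sum_univ_four]
    fin_cases i <;> fin_cases j <;> simp [P, Jstd, crossMat, -mul_eq_zero]
    · ring
    · ring
    · linear_combination z₁ * hw - w₁ * hwz
    · ring
    · ring
    · linear_combination z₂ * hw - w₂ * hwz
    · ring
    · ring
    · linear_combination z₃ * hw - w₃ * hwz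
  rw [e1, Matrix.mul_assoc, hPQ, Matrix.mul_one]

variable {A : Set TR4} {L : TR4 → ℝ}

theorem rotField_hasFDerivAt (i j : Fin 4) (x : R4) : HasFDerivAt (rotField i j)
    ((ContinuousLinearMap.proj (R := ℝ) (φ := fun _ : Fin 4 => ℝ) i).smulRight (e j) -
      (ContinuousLinearMap.proj (R := ℝ) (φ := fun _ : Fin 4 => ℝ) j).smulRight (e i)) x :=
  ((ContinuousLinearMap.proj (R := ℝ) (φ := fun _ : Fin 4 => ℝ) i).smulRight (e j) -
      (ContinuousLinearMap.proj (R := ℝ) (φ := fun _ : Fin 4 => ℝ) j).smulRight (e i)).hasFDerivAt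

theorem completeLift_rotField (i j : Fin 4) (p : TR4) :
    completeLift (rotField i j) p = (rotField i j p.1, rotField i j p.2) := by
  rw [completeLift, (rotField_hasFDerivAt i j p.1).fderiv]
  rfl

theorem IsSphericallySymmetric.isLinearKilling (h : IsSphericallySymmetric A L) (w₁ w₂ w₃ : ℝ) :
    IsLinearKilling A L
      (LinearMap.toContinuousLinearMap (crossMat w₁ w₂ w₃).mulVecLin) := by
  intro p hp
  have h23 := h 2 3 (by decide) (by decide) p hp
  have h31 := h 3 1 (by decide) (by decide) p hp
  have h12 := h 1 2 (by decide) (by decide) p hp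
  rw [completeLift_rotField] at h23 h31 h12
  have hx : ∀ x : R4, crossMat w₁ w₂ w₃ *ᵥ x =
      w₁ • rotField 2 3 x + w₂ • rotField 3 1 x + w₃ • rotField 1 2 x := by
    intro x
    ext i
    rw [mulVec_four]
    fin_cases i <;> simp [crossMat, rotField, e] <;> ring
  have e1 : (((LinearMap.toContinuousLinearMap (crossMat w₁ w₂ w₃).mulVecLin) p.1,
      (LinearMap.toContinuousLinearMap (crossMat w₁ w₂ w₃).mulVecLin) p.2) : TR4) =
      w₁ • (rotField 2 3 p.1, rotField 2 3 p.2) + w₂ • (rotField 3 1 p.1, rotField 3 1 p.2) +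
        w₃ • (rotField 1 2 p.1, rotField 1 2 p.2) := by
    simp [hx]
  rw [e1, map_add, map_add, map_smul, map_smul, map_smul, h23, h31, h12]
  simp

end Rotations

end

section

open Matrix

/-! ### The curvature of a spherically symmetric function -/

section Fibre

variable {M : Set R4} {A : Set TR4} {L : TR4 → ℝ} {Γ : ConnCoeff}

/-- Three vectors of a space of dimension at most two are linearly dependent. -/
theorem exists_relation_of_finrank_le_two {V : Type*} [AddCommGroup V] [Module ℝ V]
    [FiniteDimensional ℝ V] {S : Submodule ℝ V} (hS : Module.finrank ℝ S ≤ 2) {x y z : V}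
    (hx : x ∈ S) (hy : y ∈ S) (hz : z ∈ S) :
    ∃ a b c : ℝ, (a ≠ 0 ∨ b ≠ 0 ∨ c ≠ 0) ∧ a • x + b • y + c • z = 0 := by
  have h : ¬ LinearIndependent ℝ (![⟨x, hx⟩, ⟨y, hy⟩, ⟨z, hz⟩] : Fin 3 → S) := by
    intro h
    have := h.fintype_card_le_finrank
    simp at this
    omega
  obtain ⟨g, hg, i, hi⟩ := Fintype.not_linearIndependent_iff.1 h
  refine ⟨g 0, g 1, g 2, ?_, ?_⟩
  · fin_cases i
    · exact Or.inl hi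
    · exact Or.inr (Or.inl hi)
    · exact Or.inr (Or.inr hi)
  · have := congrArg Subtype.val hg
    simpa [Fin.sum_univ_three] using this

theorem conj_mulVec (P Q N : Matrix (Fin 4) (Fin 4) ℝ) (v : R4) :
    (Q * N * P) *ᵥ v = Q *ᵥ (N *ᵥ (P *ᵥ v)) := by
  rw [mulVec_mulVec, mulVec_mulVec, Matrix.mul_assoc]

theorem entry_eq (N : Matrix (Fin 4) (Fin 4) ℝ) (l k : Fin 4) : N l k = (N *ᵥ e k) l := by
  simp [e]

theorem mulVecCLM_apply (N : Matrix (Fin 4) (Fin 4) ℝ) (v : R4) :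
    LinearMap.toContinuousLinearMap N.mulVecLin v = N *ᵥ v := rfl

/-- At every point of `M` some rotation generator is a symmetry of the fibre, and the curvature is
equivariant under it. -/
theorem exists_rotation_symmetry (hM : IsOpen M) (hL : IsPseudoFinsler M A L)
    (hsym : IsSphericallySymmetric A L) (hB : IsCanonicalConnection M A L Γ) {x : R4}
    (hx : x ∈ M) : ∃ P Q : Matrix (Fin 4) (Fin 4) ℝ, Q * P = 1 ∧ P * Q = 1 ∧
      IsSym (fun v => L (x, v)) {v | (x, v) ∈ A} (P * Jstd * Q) ∧
      ∀ a b v : R4, curv (connForm Γ) x ((P * Jstd * Q) *ᵥ a) b v +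
        curv (connForm Γ) x a ((P * Jstd * Q) *ᵥ b) v +
        curv (connForm Γ) x a b ((P * Jstd * Q) *ᵥ v) =
        (P * Jstd * Q) *ᵥ (curv (connForm Γ) x a b v) := by
  obtain ⟨w₁, w₂, w₃, hw, hwx⟩ := exists_unit_vector x
  obtain ⟨P, Q, hQP, hPQ, hJ⟩ := exists_rotation_basis hw
  have hK := hsym.isLinearKilling w₁ w₂ w₃
  rw [← hJ] at hK hwx
  refine ⟨P, Q, hQP, hPQ, fun v hv => ?_, fun a b v => ?_⟩
  · rw [hL.fderiv_fibre hv]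
    have hv' : ((x, v) : TR4) ∈ A := hv
    have := hK.fderiv_nabla_eq_zero hM hL hB hv'
    simp only [mulVecCLM_apply, hwx, map_zero, _root_.zero_apply, add_zero] at this
    exact this
  · have hx0 : LinearMap.toContinuousLinearMap (P * Jstd * Q).mulVecLin x = 0 := by
      rw [mulVecCLM_apply, hwx]
    have := hK.curv_equivariant hM hL hB hx hx0 a b v
    simp only [mulVecCLM_apply] at this
    exact this

/-- Over a point where `L` is nowhere quadratic, small vertical holonomy and the symmetry of the
Ricci tensor force the curvature endomorphisms to be block trace-free. -/
theorem curv_isBlockTraceFree (hM : IsOpen M) (hL : IsPseudoFinsler M A L)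
    (hsym : IsSphericallySymmetric A L) (hB : IsCanonicalConnection M A L Γ)
    (hdim : ∀ p ∈ A, Module.finrank ℝ (verticalHolonomy L p) ≤ 2)
    (hric : ∀ x ∈ M, ∀ b c, ricci Γ x b c = ricci Γ x c b) {x : R4} (hx : x ∈ M) {Ω : Set R4}
    (hΩ : IsOpen Ω) (hsub : Ω ⊆ {v | (x, v) ∈ A}) (hne : Ω.Nonempty)
    (hnq : IsNowhereQuadratic (fun v => L (x, v)) Ω) (a b : R4) :
    IsBlockTraceFree (fun v => L (x, v)) Ω (toMat (curv (connForm Γ) x a b)) := by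
  obtain ⟨P, Q, hQP, hPQ, hJ, hequiv⟩ := exists_rotation_symmetry hM hL hsym hB hx
  have hℓ := (hL.isMinkowski_fibre x).mono hΩ hsub
  replace hJ := hJ.mono hsub
  have hsm := contDiffOn_connForm (hB.contDiffOn hL)
  obtain ⟨C, hC⟩ : ∃ C : R4 → R4 → R4 →L[ℝ] R4, C = curv (connForm Γ) x := ⟨_, rfl⟩
  obtain ⟨R, hR⟩ : ∃ R : Fin 4 → Fin 4 → Matrix (Fin 4) (Fin 4) ℝ, ∀ i j, R i j =
    Q * toMat (C (P *ᵥ e i) (P *ᵥ e j)) * P := ⟨_, fun i j => rfl⟩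
  have hRv : ∀ i j v, R i j *ᵥ v = Q *ᵥ (C (P *ᵥ e i) (P *ᵥ e j) (P *ᵥ v)) := fun i j v => by
    rw [hR, conj_mulVec, toMat_mulVec]
  have hswap : ∀ a b, C a b = -C b a := fun a b => by rw [hC]; exact curv_swap _ x b a
  have hsymC : ∀ a b, IsSym (fun v => L (x, v)) Ω (toMat (C a b)) := fun a b => by
    rw [hC]; exact (isSym_curv hM hL hB x a b).mono hsub
  -- the action of the rotation generator on the curvature in the adapted basis
  have hadJ : ∀ i j, adJ (R i j) = Q * toMat (C (P *ᵥ (Jstd *ᵥ e i)) (P *ᵥ e j) +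
      C (P *ᵥ e i) (P *ᵥ (Jstd *ᵥ e j))) * P := by
    intro i j
    refine ext_mulVec fun v => ?_
    have h1 := hequiv (P *ᵥ e i) (P *ᵥ e j) (P *ᵥ v)
    have h2 : ∀ u : R4, (P * Jstd * Q) *ᵥ (P *ᵥ u) = P *ᵥ (Jstd *ᵥ u) := fun u => by
      rw [mulVec_mulVec, Matrix.mul_assoc (P * Jstd), hQP, Matrix.mul_one, mulVec_mulVec]
    rw [h2, h2, h2, ← hC] at h1
    rw [adJ, sub_mulVec, ← mulVec_mulVec, ← mulVec_mulVec, hRv, hRv, conj_mulVec, toMat_mulVec,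
      _root_.add_apply, eq_sub_of_add_eq h1, mulVec_sub]
    congr 1
    rw [mulVec_mulVec, mulVec_mulVec, ← Matrix.mul_assoc, ← Matrix.mul_assoc, hQP, Matrix.one_mul,
      ← mulVec_mulVec]
  have j0 : Jstd *ᵥ e 0 = 0 := by rw [Jstd_mulVec]; ext i; fin_cases i <;> simp [e]
  have j1 : Jstd *ᵥ e 1 = 0 := by rw [Jstd_mulVec]; ext i; fin_cases i <;> simp [e]
  have j2 : Jstd *ᵥ e 2 = e 3 := by rw [Jstd_mulVec]; ext i; fin_cases i <;> simp [e]
  have j3 : Jstd *ᵥ e 3 = -e 2 := by rw [Jstd_mulVec]; ext i; fin_cases i <;> simp [e]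
  have hC0l : ∀ b, C 0 b = 0 := fun b => by
    have := curv_smul_left (connForm Γ) x 0 b 0
    rw [zero_smul, zero_smul] at this
    rw [hC]; exact this
  have hC0r : ∀ a, C a 0 = 0 := fun a => by rw [hswap, hC0l, neg_zero]
  have hCnr : ∀ a b, C a (-b) = -C a b := fun a b => by
    have := curv_smul_right (connForm Γ) x a b (-1)
    rw [neg_one_smul, neg_one_smul] at this
    rw [hC]; exact this
  have hself : ∀ a, C a a = 0 := fun a => by
    rw [hC]; ext v; simp [curv_apply]
  have hzero : toMat 0 = 0 := by ext i j; simp [toMat_apply]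
  have hblock := curvature_lower_trace (R := R) (hℓ.comp hQP hPQ) (nonempty_comp hPQ hne)
    (hnq.comp hQP hPQ) ((isSym_conj hℓ hQP hPQ _).2 hJ) (fun i j => by
      rw [hR]; exact (hsymC _ _).conj hℓ hQP hPQ)
    (fun i j => by
      rw [hR, hR, hswap, toMat_neg, Matrix.mul_neg, Matrix.neg_mul])
    (fun i j k l => by
      rw [entry_eq (R i j) l k, entry_eq (R j k) l i, entry_eq (R k i) l j, hRv, hRv, hRv, ← Pi.add_apply,
        ← Pi.add_apply, ← mulVec_add, ← mulVec_add, hC,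
        curv_bianchi hM hsm (fun y hy => connForm_symm (hB.1 y hy)) hx, mulVec_zero]
      rfl)
    (fun i j => by
      rw [hR, trace_conj hPQ, hC]
      exact trace_curv_eq_zero hM hL hB hx (hric x hx) _ _)
    (by rw [hadJ, j0, j1, mulVec_zero, hC0l, hC0r, add_zero, hzero, Matrix.mul_zero,
      Matrix.zero_mul])
    (by rw [hadJ, j2, j3, mulVec_neg, hCnr, hself, hself, neg_zero, add_zero, hzero,
      Matrix.mul_zero, Matrix.zero_mul])
    (by rw [hadJ, j0, j2, mulVec_zero, hC0l, zero_add, hR])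
    (by rw [hadJ, j0, j3, mulVec_zero, hC0l, zero_add, mulVec_neg, hCnr, toMat_neg,
      Matrix.mul_neg, Matrix.neg_mul, hR])
    (by rw [hadJ, j1, j2, mulVec_zero, hC0l, zero_add, hR])
    (by rw [hadJ, j1, j3, mulVec_zero, hC0l, zero_add, mulVec_neg, hCnr, toMat_neg,
      Matrix.mul_neg, Matrix.neg_mul, hR])
    (fun v hv i j k l m n => by
      have hp : ((x, P *ᵥ v) : TR4) ∈ A := hsub hv
      have hmem : ∀ a b, ((0 : R4), C a b (P *ᵥ v)) ∈ verticalHolonomy L (x, P *ᵥ v) :=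
        fun a b => by rw [hC]; exact curv_apply_mem_verticalHolonomy hM hL hB hp a b
      obtain ⟨α, β, γ, hne, h0⟩ := exists_relation_of_finrank_le_two (hdim _ hp)
        (hmem (P *ᵥ e i) (P *ᵥ e j)) (hmem (P *ᵥ e k) (P *ᵥ e l)) (hmem (P *ᵥ e m) (P *ᵥ e n))
      refine ⟨α, β, γ, hne, ?_⟩
      have h1 := congrArg Prod.snd h0
      simp only [Prod.snd_add, Prod.smul_snd, Prod.snd_zero] at h1
      rw [hRv, hRv, hRv, ← mulVec_smul, ← mulVec_smul, ← mulVec_smul, ← mulVec_add, ← mulVec_add,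
        h1, mulVec_zero])
  have hlow : (Q * toMat (C a b) * P) 2 2 + (Q * toMat (C a b) * P) 3 3 = 0 := by
    have e1 : ∀ l, (Q * toMat (C a b) * P) l l =
        ∑ i, ∑ j, ((Q *ᵥ a) i * (Q *ᵥ b) j) * R i j l l := by
      intro l
      have ha : C a b = C (P.mulVecLin (Q *ᵥ a)) (P.mulVecLin (Q *ᵥ b)) := by
        rw [mulVecLin_apply, mulVecLin_apply, mulVec_cancel hPQ, mulVec_cancel hPQ]
      rw [entry_eq (Q * toMat (C a b) * P) l l, conj_mulVec, toMat_mulVec, ha, hC, curv_map_sum]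
      simp only [_root_.sum_apply, _root_.smul_apply, mulVec_sum, mulVec_smul, Finset.sum_apply,
        Pi.smul_apply, smul_eq_mul]
      refine Finset.sum_congr rfl fun i _ => Finset.sum_congr rfl fun j _ => ?_
      rw [entry_eq (R i j) l l, hRv, hC, mulVecLin_apply, mulVecLin_apply]
    rw [e1, e1, ← Finset.sum_add_distrib]
    refine Finset.sum_eq_zero fun i _ => ?_
    rw [← Finset.sum_add_distrib]
    refine Finset.sum_eq_zero fun j _ => ?_
    rw [← mul_add, hblock, mul_zero]
  rw [← hC]
  refine ⟨P, Q, hQP, hPQ, hJ, ?_, hlow⟩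
  have htr : (Q * toMat (C a b) * P).trace = 0 := by
    rw [trace_conj hPQ, hC]
    exact trace_curv_eq_zero hM hL hB hx (hric x hx) a b
  rw [trace_block] at htr
  linarith

end Fibre

end

section

open Matrix

/-! ### The invariant form of a fibre -/

section Congr

variable {ℓ ℓ' : R4 → ℝ} {Ω : Set R4}

theorem IsSym.congr {N : Matrix (Fin 4) (Fin 4) ℝ} (h : IsSym ℓ Ω N) (hΩ : IsOpen Ω)
    (he : ∀ v ∈ Ω, ℓ' v = ℓ v) : IsSym ℓ' Ω N := fun v hv => by
  rw [Filter.EventuallyEq.fderiv_eq (f := ℓ)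
    (by filter_upwards [hΩ.mem_nhds hv] with w hw using he w hw)]
  exact h v hv

theorem IsNowhereQuadratic.congr (h : IsNowhereQuadratic ℓ Ω) (he : ∀ v ∈ Ω, ℓ' v = ℓ v) :
    IsNowhereQuadratic ℓ' Ω := by
  rintro Ω' hsub hopen hne ⟨G, hG⟩
  exact h Ω' hsub hopen hne ⟨G, fun v hv => by rw [← he v (hsub hv), hG v hv]⟩

theorem IsBlockTraceFree.congr {N : Matrix (Fin 4) (Fin 4) ℝ} (h : IsBlockTraceFree ℓ Ω N)
    (hΩ : IsOpen Ω) (he : ∀ v ∈ Ω, ℓ' v = ℓ v) : IsBlockTraceFree ℓ' Ω N := by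
  obtain ⟨P, Q, hQP, hPQ, hJ, ha, hb⟩ := h
  exact ⟨P, Q, hQP, hPQ, hJ.congr hΩ he, ha, hb⟩

end Congr

section Form

variable {M : Set R4} {A : Set TR4} {L : TR4 → ℝ} {Γ : ConnCoeff}

/-- The symmetrised matrix of a quadratic function `ℓ` is nondegenerate, and all symmetries of `ℓ`
are antisymmetric for it. -/
theorem IsMinkowski.exists_form_of_quadratic {ℓ : R4 → ℝ} {Ω : Set R4} (h : IsMinkowski ℓ Ω)
    (hne : Ω.Nonempty) {G : Matrix (Fin 4) (Fin 4) ℝ} (hG : ∀ v ∈ Ω, ℓ v = v ⬝ᵥ (G *ᵥ v)) :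
    ∃ q : Matrix (Fin 4) (Fin 4) ℝ, q.IsSymm ∧ q.det ≠ 0 ∧
      ∀ N, IsSym ℓ Ω N → q * N + (q * N)ᵀ = 0 := by
  set q : Matrix (Fin 4) (Fin 4) ℝ := G + Gᵀ with hq
  have hqs : q.IsSymm := by rw [Matrix.IsSymm, hq, transpose_add, transpose_transpose, add_comm]
  have hq2 : ∀ v : R4, v ⬝ᵥ (q *ᵥ v) = 2 * (v ⬝ᵥ (G *ᵥ v)) := fun v => by
    have : v ⬝ᵥ (Gᵀ *ᵥ v) = v ⬝ᵥ (G *ᵥ v) := by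
      rw [mulVec_transpose, dotProduct_comm, ← dotProduct_mulVec]
    rw [hq, add_mulVec, dotProduct_add, this]; ring
  have hfd : ∀ v ∈ Ω, ∀ w, fderiv ℝ ℓ v w = w ⬝ᵥ (q *ᵥ v) := by
    intro v hv w
    obtain ⟨D, hD, hDw⟩ := hasFDerivAt_quadratic hqs v
    have h1 := (hD.const_mul (1 / 2 : ℝ)).congr_of_eventuallyEq (f₁ := ℓ) (by
      filter_upwards [h.isOpen.mem_nhds hv] with u hu
      rw [hG u hu, hq2]; ring)
    rw [h1.fderiv, _root_.smul_apply, hDw, smul_eq_mul]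
    ring
  refine ⟨q, hqs, fun hdet => ?_, fun N hN => add_transpose_eq_zero ?_⟩
  · obtain ⟨w, hw0, hw⟩ := Matrix.exists_mulVec_eq_zero_iff.2 hdet
    refine hw0 (h.eq_zero_of_kills hne fun v hv => ?_)
    rw [hfd v hv, dotProduct_mulVec, ← mulVec_transpose, hqs.eq, hw, zero_dotProduct]
  · refine eq_zero_of_analytic (contDiff_quadratic _) h.isOpen hne fun v hv => ?_
    have := hN v hv
    rw [hfd v hv, dotProduct_mulVec, ← mulVec_transpose, hqs.eq, dotProduct_comm,
      mulVec_mulVec] at this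
    exact this

/-- In the tangent space at every point of `M` there is a nondegenerate symmetric form for which
all the curvature endomorphisms, transported back by isometries of `L`, are antisymmetric. -/
theorem exists_form (hM : IsOpen M) (hL : IsPseudoFinsler M A L)
    (hsym : IsSphericallySymmetric A L) (hB : IsCanonicalConnection M A L Γ)
    (hdim : ∀ p ∈ A, Module.finrank ℝ (verticalHolonomy L p) ≤ 2)
    (hric : ∀ x ∈ M, ∀ b c, ricci Γ x b c = ricci Γ x c b) {x₀ : R4} (hx₀ : x₀ ∈ M) :
    ∃ v₀ : R4, ∃ r > 0, Metric.ball (x₀, v₀) r ⊆ A ∧ ∃ q : Matrix (Fin 4) (Fin 4) ℝ,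
      q.IsSymm ∧ q.det ≠ 0 ∧ ∀ y ∈ M, ∀ T S : Matrix (Fin 4) (Fin 4) ℝ, S * T = 1 → T * S = 1 →
        (∀ v ∈ Metric.ball v₀ (r / 2), (y, T *ᵥ v) ∈ A ∧ L (y, T *ᵥ v) = L (x₀, v)) →
        ∀ a b, q * (S * toMat (curv (connForm Γ) y a b) * T) +
          (q * (S * toMat (curv (connForm Γ) y a b) * T))ᵀ = 0 := by
  -- transported curvature endomorphisms are symmetries of the initial fibre
  have htrans : ∀ (v₀ : R4) (r : ℝ), ∀ y ∈ M, ∀ T S : Matrix (Fin 4) (Fin 4) ℝ, S * T = 1 →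
      T * S = 1 →
      (∀ v ∈ Metric.ball v₀ (r / 2), (y, T *ᵥ v) ∈ A ∧ L (y, T *ᵥ v) = L (x₀, v)) → ∀ a b,
      IsSym (fun v => L (x₀, v)) (Metric.ball v₀ (r / 2))
        (S * toMat (curv (connForm Γ) y a b) * T) := by
    intro v₀ r y hy T S hST hTS hiso a b
    have h1 := (isSym_curv hM hL hB y a b).conj (hL.isMinkowski_fibre y) hST hTS
    exact (h1.mono (Ω' := Metric.ball v₀ (r / 2)) fun v hv => (hiso v hv).1).congr
      Metric.isOpen_ball fun v hv => (hiso v hv).2.symm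
  have hfib : ∀ (v₀ : R4) (r : ℝ), Metric.ball (x₀, v₀) r ⊆ A → 0 < r →
      Metric.ball v₀ (r / 2) ⊆ {v | (x₀, v) ∈ A} := by
    intro v₀ r hr hr0 v hv
    refine hr ?_
    rw [Metric.mem_ball, Prod.dist_eq, dist_self, max_eq_right dist_nonneg]
    exact (Metric.mem_ball.1 hv).trans (by linarith)
  by_cases hcase : IsNowhereQuadratic (fun v => L (x₀, v)) {v | (x₀, v) ∈ A}
  · obtain ⟨v₀, hv₀⟩ := hL.fibre_nonempty hx₀
    obtain ⟨r, hr0, hr⟩ := Metric.isOpen_iff.1 hL.conic.isOpen _ hv₀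
    have hsub := hfib v₀ r hr hr0
    have hne : (Metric.ball v₀ (r / 2)).Nonempty := ⟨v₀, Metric.mem_ball_self (by linarith)⟩
    have hℓ := (hL.isMinkowski_fibre x₀).mono Metric.isOpen_ball hsub
    have hnq : IsNowhereQuadratic (fun v => L (x₀, v)) (Metric.ball v₀ (r / 2)) :=
      fun Ω' hΩ' => hcase Ω' (hΩ'.trans hsub)
    obtain ⟨P, Q, hQP, hPQ, hJ, -⟩ := exists_rotation_symmetry hM hL hsym hB hx₀
    obtain ⟨q, hqs, hdet, hq⟩ := hasInvariantForm hℓ hne hnq hQP hPQ (hJ.mono hsub)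
    refine ⟨v₀, r, hr0, hr, q, hqs, hdet, fun y hy T S hST hTS hiso a b =>
      hq _ (htrans v₀ r y hy T S hST hTS hiso a b) ?_⟩
    have hopen : IsOpen {w : R4 | S *ᵥ w ∈ Metric.ball v₀ (r / 2)} :=
      Metric.isOpen_ball.preimage (contDiff_mulVec S).continuous
    have heq : ∀ w ∈ {w : R4 | S *ᵥ w ∈ Metric.ball v₀ (r / 2)},
        (y, w) ∈ A ∧ L (y, w) = L (x₀, S *ᵥ w) := fun w hw => by
      have := hiso _ hw
      rwa [mulVec_cancel hTS] at this
    have hsuby : {w : R4 | S *ᵥ w ∈ Metric.ball v₀ (r / 2)} ⊆ {w | (y, w) ∈ A} :=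
      fun w hw => (heq w hw).1
    have h1 := curv_isBlockTraceFree hM hL hsym hB hdim hric hy hopen hsuby
      (nonempty_comp hST hne) ((hnq.comp hTS hST).congr fun w hw => (heq w hw).2) a b
    have h2 := h1.conj ((hL.isMinkowski_fibre y).mono hopen hsuby) hST hTS
    have hset : {v : R4 | T *ᵥ v ∈ {w : R4 | S *ᵥ w ∈ Metric.ball v₀ (r / 2)}} =
        Metric.ball v₀ (r / 2) := by
      ext v; simp [mulVec_cancel hST]
    rw [hset] at h2
    exact h2.congr Metric.isOpen_ball fun v hv => (hiso v hv).2.symm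
  · unfold IsNowhereQuadratic at hcase
    push Not at hcase
    obtain ⟨Ω', hsub', hopen', ⟨v₀, hv₀⟩, G, hG⟩ := hcase
    obtain ⟨r₁, hr₁0, hr₁⟩ := Metric.isOpen_iff.1 hL.conic.isOpen _ (hsub' hv₀)
    obtain ⟨r₂, hr₂0, hr₂⟩ := Metric.isOpen_iff.1 hopen' _ hv₀
    have hr0 : 0 < min r₁ r₂ := lt_min hr₁0 hr₂0
    have hr : Metric.ball (x₀, v₀) (min r₁ r₂) ⊆ A :=
      (Metric.ball_subset_ball (min_le_left _ _)).trans hr₁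
    have hsub := hfib v₀ _ hr hr0
    have hne : (Metric.ball v₀ (min r₁ r₂ / 2)).Nonempty :=
      ⟨v₀, Metric.mem_ball_self (by linarith)⟩
    obtain ⟨q, hqs, hdet, hq⟩ := ((hL.isMinkowski_fibre x₀).mono Metric.isOpen_ball
      hsub).exists_form_of_quadratic hne (G := G) fun v hv =>
        hG v (hr₂ (Metric.ball_subset_ball (by linarith [min_le_right r₁ r₂]) hv))
    exact ⟨v₀, _, hr0, hr, q, hqs, hdet, fun y hy T S hST hTS hiso a b =>
      hq _ (htrans v₀ _ y hy T S hST hTS hiso a b)⟩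

end Form

end

section

/-! ### Parallel frames, parallel forms and Christoffel symbols -/

section ParallelForms

variable {V : Type*} [NormedAddCommGroup V] [NormedSpace ℝ V]

/-- The infinitesimal action `(u, v) ↦ q(N u, v) + q(u, N v)` of an endomorphism `N` on bilinear
forms `q`, as a continuous bilinear map of `N` and `q`. -/
def formAct (V : Type*) [NormedAddCommGroup V] [NormedSpace ℝ V] :
    (V →L[ℝ] V) →L[ℝ] (V →L[ℝ] V →L[ℝ] ℝ) →L[ℝ] (V →L[ℝ] V →L[ℝ] ℝ) :=
  let fl : (V →L[ℝ] V →L[ℝ] ℝ) →L[ℝ] (V →L[ℝ] V →L[ℝ] ℝ) :=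
    (ContinuousLinearMap.flipₗᵢ ℝ V V ℝ).toContinuousLinearEquiv.toContinuousLinearMap
  let C := (ContinuousLinearMap.compL ℝ V V (V →L[ℝ] ℝ)).flip
  C + ((ContinuousLinearMap.compL ℝ _ _ _) fl).comp
    (((ContinuousLinearMap.compL ℝ _ _ _).flip fl).comp C)

theorem formAct_apply (N : V →L[ℝ] V) (q : V →L[ℝ] V →L[ℝ] ℝ) (u v : V) :
    formAct V N q u v = q (N u) v + q u (N v) := by
  simp [formAct]

/-- The equation of parallel endomorphism-valued frames: `T' = -B(h) ∘ T`. -/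
def frameForm (B : V → V →L[ℝ] V →L[ℝ] V) (x : V) :
    V →L[ℝ] (V →L[ℝ] V) →L[ℝ] (V →L[ℝ] V) :=
  -((ContinuousLinearMap.compL ℝ V V V).comp (B x))

theorem frameForm_apply (B : V → V →L[ℝ] V →L[ℝ] V) (x h : V) (T : V →L[ℝ] V) :
    frameForm B x h T = -((B x h).comp T) := by
  simp [frameForm]

/-- The equation of parallel bilinear forms: `q'(u, v) = q(B(h) u, v) + q(u, B(h) v)`. -/
def bilinForm (B : V → V →L[ℝ] V →L[ℝ] V) (x : V) :
    V →L[ℝ] (V →L[ℝ] V →L[ℝ] ℝ) →L[ℝ] (V →L[ℝ] V →L[ℝ] ℝ) :=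
  (formAct V).comp (B x)

theorem bilinForm_apply (B : V → V →L[ℝ] V →L[ℝ] V) (x h : V) (q : V →L[ℝ] V →L[ℝ] ℝ) (u v : V) :
    bilinForm B x h q u v = q (B x h u) v + q u (B x h v) := by
  simp [bilinForm, formAct_apply]

variable {B : V → V →L[ℝ] V →L[ℝ] V} {M : Set V}

theorem contDiffOn_frameForm (hB : ContDiffOn ℝ ∞ B M) : ContDiffOn ℝ ∞ (frameForm B) M :=
  (contDiffOn_const.clm_comp hB).neg

theorem contDiffOn_bilinForm (hB : ContDiffOn ℝ ∞ B M) : ContDiffOn ℝ ∞ (bilinForm B) M :=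
  contDiffOn_const.clm_comp hB

theorem fderiv_bilinForm {x : V} (hB : DifferentiableAt ℝ B x) (a b : V) (q : V →L[ℝ] V →L[ℝ] ℝ)
    (u v : V) :
    fderiv ℝ (bilinForm B) x a b q u v = q (fderiv ℝ B x a b u) v + q u (fderiv ℝ B x a b v) := by
  have h : HasFDerivAt (bilinForm B)
      ((ContinuousLinearMap.compL ℝ V _ _ (formAct V)).comp (fderiv ℝ B x)) x :=
    (ContinuousLinearMap.compL ℝ V _ _ (formAct V)).hasFDerivAt.comp x hB.hasFDerivAt
  rw [h.fderiv]
  simp [formAct_apply]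

/-- Along a ray, first integrals of the horizontal fields are constant on parallel vectors. -/
theorem IsRadiallyParallel.first_integral {x₀ h v : V} {δ : ℝ} {T : V → V →L[ℝ] V}
    (hT : IsRadiallyParallel (frameForm B) x₀ δ T) (hh : ‖h‖ < δ) {F : V × V → ℝ}
    (hF : ∀ s ∈ Icc (0 : ℝ) 1, DifferentiableAt ℝ F (x₀ + s • h, T (x₀ + s • h) v))
    (hhor : ∀ s ∈ Icc (0 : ℝ) 1, fderiv ℝ F (x₀ + s • h, T (x₀ + s • h) v)
      (horizField B h (x₀ + s • h, T (x₀ + s • h) v)) = 0) :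
    F (x₀ + h, T (x₀ + h) v) = F (x₀, T x₀ v) := by
  have hd : ∀ s ∈ Icc (0 : ℝ) 1, HasDerivWithinAt (fun s : ℝ => F (x₀ + s • h, T (x₀ + s • h) v)) 0
      (Icc 0 1) s := by
    intro s hs
    have h1 := (hT h hh s hs).clm_apply (hasDerivWithinAt_const s (Icc (0 : ℝ) 1) v)
    have h2 : HasDerivWithinAt (fun s : ℝ => x₀ + s • h) h (Icc 0 1) s := by
      simpa using (((hasDerivAt_id s).smul_const h).const_add x₀).hasDerivWithinAt
    have h3 := (hF s hs).hasFDerivAt.comp_hasDerivWithinAt s (h2.prodMk h1)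
    refine h3.congr_deriv ?_
    rw [← hhor s hs]
    simp [horizField, frameForm_apply]
  have := constant_of_has_deriv_right_zero (fun s hs => (hd s hs).continuousWithinAt)
    (fun s hs => hasDerivWithinAt_Ici_of_Icc hs (hd s (Ico_subset_Icc_self hs))) 1 (by simp)
  simpa using this

/-- Parallel forms are constant on parallel vectors. -/
theorem IsRadiallyParallel.form_apply {x₀ y : V} {δ : ℝ} {T : V → V →L[ℝ] V}
    {q : V → V →L[ℝ] V →L[ℝ] ℝ}
    (hT : IsRadiallyParallel (frameForm B) x₀ δ T) (hq : IsRadiallyParallel (bilinForm B) x₀ δ q)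
    (hy : y ∈ Metric.ball x₀ δ) (u v : V) : q y (T y u) (T y v) = q x₀ (T x₀ u) (T x₀ v) := by
  obtain ⟨h, rfl⟩ : ∃ h, y = x₀ + h := ⟨y - x₀, by simp⟩
  have hh : ‖h‖ < δ := by simpa [dist_eq_norm] using hy
  have hd : ∀ s ∈ Icc (0 : ℝ) 1, HasDerivWithinAt (fun s : ℝ => q (x₀ + s • h)
      (T (x₀ + s • h) u) (T (x₀ + s • h) v)) 0 (Icc 0 1) s := by
    intro s hs
    have h1 : ∀ v, _ := fun v =>
      (hT h hh s hs).clm_apply (hasDerivWithinAt_const s (Icc (0 : ℝ) 1) v)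
    have h3 := ((hq h hh s hs).clm_apply (h1 u)).clm_apply (h1 v)
    refine h3.congr_deriv ?_
    simp [bilinForm_apply, frameForm_apply]
  have := constant_of_has_deriv_right_zero (fun s hs => (hd s hs).continuousWithinAt)
    (fun s hs => hasDerivWithinAt_Ici_of_Icc hs (hd s (Ico_subset_Icc_self hs))) 1 (by simp)
  simpa using this

/-- A radially parallel form that is invariant under the curvature is parallel. -/
theorem IsRadiallyParallel.hasFDerivAt_form [FiniteDimensional ℝ V] {x₀ y : V} {δ C : ℝ}
    {q : V → V →L[ℝ] V →L[ℝ] ℝ}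
    (hB : ContDiffOn ℝ ∞ B (Metric.ball x₀ δ))
    (hq : IsRadiallyParallel (bilinForm B) x₀ δ q) (hC : ∀ y ∈ Metric.ball x₀ δ, ‖q y‖ ≤ C)
    (hcurv : ∀ y ∈ Metric.ball x₀ δ, ∀ a b u v,
      q y (curv B y a b u) v + q y u (curv B y a b v) = 0)
    (hy : y ∈ Metric.ball x₀ δ) : HasFDerivAt q ((bilinForm B y).flip (q y)) y := by
  refine hq.hasFDerivAt ((contDiffOn_bilinForm hB).of_le two_le_infty) hC ?_ hy
  intro z hz a b
  have hBz : DifferentiableAt ℝ B z :=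
    (hB.contDiffAt (Metric.isOpen_ball.mem_nhds hz)).differentiableAt (by simp)
  ext u v
  have := hcurv z hz a b u v
  simp only [curv_apply, map_sub, map_add, _root_.add_apply, _root_.sub_apply] at this
  simp only [_root_.add_apply, fderiv_bilinForm hBz, bilinForm_apply]
  linarith

/-- A solution of `q' = θ q` with smooth coefficients is smooth. -/
theorem contDiffOn_of_hasFDerivAt {E : Type*} [NormedAddCommGroup E] [NormedSpace ℝ E]
    {θ : V → V →L[ℝ] E →L[ℝ] E} {U : Set V} (hU : IsOpen U)
    (hθ : ContDiffOn ℝ ∞ θ U) {q : V → E}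
    (hq : ∀ y ∈ U, HasFDerivAt q ((θ y).flip (q y)) y) : ContDiffOn ℝ ∞ q U := by
  rw [contDiffOn_infty]
  intro n
  induction n with
  | zero => exact contDiffOn_zero.2 fun y hy => (hq y hy).continuousAt.continuousWithinAt
  | succ n ih =>
    rw [Nat.cast_add, Nat.cast_one, contDiffOn_succ_iff_fderiv_of_isOpen hU]
    refine ⟨fun y hy => (hq y hy).differentiableAt.differentiableWithinAt, by simp, ?_⟩
    have hfl : ContDiffOn ℝ n (fun y => (θ y).flip) U :=
      ((ContinuousLinearMap.flipₗᵢ ℝ V E E).toContinuousLinearEquiv.contDiff.comp_contDiffOn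
        (hθ.of_le (by exact_mod_cast le_top)))
    exact (hfl.clm_apply ih).congr fun y hy => (hq y hy).fderiv

end ParallelForms

section Christoffel

open Matrix

/-- The Koszul formula: a connection which is torsion-free and preserves `g` is the Levi-Civita
connection. -/
theorem christoffel_eq {g : R4 → Matrix (Fin 4) (Fin 4) ℝ} {Γ : ConnCoeff} {x : R4}
    (hdet : (g x).det ≠ 0) (hg : ∀ i j, g x i j = g x j i) (hΓ : ∀ c a b, Γ x c a b = Γ x c b a)
    (hpar : ∀ a b d, pd a (fun y => g y b d) x =
      ∑ k, (Γ x k a b * g x k d + Γ x k a d * g x b k)) (c a b : Fin 4) :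
    christoffel g x c a b = Γ x c a b := by
  have h1 : ∀ d, pd a (fun y => g y b d) x + pd b (fun y => g y a d) x -
      pd d (fun y => g y a b) x = 2 * (g x *ᵥ fun k => Γ x k a b) d := by
    intro d
    rw [hpar, hpar, hpar, ← Finset.sum_add_distrib, ← Finset.sum_sub_distrib]
    simp only [mulVec, dotProduct]
    rw [Finset.mul_sum]
    refine Finset.sum_congr rfl fun k _ => ?_
    rw [hΓ k b a, hΓ k d b, hΓ k d a, hg k d, hg b k]
    ring
  have h2 : (g x)⁻¹ *ᵥ (g x *ᵥ fun k => Γ x k a b) = fun k => Γ x k a b := by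
    rw [mulVec_mulVec, Matrix.nonsing_inv_mul _ hdet.isUnit, one_mulVec]
  have h3 := congrFun h2 c
  simp only [christoffel, h1]
  rw [← h3, mulVec, dotProduct, Finset.mul_sum]
  exact Finset.sum_congr rfl fun d _ => by ring

/-- The Levi-Civita connection of `g` preserves `g`. -/
theorem pd_metric_of_christoffel {g : R4 → Matrix (Fin 4) (Fin 4) ℝ} {U : Set R4}
    (hU : IsOpen U) (hg : IsPseudoRiemannian U g) {x : R4} (hx : x ∈ U) (a b d : Fin 4) :
    pd a (fun y => g y b d) x =
      ∑ k, (christoffel g x k a b * g x k d + christoffel g x k a d * g x b k) := by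
  have hs : ∀ a b d, pd a (fun y => g y b d) x = pd a (fun y => g y d b) x := fun a b d => by
    have : (fun y => g y b d) =ᶠ[𝓝 x] fun y => g y d b := by
      filter_upwards [hU.mem_nhds hx] with y hy using hg.symm y hy b d
    rw [pd, pd, this.fderiv_eq]
  have hlow : ∀ a b d, ∑ k, christoffel g x k a b * g x k d = (1 / 2) *
      (pd a (fun y => g y b d) x + pd b (fun y => g y a d) x - pd d (fun y => g y a b) x) := by
    intro a b d
    set K : R4 := fun d => pd a (fun y => g y b d) x + pd b (fun y => g y a d) x -
      pd d (fun y => g y a b) x with hK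
    have h1 : ∀ k, christoffel g x k a b = (1 / 2) * ((g x)⁻¹ *ᵥ K) k := fun k => rfl
    have h2 : g x *ᵥ ((g x)⁻¹ *ᵥ K) = K := by
      rw [mulVec_mulVec, Matrix.mul_nonsing_inv _ (hg.nondegenerate x hx).isUnit, one_mulVec]
    have h3 := congrFun h2 d
    rw [mulVec, dotProduct] at h3
    change _ = (1 / 2) * K d
    rw [← h3, Finset.mul_sum]
    refine Finset.sum_congr rfl fun k _ => ?_
    rw [h1, hg.symm x hx k d]; ring
  rw [Finset.sum_add_distrib, hlow]
  have : ∑ k, christoffel g x k a d * g x b k = ∑ k, christoffel g x k a d * g x k b :=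
    Finset.sum_congr rfl fun k _ => by rw [hg.symm x hx b k]
  rw [this, hlow, hs a d b, hs d a b, hs b a d]
  ring

end Christoffel

end

section

open Matrix

/-! ### Metrizability -/

/-- The bilinear form with a given matrix. -/
def matForm (q : Matrix (Fin 4) (Fin 4) ℝ) : R4 →L[ℝ] R4 →L[ℝ] ℝ :=
  ∑ i, ∑ j, q i j • (ContinuousLinearMap.proj (R := ℝ) (φ := fun _ : Fin 4 => ℝ) i).smulRight
    (ContinuousLinearMap.proj (R := ℝ) (φ := fun _ : Fin 4 => ℝ) j)

theorem matForm_apply (q : Matrix (Fin 4) (Fin 4) ℝ) (u v : R4) :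
    matForm q u v = u ⬝ᵥ (q *ᵥ v) := by
  simp only [matForm, _root_.sum_apply, _root_.smul_apply,
    ContinuousLinearMap.smulRight_apply, ContinuousLinearMap.proj_apply, smul_eq_mul, dotProduct,
    mulVec, Finset.mul_sum]
  exact Finset.sum_congr rfl fun i _ => Finset.sum_congr rfl fun j _ => by ring

theorem form_apply_eq_sum (q : R4 →L[ℝ] R4 →L[ℝ] ℝ) (u v : R4) :
    q u v = u ⬝ᵥ ((Matrix.of fun i j => q (e i) (e j)) *ᵥ v) := by
  have h1 : q u = ∑ i, u i • q (e i) := map_eq_sum_e q.toLinearMap u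
  have h2 : ∀ i, q (e i) v = ∑ j, v j • q (e i) (e j) := fun i =>
    map_eq_sum_e (q (e i)).toLinearMap v
  rw [h1]
  simp only [_root_.sum_apply, _root_.smul_apply, h2, smul_eq_mul, dotProduct, mulVec, of_apply]
  exact Finset.sum_congr rfl fun i _ => by
    congr 1; exact Finset.sum_congr rfl fun j _ => mul_comm _ _

/-- A linear map close to the identity is invertible. -/
theorem exists_inverse_of_norm_sub_id_lt {T : R4 →L[ℝ] R4}
    (hT : ‖T - ContinuousLinearMap.id ℝ R4‖ < 1) : ∃ S : R4 →L[ℝ] R4,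
      (∀ v, S (T v) = v) ∧ ∀ v, T (S v) = v := by
  have h1 : IsUnit (1 - (ContinuousLinearMap.id ℝ R4 - T)) :=
    isUnit_one_sub_of_norm_lt_one (by rwa [norm_sub_rev])
  have h2 : (1 : R4 →L[ℝ] R4) - (ContinuousLinearMap.id ℝ R4 - T) = T := by
    ext v; simp
  rw [h2] at h1
  obtain ⟨u, hu⟩ := h1
  refine ⟨((u⁻¹ : (R4 →L[ℝ] R4)ˣ) : R4 →L[ℝ] R4), fun v => ?_, fun v => ?_⟩
  · rw [← hu]; exact congrArg (fun f : R4 →L[ℝ] R4 => f v) u.inv_mul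
  · rw [← hu]; exact congrArg (fun f : R4 →L[ℝ] R4 => f v) u.mul_inv

variable {M : Set R4} {A : Set TR4} {L : TR4 → ℝ} {Γ : ConnCoeff}

/-- Parallel transport along rays of the canonical connection preserves `L`. -/
theorem exists_parallel_frame (hM : IsOpen M) (hL : IsPseudoFinsler M A L)
    (hB : IsCanonicalConnection M A L Γ) {x₀ v₀ : R4} (hx₀ : x₀ ∈ M) {r : ℝ} (hr0 : 0 < r)
    (hr : Metric.ball (x₀, v₀) r ⊆ A) :
    ∃ δ > 0, Metric.ball x₀ δ ⊆ M ∧ ∃ T : R4 → R4 →L[ℝ] R4, T x₀ = ContinuousLinearMap.id ℝ R4 ∧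
      IsRadiallyParallel (frameForm (connForm Γ)) x₀ δ T ∧ ∀ y ∈ Metric.ball x₀ δ,
        (∃ S : R4 →L[ℝ] R4, (∀ v, S (T y v) = v) ∧ ∀ v, T y (S v) = v) ∧
        ∀ v ∈ Metric.ball v₀ (r / 2), (y, T y v) ∈ A ∧ L (y, T y v) = L (x₀, v) := by
  have hsm := contDiffOn_connForm (hB.contDiffOn hL)
  have hd : 0 < 4 * (‖v₀‖ + r) := by positivity
  obtain ⟨δ₁, hδ₁0, hδ₁, T, hT0, hTε, hT⟩ := exists_isRadiallyParallel hM hx₀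
    (contDiffOn_frameForm hsm).continuousOn (ContinuousLinearMap.id ℝ R4)
    (ε := r / (4 * (‖v₀‖ + r))) (by positivity)
  refine ⟨min δ₁ r, lt_min hδ₁0 hr0, (Metric.ball_subset_ball (min_le_left _ _)).trans hδ₁, T, hT0,
    hT.mono (min_le_left _ _), fun y hy => ⟨exists_inverse_of_norm_sub_id_lt ?_, ?_⟩⟩
  · refine (hTε y (Metric.ball_subset_ball (min_le_left _ _) hy)).trans_lt ?_
    rw [div_lt_one hd]
    linarith [norm_nonneg v₀]
  · intro v hv
    have hmem : ∀ z ∈ Metric.ball x₀ (min δ₁ r), ((z, T z v) : TR4) ∈ A := by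
      intro z hz
      refine hr ?_
      have h1 : ‖T z v - v‖ ≤ r / (4 * (‖v₀‖ + r)) * ‖v‖ :=
        ((T z - ContinuousLinearMap.id ℝ R4).le_opNorm v).trans (mul_le_mul_of_nonneg_right
          (hTε z (Metric.ball_subset_ball (min_le_left _ _) hz)) (norm_nonneg _))
      have h2 : ‖v - v₀‖ < r / 2 := by rwa [← dist_eq_norm]
      have h3 : ‖v‖ ≤ ‖v₀‖ + r := by
        have := norm_add_le (v - v₀) v₀
        rw [sub_add_cancel] at this
        linarith
      have h4 : r / (4 * (‖v₀‖ + r)) * ‖v‖ ≤ r / 4 := by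
        rw [div_mul_eq_mul_div, div_le_div_iff₀ hd (by norm_num)]
        nlinarith
      have h5 : ‖T z v - v₀‖ < r := by
        have := norm_add_le (T z v - v) (v - v₀)
        rw [sub_add_sub_cancel] at this
        linarith
      rw [Metric.mem_ball, Prod.dist_eq]
      refine max_lt ((Metric.mem_ball.1 hz).trans_le (min_le_right _ _)) ?_
      rw [dist_eq_norm]; exact h5
    obtain ⟨h, rfl⟩ : ∃ h, y = x₀ + h := ⟨y - x₀, by simp⟩
    have hh : ‖h‖ < min δ₁ r := by simpa [dist_eq_norm] using hy
    refine ⟨hmem _ hy, ?_⟩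
    have := (hT.mono (min_le_left _ _)).first_integral (v := v) hh (F := L)
      (fun s hs => (hL.smooth.contDiffAt (hL.conic.isOpen.mem_nhds
        (hmem _ (add_smul_mem_ball hh hs)))).differentiableAt (by simp))
      (fun s hs => fderiv_horizField_eq_zero hM hL hB (hmem _ (add_smul_mem_ball hh hs)) h)
    rw [this, hT0]
    rfl

/-- Radial parallel transport of the invariant form of one fibre gives a metric, whose
Levi-Civita connection is the canonical one. -/
theorem isLocallyRiemannMetrizable (hM : IsOpen M) (hL : IsPseudoFinsler M A L)
    (hsym : IsSphericallySymmetric A L) (hB : IsCanonicalConnection M A L Γ)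
    (hdim : ∀ p ∈ A, Module.finrank ℝ (verticalHolonomy L p) ≤ 2)
    (hric : ∀ x ∈ M, ∀ b c, ricci Γ x b c = ricci Γ x c b) : IsLocallyRiemannMetrizable M Γ := by
  intro x₀ hx₀
  have hsm := contDiffOn_connForm (hB.contDiffOn hL)
  obtain ⟨v₀, r, hr0, hr, q₀, hq₀s, hq₀det, hq₀⟩ := exists_form hM hL hsym hB hdim hric hx₀
  obtain ⟨δ₁, hδ₁0, hδ₁, T, hT0, hT, hTy⟩ := exists_parallel_frame hM hL hB hx₀ hr0 hr
  obtain ⟨δ₂, hδ₂0, hδ₂, q, hqx₀, hqε, hq⟩ := exists_isRadiallyParallel hM hx₀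
    (contDiffOn_bilinForm hsm).continuousOn (matForm q₀) one_pos
  set δ := min δ₁ δ₂ with hδ
  have hb1 : Metric.ball x₀ δ ⊆ Metric.ball x₀ δ₁ := Metric.ball_subset_ball (min_le_left _ _)
  have hb2 : Metric.ball x₀ δ ⊆ Metric.ball x₀ δ₂ := Metric.ball_subset_ball (min_le_right _ _)
  have hq' := hq.mono (min_le_right δ₁ δ₂)
  have hT' := hT.mono (min_le_left δ₁ δ₂)
  have hframe : ∀ y ∈ Metric.ball x₀ δ, ∀ u v, q y (T y u) (T y v) = u ⬝ᵥ (q₀ *ᵥ v) := by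
    intro y hy u v
    rw [hT'.form_apply hq' hy, hqx₀, hT0, matForm_apply]
    rfl
  have hq₀symm : ∀ u v : R4, u ⬝ᵥ (q₀ *ᵥ v) = v ⬝ᵥ (q₀ *ᵥ u) := fun u v => by
    rw [dotProduct_mulVec, ← mulVec_transpose, hq₀s.eq, dotProduct_comm]
  have hcurv : ∀ y ∈ Metric.ball x₀ δ, ∀ a b u v, q y (curv (connForm Γ) y a b u) v +
      q y u (curv (connForm Γ) y a b v) = 0 := by
    intro y hy a b u v
    obtain ⟨⟨S, hST, hTS⟩, hiso⟩ := hTy y (hb1 hy)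
    set N := curv (connForm Γ) y a b with hN
    have h1 := hq₀ y (hδ₁ (hb1 hy)) (toMat (T y)) (toMat S)
      (ext_mulVec fun v => by rw [← mulVec_mulVec, toMat_mulVec, toMat_mulVec, hST, one_mulVec])
      (ext_mulVec fun v => by rw [← mulVec_mulVec, toMat_mulVec, toMat_mulVec, hTS, one_mulVec])
      (fun v hv => by rw [toMat_mulVec]; exact hiso v hv) a b
    have h2 : ∀ u v : R4, u ⬝ᵥ (q₀ *ᵥ S (N (T y v))) + v ⬝ᵥ (q₀ *ᵥ S (N (T y u))) = 0 := by
      intro u v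
      have h3 := congrArg (fun K : Matrix (Fin 4) (Fin 4) ℝ => u ⬝ᵥ (K *ᵥ v)) h1
      simp only [add_mulVec, dotProduct_add, zero_mulVec, dotProduct_zero] at h3
      rw [mulVec_transpose, dotProduct_comm u (vecMul _ _), ← dotProduct_mulVec] at h3
      simpa only [← mulVec_mulVec, toMat_mulVec] using h3
    have e1 : ∀ u v : R4, q y (N u) v = S v ⬝ᵥ (q₀ *ᵥ S (N (T y (S u)))) := by
      intro u v
      rw [hq₀symm, ← hframe y hy, hTS, hTS, hTS]
    have e2 : ∀ u v : R4, q y u (N v) = S u ⬝ᵥ (q₀ *ᵥ S (N (T y (S v)))) := by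
      intro u v
      rw [← hframe y hy, hTS, hTS, hTS]
    rw [e1, e2, h2]
  have hder : ∀ y ∈ Metric.ball x₀ δ, HasFDerivAt q ((bilinForm (connForm Γ) y).flip (q y)) y :=
    fun y hy => hq'.hasFDerivAt_form (C := ‖matForm q₀‖ + 1) (hsm.mono (hb2.trans hδ₂))
      (fun y hy => by
        have h1 := hqε y (hb2 hy)
        have h2 := norm_add_le (q y - matForm q₀) (matForm q₀)
        rw [sub_add_cancel] at h2
        linarith) hcurv hy
  have hqs : ContDiffOn ℝ ∞ q (Metric.ball x₀ δ) := contDiffOn_of_hasFDerivAt Metric.isOpen_ball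
    (contDiffOn_bilinForm (hsm.mono (hb2.trans hδ₂))) hder
  have hqsymm : ∀ y ∈ Metric.ball x₀ δ, ∀ u v, q y u v = q y v u := by
    intro y hy u v
    obtain ⟨⟨S, hST, hTS⟩, -⟩ := hTy y (hb1 hy)
    rw [← hTS u, ← hTS v, hframe y hy, hframe y hy, hq₀symm]
  have hgdet : ∀ y ∈ Metric.ball x₀ δ, (Matrix.of fun i j => q y (e i) (e j)).det ≠ 0 := by
    intro y hy hdet
    obtain ⟨w, hw0, hw⟩ := Matrix.exists_mulVec_eq_zero_iff.2 hdet
    obtain ⟨⟨S, hST, hTS⟩, -⟩ := hTy y (hb1 hy)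
    have h1 : q₀ *ᵥ S w = 0 := by
      refine dotProduct_eq_zero _ fun u => ?_
      rw [dotProduct_comm, ← hframe y hy, hTS, form_apply_eq_sum, hw, dotProduct_zero]
    have h2 : S w = 0 := Matrix.eq_zero_of_mulVec_eq_zero hq₀det h1
    exact hw0 (by rw [← hTS w, h2, map_zero])
  refine ⟨Metric.ball x₀ δ, Metric.isOpen_ball, Metric.mem_ball_self (lt_min hδ₁0 hδ₂0),
    hb2.trans hδ₂, fun y => Matrix.of fun i j => q y (e i) (e j), ⟨fun i j => ?_,
    fun y hy i j => hqsymm y hy _ _, hgdet⟩, fun y hy c a b => ?_⟩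
  · exact (hqs.clm_apply contDiffOn_const).clm_apply contDiffOn_const
  · refine christoffel_eq (hgdet y hy) (fun i j => hqsymm y hy _ _)
      (hB.1 y (hδ₂ (hb2 hy))) (fun a b d => ?_) c a b
    have h1 := ((hder y hy).clm_apply (hasFDerivAt_const (e b) y)).clm_apply
      (hasFDerivAt_const (e d) y)
    have hBe : ∀ a b, connForm Γ y (e a) (e b) = ∑ k, Γ y k a b • e k := fun a b => by
      rw [← sum_smul_e (connForm Γ y (e a) (e b))]
      simp only [connForm_e_e]
    simp only [of_apply, pd]
    rw [h1.fderiv]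
    simp [bilinForm_apply, hBe, Finset.sum_add_distrib]

end

section

open Matrix

/-! ### Metrics and the holonomy distribution -/

/-- Continuous linear maps on `ℝ⁴` that agree on the coordinate vectors are equal. -/
theorem clm_ext_e {E : Type*} [NormedAddCommGroup E] [NormedSpace ℝ E] {f f' : R4 →L[ℝ] E}
    (h : ∀ a, f (e a) = f' (e a)) : f = f' := by
  ext v
  have h1 := map_eq_sum_e f.toLinearMap v
  have h2 := map_eq_sum_e f'.toLinearMap v
  simp only [ContinuousLinearMap.coe_coe] at h1 h2
  rw [h1, h2]
  exact Finset.sum_congr rfl fun a _ => by rw [h a]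

section Metric

variable {U : Set R4} {g : R4 → Matrix (Fin 4) (Fin 4) ℝ} {Γ : ConnCoeff}

theorem IsPseudoRiemannian.contDiffOn_matForm (hg : IsPseudoRiemannian U g) :
    ContDiffOn ℝ ∞ (fun y => matForm (g y)) U := by
  unfold matForm
  exact ContDiffOn.sum fun i _ => ContDiffOn.sum fun j _ => (hg.smooth i j).smul contDiffOn_const

theorem matForm_e_e (q : Matrix (Fin 4) (Fin 4) ℝ) (i j : Fin 4) : matForm q (e i) (e j) = q i j := by
  simp [matForm_apply, e]

/-- A metric is parallel for its Levi-Civita connection. -/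
theorem IsPseudoRiemannian.fderiv_matForm (hU : IsOpen U) (hg : IsPseudoRiemannian U g)
    (hΓ : ∀ y ∈ U, ∀ c a b, christoffel g y c a b = Γ y c a b) {y : R4} (hy : y ∈ U) (a u v : R4) :
    fderiv ℝ (fun y => matForm (g y)) y a u v =
      matForm (g y) (connForm Γ y a u) v + matForm (g y) u (connForm Γ y a v) := by
  have hd : DifferentiableAt ℝ (fun y => matForm (g y)) y :=
    (hg.contDiffOn_matForm.contDiffAt (hU.mem_nhds hy)).differentiableAt (by simp)
  have key : fderiv ℝ (fun y => matForm (g y)) y =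
      (bilinForm (connForm Γ) y).flip (matForm (g y)) := by
    refine clm_ext_e fun a => clm_ext_e fun b => clm_ext_e fun d => ?_
    have h1 := (hd.hasFDerivAt.clm_apply (hasFDerivAt_const (e b) y)).clm_apply
      (hasFDerivAt_const (e d) y)
    have h2 := pd_metric_of_christoffel hU hg hy a b d
    simp only [pd, ← matForm_e_e (g _) b d] at h2
    rw [h1.fderiv] at h2
    have hBe : ∀ a b, connForm Γ y (e a) (e b) = ∑ k, Γ y k a b • e k := fun a b => by
      rw [← sum_smul_e (connForm Γ y (e a) (e b))]
      simp only [connForm_e_e]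
    simp [hΓ y hy] at h2
    simp [bilinForm_apply, hBe, h2, matForm_e_e, Finset.sum_add_distrib]
  rw [key]
  simp [bilinForm_apply]

/-- The energy `g(v, v)` of a metric. -/
def energy (g : R4 → Matrix (Fin 4) (Fin 4) ℝ) (p : TR4) : ℝ := matForm (g p.1) p.2 p.2

theorem IsPseudoRiemannian.contDiffOn_energy (hg : IsPseudoRiemannian U g) :
    ContDiffOn ℝ ∞ (energy g) (U ×ˢ univ) := by
  have h1 : ContDiffOn ℝ ∞ (fun p : TR4 => matForm (g p.1)) (U ×ˢ univ) :=
    hg.contDiffOn_matForm.comp contDiffOn_fst fun p hp => hp.1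
  exact (h1.clm_apply contDiffOn_snd).clm_apply contDiffOn_snd

theorem IsPseudoRiemannian.fderiv_energy (hU : IsOpen U) (hg : IsPseudoRiemannian U g) {p : TR4}
    (hp : p.1 ∈ U) (q : TR4) : fderiv ℝ (energy g) p q =
      fderiv ℝ (fun y => matForm (g y)) p.1 q.1 p.2 p.2 + 2 * matForm (g p.1) q.2 p.2 := by
  have hd : DifferentiableAt ℝ (fun y => matForm (g y)) p.1 :=
    (hg.contDiffOn_matForm.contDiffAt (hU.mem_nhds hp)).differentiableAt (by simp)
  have hs : matForm (g p.1) p.2 q.2 = matForm (g p.1) q.2 p.2 := by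
    have ht : (g p.1)ᵀ = g p.1 := by ext i j; exact hg.symm _ hp j i
    rw [matForm_apply, matForm_apply, dotProduct_mulVec, ← mulVec_transpose, ht, dotProduct_comm]
  have h1 : HasFDerivAt (fun p : TR4 => matForm (g p.1))
      ((fderiv ℝ (fun y => matForm (g y)) p.1).comp (ContinuousLinearMap.fst ℝ R4 R4)) p :=
    hd.hasFDerivAt.comp p hasFDerivAt_fst
  have h2 := hasFDerivAt_snd (𝕜 := ℝ) (E := R4) (F := R4) (p := p)
  have h3 : HasFDerivAt (energy g) _ p := (h1.clm_apply h2).clm_apply h2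
  rw [h3.fderiv]
  simp [hs]
  ring

theorem IsPseudoRiemannian.fderiv_energy_horizField (hU : IsOpen U) (hg : IsPseudoRiemannian U g)
    (hΓ : ∀ y ∈ U, ∀ c a b, christoffel g y c a b = Γ y c a b) {p : TR4} (hp : p ∈ U ×ˢ univ)
    (a : R4) : fderiv ℝ (energy g) p (horizField (connForm Γ) a p) = 0 := by
  have h := hg.fderiv_matForm hU hΓ hp.1 a p.2 p.2
  have ht : (g p.1)ᵀ = g p.1 := by ext i j; exact hg.symm _ hp.1 j i
  have hs : matForm (g p.1) p.2 (connForm Γ p.1 a p.2) =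
      matForm (g p.1) (connForm Γ p.1 a p.2) p.2 := by
    rw [matForm_apply, matForm_apply, dotProduct_mulVec, ← mulVec_transpose, ht, dotProduct_comm]
  rw [hg.fderiv_energy hU hp.1]
  simp only [horizField]
  rw [h, hs, map_neg, _root_.neg_apply]
  ring

/-- The curvature of a Levi-Civita connection is trace-free. -/
theorem IsPseudoRiemannian.trace_curv (hU : IsOpen U) (hg : IsPseudoRiemannian U g)
    (hsm : ContDiffOn ℝ ∞ (connForm Γ) U)
    (hΓ : ∀ y ∈ U, ∀ c a b, christoffel g y c a b = Γ y c a b) {y : R4} (hy : y ∈ U) (a b : R4) :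
    (toMat (curv (connForm Γ) y a b)).trace = 0 := by
  set R := toMat (curv (connForm Γ) y a b) with hR
  have ht : (g y)ᵀ = g y := by ext i j; exact hg.symm _ hy j i
  have h1 : g y * R + (g y * R)ᵀ = 0 := by
    refine add_transpose_eq_zero fun v => ?_
    have h := fderiv_curv_eq_zero (p := ((y, v) : TR4)) hU (hU.prod isOpen_univ)
      (fun p hp => hp.1) hsm hg.contDiffOn_energy
      (fun p hp a => hg.fderiv_energy_horizField hU hΓ hp a) ⟨hy, mem_univ _⟩ a b
    rw [hg.fderiv_energy hU hy] at h
    simp only [map_zero, _root_.zero_apply, zero_add, matForm_apply, mul_eq_zero,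
      OfNat.ofNat_ne_zero, false_or] at h
    rw [← mulVec_mulVec, hR, toMat_mulVec, dotProduct_mulVec, ← mulVec_transpose, ht,
      dotProduct_comm]
    exact h
  have hu : IsUnit (g y).det := (hg.nondegenerate y hy).isUnit
  have h2 : R = (g y)⁻¹ * (g y * R) := by
    rw [← Matrix.mul_assoc, Matrix.nonsing_inv_mul _ hu, Matrix.one_mul]
  have h3 : R.trace = -R.trace := by
    calc R.trace = ((g y)⁻¹ * (g y * R)).trace := by rw [← h2]
      _ = ((g y * R)ᵀ * ((g y)⁻¹)ᵀ).trace := by rw [← transpose_mul, trace_transpose]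
      _ = -((g y * R) * (g y)⁻¹).trace := by
        rw [eq_neg_of_add_eq_zero_right h1, transpose_nonsing_inv, ht, Matrix.neg_mul, trace_neg]
      _ = -R.trace := by rw [trace_mul_comm, ← h2]
  linarith

end Metric

section Holonomy

variable {M : Set R4} {A : Set TR4} {L : TR4 → ℝ} {Γ : ConnCoeff}

/-- `N` is a smooth field of endomorphisms over `U` that preserves both `L` and `F`. -/
structure IsInvariantField (A : Set TR4) (L : TR4 → ℝ) (U : Set R4) (F : TR4 → ℝ)
    (N : R4 → R4 →L[ℝ] R4) : Prop where
  smooth : ContDiffOn ℝ ∞ N U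
  left : ∀ p ∈ A ∩ (U ×ˢ univ), fderiv ℝ L p (vertField N p) = 0
  right : ∀ p ∈ U ×ˢ (univ : Set R4), fderiv ℝ F p (vertField N p) = 0

/-- The iterated brackets are horizontal coordinate fields or linear vertical fields. -/
theorem IsIteratedBracket.horizontal_or_vertical (hM : IsOpen M) (hL : IsPseudoFinsler M A L)
    (hB : IsCanonicalConnection M A L Γ) {U : Set R4} (hU : IsOpen U) (hUM : U ⊆ M)
    {F : TR4 → ℝ} (hF : ContDiffOn ℝ ∞ F (U ×ˢ univ))
    (hhor : ∀ p ∈ U ×ˢ (univ : Set R4), ∀ a, fderiv ℝ F p (horizField (connForm Γ) a p) = 0)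
    {X : TR4 → TR4} (hX : IsIteratedBracket L X) :
    (∃ a, ∀ q ∈ A ∩ (U ×ˢ univ), X q = horizField (connForm Γ) (e a) q) ∨
      ∃ N, IsInvariantField A L U F N ∧ ∀ q ∈ A ∩ (U ×ˢ univ), X q = vertField N q := by
  have hsm : ContDiffOn ℝ ∞ (connForm Γ) U := (contDiffOn_connForm (hB.contDiffOn hL)).mono hUM
  have hopen : IsOpen (A ∩ (U ×ˢ (univ : Set R4))) :=
    hL.conic.isOpen.inter (hU.prod isOpen_univ)
  have hLs : ContDiffOn ℝ ∞ L (A ∩ (U ×ˢ (univ : Set R4))) := hL.smooth.mono inter_subset_left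
  have hLhor : ∀ p ∈ A ∩ (U ×ˢ (univ : Set R4)), ∀ a,
      fderiv ℝ L p (horizField (connForm Γ) a p) = 0 := fun p hp a =>
    fderiv_horizField_eq_zero hM hL hB hp.1 a
  have hdB : ∀ q ∈ A ∩ (U ×ˢ (univ : Set R4)), DifferentiableAt ℝ (connForm Γ) q.1 := fun q hq =>
    (hsm.contDiffAt (hU.mem_nhds hq.2.1)).differentiableAt (by simp)
  induction hX with
  | base a => exact Or.inl ⟨a, fun q hq => horiz_eq hM hL hB hq.1 a⟩
  | bracket a X hX ih =>
    have ev : ∀ q ∈ A ∩ (U ×ˢ (univ : Set R4)),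
        horiz L a =ᶠ[𝓝 q] horizField (connForm Γ) (e a) := fun q hq => by
      filter_upwards [hopen.mem_nhds hq] with z hz using horiz_eq hM hL hB hz.1 a
    refine Or.inr ?_
    rcases ih with ⟨b, hb⟩ | ⟨N, hN, hXN⟩
    · refine ⟨fun y => curv (connForm Γ) y (e b) (e a), ⟨contDiffOn_curv hU hsm _ _, ?_, ?_⟩, ?_⟩
      · intro p hp
        exact fderiv_curv_eq_zero hU hopen (fun p hp => hp.2.1) hsm hLs hLhor hp _ _
      · intro p hp
        exact fderiv_curv_eq_zero hU (hU.prod isOpen_univ) (fun p hp => hp.1) hsm hF hhor hp _ _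
      · intro q hq
        have evX : X =ᶠ[𝓝 q] horizField (connForm Γ) (e b) := by
          filter_upwards [hopen.mem_nhds hq] with z hz using hb z hz
        rw [(ev q hq).lieBracket_vectorField_eq evX, lieBracket_horiz_horiz (hdB q hq), vertField,
          curv_swap _ _ (e a) (e b), _root_.neg_apply]
    · refine ⟨covDeriv (connForm Γ) (e a) N, ⟨contDiffOn_covDeriv hU hsm hN.smooth _, ?_, ?_⟩, ?_⟩
      · intro p hp
        exact fderiv_covDeriv_eq_zero hU hopen (fun p hp => hp.2.1) hsm hLs hLhor hN.smooth
          hN.left hp _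
      · intro p hp
        exact fderiv_covDeriv_eq_zero hU (hU.prod isOpen_univ) (fun p hp => hp.1) hsm hF hhor
          hN.smooth hN.right hp _
      · intro q hq
        have evX : X =ᶠ[𝓝 q] vertField N := by
          filter_upwards [hopen.mem_nhds hq] with z hz using hXN z hz
        rw [(ev q hq).lieBracket_vectorField_eq evX, lieBracket_horiz_vert (hdB q hq)
          ((hN.smooth.contDiffAt (hU.mem_nhds hq.2.1)).differentiableAt (by simp))]

/-- The vertical holonomy is spanned by the values of linear vertical fields. -/
theorem finrank_verticalHolonomy_le (hM : IsOpen M) (hL : IsPseudoFinsler M A L)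
    (hB : IsCanonicalConnection M A L Γ) {U : Set R4} (hU : IsOpen U) (hUM : U ⊆ M)
    {F : TR4 → ℝ} (hF : ContDiffOn ℝ ∞ F (U ×ˢ univ))
    (hhor : ∀ p ∈ U ×ˢ (univ : Set R4), ∀ a, fderiv ℝ F p (horizField (connForm Γ) a p) = 0)
    {p : TR4} (hp : p ∈ A) (hpU : p.1 ∈ U) :
    Module.finrank ℝ (verticalHolonomy L p) ≤ Module.finrank ℝ
      (Submodule.span ℝ {w : R4 | ∃ N, IsInvariantField A L U F N ∧ N p.1 p.2 = w}) := by
  set W := Submodule.span ℝ {w : R4 | ∃ N, IsInvariantField A L U F N ∧ N p.1 p.2 = w} with hW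
  have h1 : holonomyDistribution L p ≤ W.comap ((LinearMap.snd ℝ R4 R4) +
      ((connForm Γ p.1).flip p.2).toLinearMap.comp (LinearMap.fst ℝ R4 R4)) := by
    refine Submodule.span_le.2 ?_
    rintro w ⟨X, hX, rfl⟩
    rcases hX.horizontal_or_vertical hM hL hB hU hUM hF hhor with ⟨a, ha⟩ | ⟨N, hN, hXN⟩
    · rw [ha p ⟨hp, hpU, mem_univ _⟩]
      simp [horizField]
    · rw [hXN p ⟨hp, hpU, mem_univ _⟩]
      have : N p.1 p.2 ∈ W := Submodule.subset_span ⟨N, hN, rfl⟩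
      simpa [vertField] using this
  have h2 : verticalHolonomy L p ≤ W.map (LinearMap.inr ℝ R4 R4) := by
    rintro ⟨w₁, w₂⟩ ⟨hw, hw0⟩
    have h3 := h1 hw
    have h4 : w₁ = 0 := by simpa using hw0
    subst h4
    exact ⟨w₂, by simpa using h3, rfl⟩
  exact (Submodule.finrank_mono h2).trans (Submodule.finrank_map_le _ _)

end Holonomy

end

section

open Matrix

/-! ### Necessity of the conditions -/

section Linear

/-- Three independent vectors of `ℝ⁴` are completed to a basis by a fourth one. -/
theorem exists_det_vecCons_ne_zero {n : Fin 3 → R4} (hn : LinearIndependent ℝ n) :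
    ∃ k : R4, (Matrix.of (vecCons k n)).det ≠ 0 := by
  have hlt : Submodule.span ℝ (range n) < ⊤ := by
    refine lt_top_iff_ne_top.2 fun h => ?_
    have h1 := finrank_span_eq_card hn
    rw [h, finrank_top] at h1
    simp at h1
  obtain ⟨k, -, hk⟩ := SetLike.exists_of_lt hlt
  refine ⟨k, ?_⟩
  have h1 : LinearIndependent ℝ (Fin.cons k n : Fin 4 → R4) := linearIndependent_finCons.2 ⟨hn, hk⟩
  exact ((Matrix.isUnit_iff_isUnit_det _).1
    ((Matrix.linearIndependent_rows_iff_isUnit (A := Matrix.of (vecCons k n))).1 h1)).ne_zero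

/-- Two functionals on `ℝ⁴` with the same three-dimensional kernel are proportional. -/
theorem exists_eq_smul_of_kernel {n : Fin 3 → R4} {k : R4}
    (hdet : (Matrix.of (vecCons k n)).det ≠ 0) {φ ψ : R4 →L[ℝ] ℝ} (hφ : ∀ i, φ (n i) = 0)
    (hψ : ∀ i, ψ (n i) = 0) (hψ0 : ψ ≠ 0) : ∃ c : ℝ, φ = c • ψ := by
  have key : ∀ χ : R4 →L[ℝ] ℝ, (∀ i, χ (n i) = 0) → χ k = 0 → χ = 0 := by
    intro χ hχ hk
    have h1 : (fun j => χ (e j)) = 0 := by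
      refine Matrix.eq_zero_of_mulVec_eq_zero hdet ?_
      ext i
      have h2 : ∀ w : R4, w ⬝ᵥ (fun j => χ (e j)) = χ w := fun w =>
        (map_eq_sum_e χ.toLinearMap w).symm
      refine Fin.cases ?_ (fun i => ?_) i
      · exact (h2 k).trans hk
      · exact (h2 (n i)).trans (hχ i)
    exact clm_ext_e fun a => by simpa using congrFun h1 a
  have hk : ψ k ≠ 0 := fun h => hψ0 (key ψ hψ h)
  refine ⟨φ k / ψ k, sub_eq_zero.1 (key _ (fun i => ?_) ?_)⟩
  · simp [hφ, hψ]
  · simp [hk]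

theorem contDiffAt_det_vecCons {W : Type*} [NormedAddCommGroup W] [NormedSpace ℝ W]
    {n : W → Fin 3 → R4} {r : WithTop ℕ∞} {x : W} (hn : ∀ i, ContDiffAt ℝ r (fun y => n y i) x)
    (k : R4) : ContDiffAt ℝ r (fun y => (Matrix.of (vecCons k (n y))).det) x := by
  simp only [Matrix.det_apply]
  refine ContDiffAt.sum fun σ _ => (contDiffAt_prod fun i _ => ?_).const_smul _
  refine Fin.cases ?_ (fun j => ?_) (σ i)
  · exact contDiffAt_const
  · exact (contDiffAt_pi.1 (hn j)) i

end Linear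

section QuadraticNear

variable {ℓ : R4 → ℝ} {Ω : Set R4}

theorem fderiv_matForm_self (G : Matrix (Fin 4) (Fin 4) ℝ) :
    fderiv ℝ (fun w => matForm G w w) = fun w => (matForm G + (matForm G).flip) w := by
  ext w u
  have h := (matForm G).hasFDerivAt.clm_apply (hasFDerivAt_id (𝕜 := ℝ) w)
  rw [HasFDerivAt.fderiv (f := fun w => matForm G w w) h]
  simp

/-- A pseudo-Minkowski function that is quadratic on a dense open set is quadratic near every point:
its third derivative vanishes. -/
theorem IsMinkowski.quadratic_near (h : IsMinkowski ℓ Ω)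
    (hq : ∀ Ω' ⊆ Ω, IsOpen Ω' → Ω'.Nonempty → ¬ IsNowhereQuadratic ℓ Ω') {v : R4} (hv : v ∈ Ω) :
    ∃ G : Matrix (Fin 4) (Fin 4) ℝ, ∀ᶠ w in 𝓝 v, ℓ w = w ⬝ᵥ (G *ᵥ w) := by
  have hs2 : ContDiffOn ℝ ∞ (fderiv ℝ (fderiv ℝ ℓ)) Ω :=
    (h.smooth.fderiv_of_isOpen h.isOpen (m := ∞) (by simp)).fderiv_of_isOpen h.isOpen (by simp)
  have hs3 : ContinuousOn (fderiv ℝ (fderiv ℝ (fderiv ℝ ℓ))) Ω :=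
    (hs2.fderiv_of_isOpen h.isOpen (m := ∞) (by simp)).continuousOn
  have h3 : ∀ w ∈ Ω, fderiv ℝ (fderiv ℝ (fderiv ℝ ℓ)) w = 0 := by
    intro w hw
    by_contra hne
    have hopen : IsOpen (Ω ∩ fderiv ℝ (fderiv ℝ (fderiv ℝ ℓ)) ⁻¹' {0}ᶜ) :=
      hs3.isOpen_inter_preimage h.isOpen isOpen_compl_singleton
    have h4 := hq _ inter_subset_left hopen ⟨w, hw, hne⟩
    unfold IsNowhereQuadratic at h4
    push Not at h4
    obtain ⟨Ω'', hsub, hopen'', ⟨u, hu⟩, G, hG⟩ := h4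
    have e0 : ℓ =ᶠ[𝓝 u] fun w => matForm G w w := by
      filter_upwards [hopen''.mem_nhds hu] with z hz
      rw [hG z hz, matForm_apply]
    have e3 := (((e0.fderiv (𝕜 := ℝ)).fderiv (𝕜 := ℝ)).fderiv (𝕜 := ℝ)).self_of_nhds
    refine (hsub hu).2 ?_
    have e4 : ∀ K : R4 →L[ℝ] R4 →L[ℝ] ℝ, fderiv ℝ (fun w => K w) = fun _ => K := fun K => by
      ext w : 1; exact K.fderiv
    rw [mem_singleton_iff, e3, fderiv_matForm_self, e4]
    simp only [fderiv_fun_const, Pi.zero_apply]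
  obtain ⟨r, hr0, hr⟩ := Metric.isOpen_iff.1 h.isOpen v hv
  have hconst : ∀ w ∈ Metric.ball v r, fderiv ℝ (fderiv ℝ ℓ) w = fderiv ℝ (fderiv ℝ ℓ) v :=
    fun w hw => Metric.isOpen_ball.is_const_of_fderiv_eq_zero (convex_ball v r).isPreconnected
      ((hs2.mono hr).differentiableOn (by simp)) (fun z hz => h3 z (hr hz)) hw
      (Metric.mem_ball_self hr0)
  -- Euler's relation for the differential of `ℓ`
  have heuler : ∀ w ∈ Ω, ∀ u, fderiv ℝ (fderiv ℝ ℓ) w u w = fderiv ℝ ℓ w u := by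
    intro w hw u
    have c1 := (h.differentiableAt_fderiv hw).hasFDerivAt.clm_apply (hasFDerivAt_id (𝕜 := ℝ) w)
    have c2 := ((h.differentiableAt hw).hasFDerivAt.const_mul 2).congr_of_eventuallyEq
      (f₁ := fun v => fderiv ℝ ℓ v (id v))
      (by filter_upwards [h.isOpen.mem_nhds hw] with z hz using h.euler z hz)
    have c3 := congrArg (fun f : R4 →L[ℝ] ℝ => f u) (c1.unique c2)
    simp at c3
    linarith
  refine ⟨(1 / 2 : ℝ) • Matrix.of fun i j => fderiv ℝ (fderiv ℝ ℓ) v (e i) (e j), ?_⟩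
  filter_upwards [Metric.ball_mem_nhds v hr0] with w hw
  have h5 := h.euler w (hr hw)
  rw [← heuler w (hr hw) w, hconst w hw, form_apply_eq_sum] at h5
  rw [smul_mulVec, dotProduct_smul, h5, smul_eq_mul]
  ring

end QuadraticNear

section Necessity

variable {M : Set R4} {A : Set TR4} {L : TR4 → ℝ} {Γ : ConnCoeff}

/-- If three endomorphisms that preserve both `ℓ` and a nondegenerate form `G` take independent values
at some vector, then `ℓ` is quadratic near every point. -/
theorem IsMinkowski.quadratic_near_of_three {ℓ : R4 → ℝ} {Ω : Set R4} (h : IsMinkowski ℓ Ω)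
    {G : Matrix (Fin 4) (Fin 4) ℝ} (hG : G.IsSymm) (hdet : G.det ≠ 0) {N : Fin 3 → R4 →L[ℝ] R4}
    (hNℓ : ∀ i, ∀ v ∈ Ω, fderiv ℝ ℓ v (N i v) = 0)
    (hNG : ∀ i, ∀ v : R4, N i v ⬝ᵥ (G *ᵥ v) = 0) {k u : R4}
    (hu : (Matrix.of (vecCons k fun i => N i u)).det ≠ 0) {v : R4} (hv : v ∈ Ω) :
    ∃ a : Matrix (Fin 4) (Fin 4) ℝ, ∀ᶠ w in 𝓝 v, ℓ w = w ⬝ᵥ (a *ᵥ w) := by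
  refine h.quadratic_near (fun Ω' hsub hopen hne hnq => ?_) hv
  -- a nondegenerate form is not identically zero
  obtain ⟨w, hw⟩ : ∃ w : R4, w ⬝ᵥ (G *ᵥ w) ≠ 0 := by
    by_contra! h0
    have h1 := add_transpose_eq_zero h0
    rw [hG.eq] at h1
    have h2 : G = 0 := by
      ext i j
      have := congrFun (congrFun h1 i) j
      simp only [Matrix.add_apply, Matrix.zero_apply] at this ⊢
      linarith
    exact hdet (by rw [h2, det_zero])
  have hφ : ContDiff ℝ ω fun v : R4 => (Matrix.of (vecCons k fun i => N i v)).det :=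
    contDiff_iff_contDiffAt.2 fun v =>
      contDiffAt_det_vecCons (fun i => (N i).contDiff.contDiffAt) k
  refine (h.mono hopen hsub).not_proportional_dense hne hnq hφ hu hG (fun v hv hφv => ?_) hw
  set ψ : R4 →L[ℝ] ℝ := (matForm G).flip v with hψ
  have hψa : ∀ w, ψ w = w ⬝ᵥ (G *ᵥ v) := fun w => by
    rw [hψ, ContinuousLinearMap.flip_apply, matForm_apply]
  have hv0 : v ≠ 0 := by
    rintro rfl
    refine hφv (Matrix.det_eq_zero_of_row_eq_zero 1 fun j => ?_)
    change N 0 0 j = 0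
    rw [map_zero]; rfl
  obtain ⟨c, hc⟩ := exists_eq_smul_of_kernel hφv (φ := fderiv ℝ ℓ v) (ψ := ψ)
    (fun i => hNℓ i v (hsub hv)) (fun i => by rw [hψa, hNG i v]) (fun h0 => hv0 (by
      refine Matrix.eq_zero_of_mulVec_eq_zero hdet (dotProduct_eq_zero _ fun w => ?_)
      rw [dotProduct_comm, ← hψa, h0]; rfl))
  exact ⟨c, fun w => by rw [hc, _root_.smul_apply, hψa, smul_eq_mul]⟩

/-- A metrizable canonical connection has symmetric Ricci tensor. -/
theorem IsLocallyRiemannMetrizable.ricci_symm (hR : IsLocallyRiemannMetrizable M Γ)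
    (hM : IsOpen M) (hL : IsPseudoFinsler M A L) (hB : IsCanonicalConnection M A L Γ) {x : R4}
    (hx : x ∈ M) (b c : Fin 4) : ricci Γ x b c = ricci Γ x c b := by
  obtain ⟨U, hU, hxU, hUM, g, hg, hΓ⟩ := hR x hx
  rw [← sub_eq_zero, ricci_sub_ricci hM hL hB hx]
  exact hg.trace_curv hU ((contDiffOn_connForm (hB.contDiffOn hL)).mono hUM) hΓ hxU _ _

/-- If the canonical connection of a nowhere Riemannian function is metrizable, then the holonomy is
at most two-dimensional: otherwise the metric and `L` are both determined, up to scale, by the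
orbits of the holonomy in the fibres. -/
theorem IsLocallyRiemannMetrizable.finrank_le_two (hR : IsLocallyRiemannMetrizable M Γ)
    (hM : IsOpen M) (hL : IsPseudoFinsler M A L) (hB : IsCanonicalConnection M A L Γ)
    (hnR : IsNonRiemannian M A L) {p : TR4} (hp : p ∈ A) :
    Module.finrank ℝ (verticalHolonomy L p) ≤ 2 := by
  by_contra! hlt
  obtain ⟨x, v⟩ := p
  obtain ⟨U, hU, hxU, hUM, g, hg, hΓ⟩ := hR x (hL.fst_mem hp)
  have h1 := finrank_verticalHolonomy_le hM hL hB hU hUM hg.contDiffOn_energy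
    (fun p hp a => hg.fderiv_energy_horizField hU hΓ hp a) hp hxU
  set s : Set R4 := {w : R4 | ∃ N, IsInvariantField A L U (energy g) N ∧ N x v = w} with hs
  obtain ⟨f, hfs, -, hf⟩ := Submodule.exists_fun_fin_finrank_span_eq ℝ s
  have h3 : 3 ≤ Module.finrank ℝ (Submodule.span ℝ s) := le_trans hlt h1
  have hind : LinearIndependent ℝ (f ∘ Fin.castLE h3) := hf.comp _ (Fin.castLE_injective h3)
  choose N hN hNx using fun i : Fin 3 => hfs (Fin.castLE h3 i)
  obtain ⟨k, hk⟩ := exists_det_vecCons_ne_zero hind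
  have hk' : (Matrix.of (vecCons k fun i => N i x v)).det ≠ 0 := by
    have : (fun i => N i x v) = f ∘ Fin.castLE h3 := funext hNx
    rw [this]; exact hk
  have hcont : ContinuousAt (fun y => (Matrix.of (vecCons k fun i => N i y v)).det) x :=
    (contDiffAt_det_vecCons (fun i => ((hN i).smooth.contDiffAt (hU.mem_nhds hxU)).clm_apply
      contDiffAt_const) k).continuousAt
  obtain ⟨V, hVsub, hV, hxV⟩ := mem_nhds_iff.1
    ((hcont.eventually_ne hk').and (hU.eventually_mem hxU))
  refine hnR V hV (fun y hy => hUM (hVsub hy).2) ⟨x, hxV⟩ ?_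
  rintro ⟨y, w⟩ hyw hyV
  obtain ⟨hdety, hyU⟩ := hVsub hyV
  have ht : (g y).IsSymm := by ext i j; exact hg.symm _ hyU j i
  obtain ⟨a, ha⟩ := (hL.isMinkowski_fibre y).quadratic_near_of_three ht (hg.nondegenerate y hyU)
    (N := fun i => N i y) (fun i v hv => by
      rw [hL.fderiv_fibre hv]
      exact (hN i).left (y, v) ⟨hv, hyU, mem_univ _⟩)
    (fun i v => by
      have := (hN i).right (y, v) ⟨hyU, mem_univ _⟩
      rw [hg.fderiv_energy (p := (y, v)) hU hyU] at this
      simpa [vertField, matForm_apply] using this) hdety hyw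
  refine ⟨a, ?_⟩
  filter_upwards [ha] with u hu
  rw [hu]
  simp only [dotProduct, mulVec, Finset.mul_sum]
  exact Finset.sum_congr rfl fun i _ => Finset.sum_congr rfl fun j _ => by ring

end Necessity

end

end BerwaldFinsler

end


theorem theorem1 (M : Set R4) (hM : IsOpen M) (hM0 : (0 : R4) ∉ M)
    (A : Set TR4) (L : TR4 → ℝ) (Γ : ConnCoeff)
    (hL : IsPseudoFinsler M A L)
    (hsym : IsSphericallySymmetric A L)
    (hBerwald : IsCanonicalConnection M A L Γ)
    (hnonRiem : IsNonRiemannian M A L) :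
    IsLocallyRiemannMetrizable M Γ ↔
      ((∀ p ∈ A, Module.finrank ℝ (verticalHolonomy L p) ≤ 2) ∧
        (∀ x ∈ M, ∀ b c, ricci Γ x b c = ricci Γ x c b)) :=
  ⟨fun h => ⟨fun _ hp => h.finrank_le_two hM hL hBerwald hnonRiem hp,
      fun _ hx b c => h.ricci_symm hM hL hBerwald hx b c⟩,
    fun h => isLocallyRiemannMetrizable hM hL hsym hBerwald h.1 h.2⟩
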